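/- \textbf{Model.} For $n\ge 1$ let $\pi$ be a permutation of $[n]=\{1,\dots,n\}$. A \emph{program} is a deterministic imperative program with a fixed finite number of variables, each storing one non-negative integer and initially $0$. It is built by sequencing, if-then-else and while loops, whose conditions compare two variables ($=,\neq,<,\le$), from the commands: do nothing; assign to a variable a constant, the number $n$, the value of a variable, the sum of two variables, or their difference truncated at $0$; assign $x:=\pi(y)$ by a query to a read-only oracle for $\pi$ (allowed only if $y\in[n]$); report the element of $[n]$ stored in a variable. Each command and each evaluation of a condition is one step; the \emph{time} is the number of steps. The \emph{space} is the maximum, over all moments of the run, of the total number of binary digits of the values of all variables (where $0$ has no digits). \textbf{Theorem.} For every real $\varepsilon>0$ there are a program $P_\varepsilon$ (not depending on $n$ or $\pi$) and a constant $C_\varepsilon$ such that for every $n\ge 1$ and every permutation $\pi$ of $[n]$, the program $P_\varepsilon$ with oracle $\pi$ halts, reports exactly one element (the leader) of each cycle of $\pi$ (fixed points included), each leader exactly once, takes time at most $C_\varepsilon\, n^{1+\varepsilon}$, and uses at most $C_\varepsilon\log_2(n+1)$ bits of space. In other words, for every $\varepsilon>0$ the cycle leaders problem is solved in $O_\varepsilon(n^{1+\varepsilon})$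 time with $O_\varepsilon(\log n)$ bits of extra space. -/

import Mathlib

namespace CycleLeaders

/-- The set `[n] = {1, …, n}`, as a type. -/
abbrev Elem (n : ℕ) : Type := Set.Icc (1 : ℕ) n

/-- Comparisons of two variables, used as conditions of branches and loops. -/
inductive Test (k : ℕ) : Type
  | eq (x y : Fin k)
  | ne (x y : Fin k)
  | lt (x y : Fin k)
  | le (x y : Fin k)

/-- Deterministic imperative programs over a fixed number `k` of variables, each of which stores
one natural number. There are no arrays, no recursion and no indirect addressing. The only access
to the input is `size`, which gives `n`, and `query`, which asks the oracle for one value of the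
permutation. The output (`report`) is write-only. -/
inductive Prog (k : ℕ) : Type
  | skip
  /-- `x := c` for a literal `c` -/
  | const (x : Fin k) (c : ℕ)
  /-- `x := n` -/
  | size (x : Fin k)
  /-- `x := y` -/
  | copy (x y : Fin k)
  /-- `x := y + z` -/
  | add (x y z : Fin k)
  /-- `x := max (y - z) 0` -/
  | sub (x y z : Fin k)
  /-- `x := π(y)` -/
  | query (x y : Fin k)
  /-- report the element stored in `y` -/
  | report (y : Fin k)
  | seq (p q : Prog k)
  | ite (c : Test k) (p q : Prog k)
  | while (c : Test k) (p : Prog k)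

/-- The content of the memory: the values of the `k` variables. -/
abbrev State (k : ℕ) : Type := Fin k → ℕ

/-- The truth value of a comparison. -/
def Test.Holds {k : ℕ} (σ : State k) : Test k → Prop
  | .eq x y => σ x = σ y
  | .ne x y => σ x ≠ σ y
  | .lt x y => σ x < σ y
  | .le x y => σ x ≤ σ y

/-- The number of bits in use: the total length of the binary expansions of all variables. -/
def bits {k : ℕ} (σ : State k) : ℕ := ∑ x, Nat.size (σ x)

/-- `Exec π p σ σ' t s out`: with oracle access to the permutation `π` of `[n]`, the program `p`,
started with memory content `σ`, halts with memory content `σ'` after exactly `t` steps, the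
largest number of bits in use at any moment (start and end included) is `s`, and `out` is the list
of the reported elements, in the order of reporting.

Every elementary command and every evaluation of a condition is one step. A program that queries
or reports a number outside `[n]` is stuck, and so has no execution. -/
inductive Exec {n k : ℕ} (π : Equiv.Perm (Elem n)) :
    Prog k → State k → State k → ℕ → ℕ → List (Elem n) → Prop
  | skip (σ : State k) :
      Exec π .skip σ σ 1 (bits σ) []
  | const (σ : State k) (x : Fin k) (c : ℕ) :
      Exec π (.const x c) σ (Function.update σ x c) 1
        (max (bits σ) (bits (Function.update σ x c))) []
  | size (σ : State k) (x : Fin k) :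
      Exec π (.size x) σ (Function.update σ x n) 1
        (max (bits σ) (bits (Function.update σ x n))) []
  | copy (σ : State k) (x y : Fin k) :
      Exec π (.copy x y) σ (Function.update σ x (σ y)) 1
        (max (bits σ) (bits (Function.update σ x (σ y)))) []
  | add (σ : State k) (x y z : Fin k) :
      Exec π (.add x y z) σ (Function.update σ x (σ y + σ z)) 1
        (max (bits σ) (bits (Function.update σ x (σ y + σ z)))) []
  | sub (σ : State k) (x y z : Fin k) :
      Exec π (.sub x y z) σ (Function.update σ x (σ y - σ z)) 1
        (max (bits σ) (bits (Function.update σ x (σ y - σ z)))) []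
  | query (σ : State k) (x y : Fin k) (i : Elem n) (hi : σ y = i) :
      Exec π (.query x y) σ (Function.update σ x (π i)) 1
        (max (bits σ) (bits (Function.update σ x (π i)))) []
  | report (σ : State k) (y : Fin k) (i : Elem n) (hi : σ y = i) :
      Exec π (.report y) σ σ 1 (bits σ) [i]
  | seq {p q : Prog k} {σ₁ σ₂ σ₃ : State k} {t₁ t₂ s₁ s₂ : ℕ} {out₁ out₂ : List (Elem n)}
      (hp : Exec π p σ₁ σ₂ t₁ s₁ out₁) (hq : Exec π q σ₂ σ₃ t₂ s₂ out₂) :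
      Exec π (.seq p q) σ₁ σ₃ (t₁ + t₂) (max s₁ s₂) (out₁ ++ out₂)
  | iteTrue {c : Test k} {p q : Prog k} {σ₁ σ₂ : State k} {t s : ℕ} {out : List (Elem n)}
      (hc : c.Holds σ₁) (hp : Exec π p σ₁ σ₂ t s out) :
      Exec π (.ite c p q) σ₁ σ₂ (1 + t) s out
  | iteFalse {c : Test k} {p q : Prog k} {σ₁ σ₂ : State k} {t s : ℕ} {out : List (Elem n)}
      (hc : ¬ c.Holds σ₁) (hq : Exec π q σ₁ σ₂ t s out) :
      Exec π (.ite c p q) σ₁ σ₂ (1 + t) s out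
  | whileTrue {c : Test k} {p : Prog k} {σ₁ σ₂ σ₃ : State k} {t₁ t₂ s₁ s₂ : ℕ}
      {out₁ out₂ : List (Elem n)} (hc : c.Holds σ₁) (hp : Exec π p σ₁ σ₂ t₁ s₁ out₁)
      (hw : Exec π (.while c p) σ₂ σ₃ t₂ s₂ out₂) :
      Exec π (.while c p) σ₁ σ₃ (1 + t₁ + t₂) (max s₁ s₂) (out₁ ++ out₂)
  | whileFalse {c : Test k} {p : Prog k} {σ : State k} (hc : ¬ c.Holds σ) :
      Exec π (.while c p) σ σ 1 (bits σ) []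

/-- The list `out` contains exactly one element of each cycle of `π` (fixed points are cycles of
length one), and contains it only once. -/
def IsLeaderList {n : ℕ} (π : Equiv.Perm (Elem n)) (out : List (Elem n)) : Prop :=
  out.Nodup ∧ ∀ i : Elem n, ∃! j : Elem n, j ∈ out ∧ π.SameCycle i j

end CycleLeaders

/-! Let `q` be the least positive number with `n ≤ q ^ c`, so that `q` is about `n ^ (1/c)`. A table
with `K` rows of `m` hash functions `x ↦ (a x + b) mod p`, each selecting `x` when the residue is
below `p / q`, gives every `x` a level: the number of initial rows in which some function selects
`x`. The leader of a cycle is its element of highest level, the smallest number among ties. To test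
`x`, walk from `x` until an element with priority or `x` itself is met. The table has constantly
many entries, each at most `q ^ 4`, so it fits into `O(log n)` bits, and levels are recomputed on
demand.

Cost of walking: for a fixed level `r`, stop each walk once it has met `q ^ 2` elements of its own
level. Then at most `q ^ 2 + 1` of these walks pass through any one element, because the walk that
started farthest back has met all the other starts (`sum_walkTime_le`). Hence any table, good or
bad, is evaluated at one level within about `n q ^ 2` steps of walking. If no walk is stopped by the
limit, then the unlimited walks are equally cheap (`sum_walkLen_le`).

Construction of the table: the slots are filled greedily, each by trying all triples below `q ^ 4`.
A walk stopped by the limit has a window of `q ^ 2` elements of its level. A function that selects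
one of them lifts it above `r`, and the walk then ends there (`Unfinished.of_increase`). Pairwise
independence and Chebyshev's inequality show that some function misses only a fraction `O(1/q)` of
the windows while selecting only a fraction `O(1/q)` of the elements (`exists_hash`). Both constants
are at most `c + 3`, so each slot reduces the number of unfinished walks by the factor `(c + 3) / q`
(`exists_improves`), and `2c + 1` slots reduce it below one when `q ≥ (c + 3) ^ 2` (`rowTab_spec`,
`eq_zero_of_pow_mul_le`). Likewise each row passes on only a fraction `m (c + 3) / q` of the
elements, so that for large `q` no element gets through all `2c + 1` rows (`numGe_allTab`). Later
rows do not spoil this, since they only affect levels above `r`. If `q` is below a constant, then so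
is `n`, and a quadratic bound suffices.

The total time is `O(n q ^ 18 log² n)`, and `c ≥ 36 / ε` makes this `O(n ^ (1 + ε))`. -/

namespace CycleLeaders

/-! ### Named registers, and runs with bounds for time and register size -/

/-- Scratch registers of the arithmetic routines and of the level computation. -/
structure Lo where
  mx : ℕ
  my : ℕ
  acc : ℕ
  mi : ℕ
  dy : ℕ
  dz : ℕ
  dw : ℕ
  hp : ℕ
  ha : ℕ
  hb : ℕ
  hit : ℕ
  fl : ℕ
  ci : ℕ

/-- Scratch registers that are all zero. -/
def Lo.zero : Lo := ⟨0, 0, 0, 0, 0, 0, 0, 0, 0, 0, 0, 0, 0⟩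

/-- The memory of the programs below, with named registers. -/
structure Mem where
  lo : Lo
  lx : ℕ
  lv : ℕ
  rr : ℕ
  wlim : ℕ
  wr : ℕ
  wy : ℕ
  cnt : ℕ
  res : ℕ
  ex : ℕ
  eu : ℕ
  en : ℕ
  eh : ℕ
  sp : ℕ
  sa : ℕ
  sb : ℕ
  bp : ℕ
  ba : ℕ
  bb : ℕ
  ta : ℕ
  tb : ℕ
  q : ℕ
  M : ℕ
  L : ℕ
  nn : ℕ
  one : ℕ
  zero : ℕ
  tab : ℕ → ℕ → Fin 3 → ℕ

/-- Names of registers. -/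
inductive Reg (K m : ℕ) : Type
  | mx | my | acc | mi | dy | dz | dw | hp | ha | hb | hit | fl | ci
  | lx | lv | rr | wlim | wr | wy | cnt | res | ex | eu | en | eh
  | sp | sa | sb | bp | ba | bb | ta | tb | q | M | L | nn | one | zero
  | slot (i : Fin K) (j : Fin m) (c : Fin 3)
  deriving DecidableEq, Fintype

/-- The table `T` with the entry `(i, j, c)` replaced by `v`. -/
def updTab (T : ℕ → ℕ → Fin 3 → ℕ) (i j : ℕ) (c : Fin 3) (v : ℕ) : ℕ → ℕ → Fin 3 → ℕ :=
  fun i' j' c' => if i' = i ∧ j' = j ∧ c' = c then v else T i' j' c'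

variable {K m n : ℕ}

/-- The content of a register. -/
def Mem.get (s : Mem) : Reg K m → ℕ
  | .mx => s.lo.mx | .my => s.lo.my | .acc => s.lo.acc | .mi => s.lo.mi
  | .dy => s.lo.dy | .dz => s.lo.dz | .dw => s.lo.dw
  | .hp => s.lo.hp | .ha => s.lo.ha | .hb => s.lo.hb | .hit => s.lo.hit
  | .fl => s.lo.fl | .ci => s.lo.ci
  | .lx => s.lx | .lv => s.lv | .rr => s.rr | .wlim => s.wlim | .wr => s.wr | .wy => s.wy
  | .cnt => s.cnt | .res => s.res | .ex => s.ex | .eu => s.eu | .en => s.en | .eh => s.eh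
  | .sp => s.sp | .sa => s.sa | .sb => s.sb | .bp => s.bp | .ba => s.ba | .bb => s.bb
  | .ta => s.ta | .tb => s.tb | .q => s.q | .M => s.M | .L => s.L | .nn => s.nn
  | .one => s.one | .zero => s.zero | .slot i j c => s.tab i j c

/-- The memory after writing `v` into a register. -/
def Mem.set (s : Mem) (v : ℕ) : Reg K m → Mem
  | .mx => { s with lo := { s.lo with mx := v } }
  | .my => { s with lo := { s.lo with my := v } }
  | .acc => { s with lo := { s.lo with acc := v } }
  | .mi => { s with lo := { s.lo with mi := v } }
  | .dy => { s with lo := { s.lo with dy := v } }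
  | .dz => { s with lo := { s.lo with dz := v } }
  | .dw => { s with lo := { s.lo with dw := v } }
  | .hp => { s with lo := { s.lo with hp := v } }
  | .ha => { s with lo := { s.lo with ha := v } }
  | .hb => { s with lo := { s.lo with hb := v } }
  | .hit => { s with lo := { s.lo with hit := v } }
  | .fl => { s with lo := { s.lo with fl := v } }
  | .ci => { s with lo := { s.lo with ci := v } }
  | .lx => { s with lx := v } | .lv => { s with lv := v } | .rr => { s with rr := v }
  | .wlim => { s with wlim := v } | .wr => { s with wr := v } | .wy => { s with wy := v }
  | .cnt => { s with cnt := v } | .res => { s with res := v } | .ex => { s with ex := v }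
  | .eu => { s with eu := v } | .en => { s with en := v } | .eh => { s with eh := v }
  | .sp => { s with sp := v } | .sa => { s with sa := v } | .sb => { s with sb := v }
  | .bp => { s with bp := v } | .ba => { s with ba := v } | .bb => { s with bb := v }
  | .ta => { s with ta := v } | .tb => { s with tb := v } | .q => { s with q := v }
  | .M => { s with M := v } | .L => { s with L := v } | .nn => { s with nn := v }
  | .one => { s with one := v } | .zero => { s with zero := v }
  | .slot i j c => { s with tab := updTab s.tab i j c v }

theorem Mem.get_set (s : Mem) (v : ℕ) (r r' : Reg K m) :
    (s.set v r).get r' = if r' = r then v else s.get r' := by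
  cases r
  case slot i j c =>
    cases r' <;> simp [Mem.get, Mem.set, updTab, Fin.ext_iff]
  all_goals cases r' <;> rfl

/-- The number of registers. -/
abbrev numRegs (K m : ℕ) : ℕ := Fintype.card (Reg K m)

/-- The variable that holds a register. -/
noncomputable def vr (r : Reg K m) : Fin (numRegs K m) := Fintype.equivFin (Reg K m) r

/-- The memory as the values of the program variables. -/
noncomputable def encode (K m : ℕ) (s : Mem) : State (numRegs K m) :=
  fun i => s.get ((Fintype.equivFin (Reg K m)).symm i)

@[simp] theorem encode_vr (s : Mem) (r : Reg K m) : encode K m s (vr r) = s.get r := by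
  simp [encode, vr]

theorem encode_set (s : Mem) (v : ℕ) (r : Reg K m) :
    encode K m (s.set v r) = Function.update (encode K m s) (vr r) v := by
  funext i
  obtain ⟨r', rfl⟩ := (Fintype.equivFin (Reg K m)).surjective i
  change encode K m (s.set v r) (vr r') = Function.update (encode K m s) (vr r) v (vr r')
  have : vr r' = vr r ↔ r' = r := by simp [vr]
  rw [encode_vr, Mem.get_set, Function.update_apply, encode_vr]
  simp only [this]

/-- All registers hold values that are at most `B`. -/
def Mem.Bdd (K m : ℕ) (s : Mem) (B : ℕ) : Prop := ∀ r : Reg K m, s.get r ≤ B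

theorem Mem.Bdd.set {s : Mem} {B v : ℕ} (h : s.Bdd K m B) (hv : v ≤ B) (r : Reg K m) :
    (s.set v r).Bdd K m B := by
  intro r'
  rw [Mem.get_set]
  split_ifs
  · exact hv
  · exact h r'

theorem bits_encode_le {s : Mem} {B : ℕ} (h : s.Bdd K m B) :
    bits (encode K m s) ≤ numRegs K m * Nat.size B := by
  unfold bits
  calc ∑ x, Nat.size (encode K m s x) ≤ ∑ _x : Fin (numRegs K m), Nat.size B :=
        Finset.sum_le_sum fun i _ => Nat.size_le_size (h _)
    _ = numRegs K m * Nat.size B := by simp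

/-- `Runs π B p s s' T out`: started in `s`, the program `p` halts in `s'` after at most `T` steps
with output `out`, and no register exceeds `B` on the way, provided that none does so in `s`. -/
def Runs (π : Equiv.Perm (Elem n)) (B : ℕ) (p : Prog (numRegs K m)) (s s' : Mem) (T : ℕ)
    (out : List (Elem n)) : Prop :=
  s.Bdd K m B → s'.Bdd K m B ∧ ∃ t ≤ T, ∃ sp ≤ numRegs K m * Nat.size B,
    Exec π p (encode K m s) (encode K m s') t sp out

variable {π : Equiv.Perm (Elem n)} {B : ℕ} {p p' : Prog (numRegs K m)} {s s' s'' : Mem}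
  {T T' : ℕ} {out out' : List (Elem n)}

/-- `Runs` already assumes the bound for the initial memory, so a proof may use it; this is how
facts such as `M ≤ B` become available. -/
theorem Runs.of_bdd (h : s.Bdd K m B → Runs π B p s s' T out) : Runs π B p s s' T out :=
  fun hs => h hs hs

theorem Runs.mono (h : Runs π B p s s' T out) (hT : T ≤ T') : Runs π B p s s' T' out := by
  intro hs
  obtain ⟨h1, t, ht, h2⟩ := h hs
  exact ⟨h1, t, ht.trans hT, h2⟩

theorem Runs.congr (h : Runs π B p s s' T out) (hs : s' = s'') (hT : T ≤ T') :
    Runs π B p s s'' T' out := hs ▸ h.mono hT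

theorem Runs.seq (h : Runs π B p s s' T out) (h' : Runs π B p' s' s'' T' out') :
    Runs π B (.seq p p') s s'' (T + T') (out ++ out') := by
  intro hs
  obtain ⟨h1, t, ht, sp, hsp, he⟩ := h hs
  obtain ⟨h1', t', ht', sp', hsp', he'⟩ := h' h1
  exact ⟨h1', t + t', by omega, max sp sp', max_le hsp hsp', .seq he he'⟩

theorem Runs.seq_nil (h : Runs π B p s s' T []) (h' : Runs π B p' s' s'' T' out') :
    Runs π B (.seq p p') s s'' (T + T') out' := h.seq h'

theorem Runs.skip : Runs (K := K) (m := m) π B .skip s s 1 [] :=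
  fun hs => ⟨hs, 1, le_rfl, _, bits_encode_le hs, .skip _⟩

theorem Runs.of_set (r : Reg K m) (v : ℕ) (hv : s.Bdd K m B → v ≤ B)
    (h : Exec π p (encode K m s) (Function.update (encode K m s) (vr r) v) 1
      (max (bits (encode K m s)) (bits (Function.update (encode K m s) (vr r) v))) out) :
    Runs π B p s (s.set v r) 1 out := by
  intro hs
  have hs' := hs.set (hv hs) r
  rw [← encode_set] at h
  exact ⟨hs', 1, le_rfl, _, max_le (bits_encode_le hs) (bits_encode_le hs'), h⟩

/-- `r := c` -/
noncomputable def iCst (r : Reg K m) (c : ℕ) : Prog (numRegs K m) := .const (vr r) c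
/-- `r := n` -/
noncomputable def iSiz (r : Reg K m) : Prog (numRegs K m) := .size (vr r)
/-- `r := a` -/
noncomputable def iCpy (r a : Reg K m) : Prog (numRegs K m) := .copy (vr r) (vr a)
/-- `r := a + b` -/
noncomputable def iPlus (r a b : Reg K m) : Prog (numRegs K m) := .add (vr r) (vr a) (vr b)
/-- `r := a - b` -/
noncomputable def iMinus (r a b : Reg K m) : Prog (numRegs K m) := .sub (vr r) (vr a) (vr b)
/-- `r := π(a)` -/
noncomputable def iAsk (r a : Reg K m) : Prog (numRegs K m) := .query (vr r) (vr a)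
/-- report the content of `r` -/
noncomputable def iTell (r : Reg K m) : Prog (numRegs K m) := .report (vr r)

theorem Runs.cst (r : Reg K m) (c : ℕ) (hc : c ≤ B) :
    Runs π B (iCst r c) s (s.set c r) 1 [] :=
  .of_set r c (fun _ => hc) (.const _ _ _)

theorem Runs.siz (r : Reg K m) (hc : n ≤ B) : Runs π B (iSiz r) s (s.set n r) 1 [] :=
  .of_set r n (fun _ => hc) (.size _ _)

theorem Runs.cpy (r a : Reg K m) : Runs π B (iCpy r a) s (s.set (s.get a) r) 1 [] :=
  .of_set r _ (fun h => h a) (by simpa [iCpy] using Exec.copy (π := π) (encode K m s) (vr r) (vr a))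

theorem Runs.plus (r a b : Reg K m) (h : s.Bdd K m B → s.get a + s.get b ≤ B) :
    Runs π B (iPlus r a b) s (s.set (s.get a + s.get b) r) 1 [] :=
  .of_set r _ h (by simpa [iPlus] using Exec.add (π := π) (encode K m s) (vr r) (vr a) (vr b))

theorem Runs.minus (r a b : Reg K m) :
    Runs π B (iMinus r a b) s (s.set (s.get a - s.get b) r) 1 [] :=
  .of_set r _ (fun h => (Nat.sub_le _ _).trans (h a))
    (by simpa [iMinus] using Exec.sub (π := π) (encode K m s) (vr r) (vr a) (vr b))

theorem Runs.ask (r a : Reg K m) (i : Elem n) (hi : s.get a = i) (hn : n ≤ B) :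
    Runs π B (iAsk r a) s (s.set (π i) r) 1 [] :=
  .of_set r _ (fun _ => (π i).2.2.trans hn)
    (Exec.query (π := π) (encode K m s) (vr r) (vr a) i (by simpa using hi))

theorem Runs.tell (r : Reg K m) (i : Elem n) (hi : s.get r = i) :
    Runs π B (iTell r) s s 1 [i] :=
  fun hs => ⟨hs, 1, le_rfl, _, bits_encode_le hs, .report _ _ i (by simpa using hi)⟩

theorem Runs.ite {c : Test (numRegs K m)} (h1 : c.Holds (encode K m s) → Runs π B p s s' T out)
    (h2 : ¬ c.Holds (encode K m s) → Runs π B p' s s' T out) :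
    Runs π B (.ite c p p') s s' (T + 1) out := by
  intro hs
  by_cases hc : c.Holds (encode K m s)
  · obtain ⟨h, t, ht, sp, hsp, he⟩ := h1 hc hs
    exact ⟨h, 1 + t, by omega, sp, hsp, .iteTrue hc he⟩
  · obtain ⟨h, t, ht, sp, hsp, he⟩ := h2 hc hs
    exact ⟨h, 1 + t, by omega, sp, hsp, .iteFalse hc he⟩

/-- The memory `st j` before each round is given in closed form, so a loop invariant becomes an
equality of memories and the only induction is this one. -/
theorem Runs.while {c : Test (numRegs K m)} (N : ℕ) (st : ℕ → Mem) (T : ℕ → ℕ)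
    (o : ℕ → List (Elem n)) (hc : ∀ j < N, c.Holds (encode K m (st j)))
    (hb : ∀ j < N, Runs π B p (st j) (st (j + 1)) (T j) (o j))
    (hN : ¬ c.Holds (encode K m (st N))) :
    Runs π B (.while c p) (st 0) (st N) (∑ j ∈ Finset.range N, (T j + 1) + 1)
      ((List.range N).flatMap o) := by
  induction N generalizing st T o with
  | zero => exact fun hs => ⟨hs, 1, by simp, _, bits_encode_le hs, .whileFalse hN⟩
  | succ N ih =>
    intro hs
    obtain ⟨h1, t, ht, sp, hsp, he⟩ := hb 0 (by omega) hs
    obtain ⟨h1', t', ht', sp', hsp', he'⟩ := ih (fun j => st (j + 1)) (fun j => T (j + 1))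
      (fun j => o (j + 1)) (fun j hj => hc _ (by omega)) (fun j hj => hb _ (by omega)) hN h1
    refine ⟨h1', 1 + t + t', ?_, max sp sp', max_le hsp hsp', ?_⟩
    · rw [Finset.sum_range_succ']
      omega
    · have := Exec.whileTrue (hc 0 (by omega)) he he'
      simpa [List.range_succ_eq_map, List.flatMap_map] using this

theorem Runs.while_nil {c : Test (numRegs K m)} (N : ℕ) (st : ℕ → Mem) (T : ℕ → ℕ)
    (hc : ∀ j < N, c.Holds (encode K m (st j)))
    (hb : ∀ j < N, Runs π B p (st j) (st (j + 1)) (T j) [])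
    (hN : ¬ c.Holds (encode K m (st N))) :
    Runs π B (.while c p) (st 0) (st N) (∑ j ∈ Finset.range N, (T j + 1) + 1) [] := by
  have := Runs.while N st T (fun _ => []) hc hb hN
  rwa [List.flatMap_eq_nil_iff.2 fun _ _ => rfl] at this

theorem Runs.while_const {c : Test (numRegs K m)} (N : ℕ) (st : ℕ → Mem) (T : ℕ)
    (hc : ∀ j < N, c.Holds (encode K m (st j)))
    (hb : ∀ j < N, Runs π B p (st j) (st (j + 1)) T [])
    (hN : ¬ c.Holds (encode K m (st N))) :
    Runs π B (.while c p) (st 0) (st N) (N * (T + 1) + 1) [] := by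
  simpa using Runs.while_nil N st (fun _ => T) hc hb hN

/-- The programs `f 0`, …, `f (N - 1)`, one after the other. -/
def unroll {k : ℕ} : (N : ℕ) → (Fin N → Prog k) → Prog k
  | 0, _ => .skip
  | N + 1, f => .seq (unroll N fun i => f i.castSucc) (f (Fin.last N))

theorem Runs.unroll (N : ℕ) (f : Fin N → Prog (numRegs K m)) (st : ℕ → Mem)
    (hb : ∀ i : Fin N, Runs π B (f i) (st i) (st (i + 1)) T []) :
    Runs π B (unroll N f) (st 0) (st N) (N * T + 1) [] := by
  induction N with
  | zero => exact Runs.skip.mono (by simp)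
  | succ N ih =>
    refine ((ih (fun i => f i.castSucc) fun i => hb i.castSucc).seq
      (hb (Fin.last N))).mono ?_
    simp [add_mul]; omega

/-- The condition `a < b`. -/
noncomputable def tlt (a b : Reg K m) : Test (numRegs K m) := .lt (vr a) (vr b)
/-- The condition `a ≤ b`. -/
noncomputable def tle (a b : Reg K m) : Test (numRegs K m) := .le (vr a) (vr b)
/-- The condition `a = b`. -/
noncomputable def teq (a b : Reg K m) : Test (numRegs K m) := .eq (vr a) (vr b)

@[simp] theorem tlt_holds (a b : Reg K m) :
    (tlt a b).Holds (encode K m s) ↔ s.get a < s.get b := by simp [tlt, Test.Holds]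
@[simp] theorem tle_holds (a b : Reg K m) :
    (tle a b).Holds (encode K m s) ↔ s.get a ≤ s.get b := by simp [tle, Test.Holds]
@[simp] theorem teq_holds (a b : Reg K m) :
    (teq a b).Holds (encode K m s) ↔ s.get a = s.get b := by simp [teq, Test.Holds]

theorem Runs.iteLt {a b : Reg K m} (h1 : s.get a < s.get b → Runs π B p s s' T out)
    (h2 : s.get b ≤ s.get a → Runs π B p' s s' T out) :
    Runs π B (.ite (tlt a b) p p') s s' (T + 1) out :=
  .ite (fun h => h1 (by simpa using h)) fun h => h2 (by simpa using h)

theorem Runs.iteLe {a b : Reg K m} (h1 : s.get a ≤ s.get b → Runs π B p s s' T out)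
    (h2 : s.get b < s.get a → Runs π B p' s s' T out) :
    Runs π B (.ite (tle a b) p p') s s' (T + 1) out :=
  .ite (fun h => h1 (by simpa using h)) fun h => h2 (by simpa using h)

theorem Runs.iteEq {a b : Reg K m} (h1 : s.get a = s.get b → Runs π B p s s' T out)
    (h2 : s.get a ≠ s.get b → Runs π B p' s s' T out) :
    Runs π B (.ite (teq a b) p p') s s' (T + 1) out :=
  .ite (fun h => h1 (by simpa using h)) fun h => h2 (by simpa using h)

end CycleLeaders

/-! ### Multiplication, remainders and the evaluation of one hash function -/

namespace CycleLeaders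

variable {K m n : ℕ} {π : Equiv.Perm (Elem n)} {B : ℕ} {p p' : Prog (numRegs K m)}
  {s s' s'' : Mem} {T T' : ℕ} {out out' : List (Elem n)}

infixr:60 " ⨾ " => Prog.seq

theorem Runs.start (h : Runs π B p s s' T out) (hs : s'' = s) : Runs π B p s'' s' T out := hs ▸ h

theorem Runs.while_stop {c : Test (numRegs K m)} (hc : ¬ c.Holds (encode K m s)) :
    Runs π B (.while c p) s s 1 [] :=
  fun hs => ⟨hs, 1, le_rfl, _, bits_encode_le hs, .whileFalse hc⟩

theorem Runs.while_step {c : Test (numRegs K m)} (hc : c.Holds (encode K m s))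
    (h : Runs π B p s s' T []) (h' : Runs π B (.while c p) s' s'' T' []) :
    Runs π B (.while c p) s s'' (1 + T + T') [] := by
  intro hs
  obtain ⟨h1, t, ht, sp, hsp, he⟩ := h hs
  obtain ⟨h1', t', ht', sp', hsp', he'⟩ := h' h1
  exact ⟨h1', 1 + t + t', by omega, max sp sp', max_le hsp hsp', .whileTrue hc he he'⟩

/-- `d := x * y` by repeated addition. -/
noncomputable def mulP (d x y : Reg K m) : Prog (numRegs K m) :=
  iCpy .mx x ⨾ iCpy .my y ⨾ iCst .acc 0 ⨾ iCst .mi 0 ⨾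
  .while (tlt .mi .my) (iPlus .acc .acc .mx ⨾ iPlus .mi .mi .one) ⨾
  iCpy d .acc ⨾ iCst .mx 0 ⨾ iCst .my 0 ⨾ iCst .acc 0 ⨾ iCst .mi 0

/-- The memory with the registers used by `mulP` cleared. -/
def Mem.clearMul (s : Mem) : Mem :=
  { s with lo := { s.lo with mx := 0, my := 0, acc := 0, mi := 0 } }

/-- Time linear in the second factor is affordable: that factor is always a table entry, `q` or a
constant. `hy` and `hd` express that `y` is not overwritten by the first copy and that `d` is not a
scratch register; for concrete registers they hold by `rfl`. -/
theorem runs_mulP {d x y : Reg K m} (h1 : s.one = 1) (hB : s.get x * s.get y ≤ B)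
    (hy : ∀ a, (s.set a (.mx : Reg K m)).get y = s.get y)
    (hd : ∀ a b c e v, Mem.clearMul (Mem.set { s with lo :=
      { s.lo with mx := a, my := b, acc := c, mi := e } } v d) = Mem.set s.clearMul v d) :
    Runs π B (mulP d x y) s (s.clearMul.set (s.get x * s.get y) d) (3 * s.get y + 10) [] := by
  refine .of_bdd fun hs => ?_
  have hyB := hs y
  set X := s.get x with hX
  set Y := s.get y with hY
  have loop := Runs.while_const (π := π) (B := B) (c := tlt (K := K) (m := m) .mi .my)
    (p := iPlus .acc .acc .mx ⨾ iPlus .mi .mi .one) Y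
    (fun j => { s with lo := { s.lo with mx := X, my := Y, acc := X * j, mi := j } }) 2
    (fun j hj => by simpa [Mem.get] using hj)
    (fun j hj => by
      refine ((Runs.plus .acc .acc .mx fun _ => ?_).seq_nil
        (Runs.plus .mi .mi .one fun _ => ?_)).congr ?_ le_rfl
      · exact (Nat.mul_le_mul_left X hj).trans hB
      · change j + s.one ≤ B
        omega
      · simp [Mem.set, Mem.get, h1, Nat.mul_succ])
    (by simp [Mem.get])
  refine ((Runs.cpy .mx x).seq_nil <| (Runs.cpy .my y).seq_nil <|
    (Runs.cst .acc 0 (Nat.zero_le _)).seq_nil <| (Runs.cst .mi 0 (Nat.zero_le _)).seq_nil <|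
    (loop.start ?_).seq_nil <| (Runs.cpy d .acc).seq_nil <|
    (Runs.cst .mx 0 (Nat.zero_le _)).seq_nil <| (Runs.cst .my 0 (Nat.zero_le _)).seq_nil <|
    (Runs.cst .acc 0 (Nat.zero_le _)).seq_nil <| (Runs.cst .mi 0 (Nat.zero_le _))).congr ?_ ?_
  · rw [hy]
    simp [Mem.set, X, Y]
  · exact hd _ _ _ _ _
  · omega

/-- `dy := dy mod hp` by repeated subtraction of multiples of `hp` by powers of two. -/
noncomputable def modP : Prog (numRegs K m) :=
  .while (tle .hp .dy) (iCpy .dz .hp ⨾ iPlus .dw .dz .dz ⨾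
    .while (tle .dw .dy) (iCpy .dz .dw ⨾ iPlus .dw .dz .dz) ⨾
    iMinus .dy .dy .dz ⨾ iCst .dz 0 ⨾ iCst .dw 0)

/-- Subtracting the largest `hp * 2 ^ N` below `y` leaves less than half of `y`, so each round
lowers `k` by one, and finding `N` takes at most `Nat.size B` doublings. The last doubling
overshoots `y`, which is why `2 * y` has to fit. -/
theorem runs_modP (k y : ℕ) (hk : y < 2 ^ k) (hB : 2 * y ≤ B) (hp : 0 < s.lo.hp) :
    Runs (K := K) (m := m) π B modP { s with lo := { s.lo with dy := y, dz := 0, dw := 0 } }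
      { s with lo := { s.lo with dy := y % s.lo.hp, dz := 0, dw := 0 } }
      (k * (3 * Nat.size B + 7) + 1) [] := by
  induction k generalizing y with
  | zero =>
    obtain rfl : y = 0 := by simpa using hk
    refine (Runs.while_stop ?_).congr (by simp) (by simp)
    simpa [Mem.get] using hp.ne'
  | succ k ih =>
    by_cases hle : s.lo.hp ≤ y
    · set N := Nat.log 2 (y / s.lo.hp) with hN
      have hq : y / s.lo.hp ≠ 0 := (Nat.div_pos hle hp).ne'
      have h1 : s.lo.hp * 2 ^ N ≤ y :=
        (Nat.mul_le_mul_left _ (Nat.pow_log_le_self 2 hq)).trans (Nat.mul_div_le _ _)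
      have h2 : y < s.lo.hp * 2 ^ N * 2 := by
        have := Nat.lt_pow_succ_log_self (b := 2) (by omega) (y / s.lo.hp)
        rw [Nat.div_lt_iff_lt_mul hp, pow_succ] at this
        rw [← hN] at this
        linarith
      have hNB : N ≤ Nat.size B := by
        have h3 : 2 ^ N ≤ B := by nlinarith
        exact (Nat.lt_size.2 h3).le
      have hmono : ∀ j ≤ N, s.lo.hp * 2 ^ j ≤ s.lo.hp * 2 ^ N := fun j hj =>
        Nat.mul_le_mul_left _ (Nat.pow_le_pow_right (by omega) hj)
      have loop := Runs.while_const (π := π) (B := B) (c := tle (K := K) (m := m) .dw .dy)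
        (p := iCpy .dz .dw ⨾ iPlus .dw .dz .dz) N
        (fun j => { s with lo := { s.lo with
          dy := y, dz := s.lo.hp * 2 ^ j, dw := s.lo.hp * 2 ^ j + s.lo.hp * 2 ^ j } }) 2
        (fun j hj => by
          have := hmono (j + 1) hj
          rw [pow_succ] at this
          simp only [tle_holds, Mem.get]
          linarith)
        (fun j hj => by
          refine ((Runs.cpy .dz .dw).seq_nil
            (Runs.plus .dw .dz .dz fun _ => ?_)).congr ?_ le_rfl
          · have := hmono (j + 1) hj
            rw [pow_succ] at this
            simp only [Mem.get, Mem.set]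
            linarith
          · have : s.lo.hp * 2 ^ (j + 1) = s.lo.hp * 2 ^ j + s.lo.hp * 2 ^ j := by ring
            simp only [Mem.get, Mem.set, this])
        (by simp only [tle_holds, Mem.get]; linarith)
      have hnew : y - s.lo.hp * 2 ^ N < 2 ^ k := by
        rw [pow_succ] at hk
        omega
      have hmod : (y - s.lo.hp * 2 ^ N) % s.lo.hp = y % s.lo.hp :=
        Nat.sub_mul_mod h1
      have rest := ih (y - s.lo.hp * 2 ^ N) hnew (by omega)
      rw [hmod] at rest
      refine (Runs.while_step ?_ ((Runs.cpy .dz .hp).seq_nil <|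
        (Runs.plus .dw .dz .dz fun _ => ?_).seq_nil <|
        (loop.start ?_).seq_nil <| (Runs.minus .dy .dy .dz).seq_nil <|
        (Runs.cst .dz 0 (Nat.zero_le _)).seq_nil <| (Runs.cst .dw 0 (Nat.zero_le _)))
        rest).mono ?_
      · simpa [Mem.get] using hle
      · simp only [Mem.get, Mem.set]
        omega
      · simp [Mem.get, Mem.set]
      · have : N * (2 + 1) ≤ 3 * Nat.size B := by omega
        rw [add_mul k 1]
        omega
    · refine (Runs.while_stop ?_).congr ?_ (by omega)
      · simpa [Mem.get] using hle
      · rw [Nat.mod_eq_of_lt (by omega)]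

/-- The hash function given by the triple `h` selects `x`. -/
def Hits (q : ℕ) (h : Fin 3 → ℕ) (x : ℕ) : Prop := q * ((h 1 * x + h 2) % h 0) < h 0

open Classical in
/-- The truth value of `P` as a number. -/
noncomputable def ind (P : Prop) : ℕ := if P then 1 else 0

@[simp] theorem ind_true {P : Prop} (h : P) : ind P = 1 := if_pos h
@[simp] theorem ind_false {P : Prop} (h : ¬ P) : ind P = 0 := if_neg h
theorem ind_le_one (P : Prop) : ind P ≤ 1 := by
  by_cases h : P <;> simp [h]
theorem ind_eq_one_iff {P : Prop} : ind P = 1 ↔ P := by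
  by_cases h : P <;> simp [h]

/-- `hit := 1` if the hash function in `hp, ha, hb` selects `lx`, and `hit := 0` otherwise. -/
noncomputable def hitP : Prog (numRegs K m) :=
  .ite (tlt .zero .hp)
    (mulP .dy .lx .ha ⨾ iPlus .dy .dy .hb ⨾ modP ⨾ mulP .dy .dy .q ⨾
      .ite (tlt .dy .hp) (iCst .hit 1) (iCst .hit 0) ⨾ iCst .dy 0)
    (iCst .hit 0)

/-- A bound for the time of `hitP`. -/
def hitTime (B q M : ℕ) : ℕ := Nat.size B * (3 * Nat.size B + 7) + 3 * M + 3 * q + 30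

/-- The requirements on the global registers. -/
def Globals (n B one z nn q M : ℕ) (tab : ℕ → ℕ → Fin 3 → ℕ) : Prop :=
  one = 1 ∧ z = 0 ∧ nn = n ∧ 2 * (M * n + M) ≤ B ∧ M * q ≤ B ∧ 1 ≤ B ∧ n ≤ B ∧
    ∀ i j c, tab i j c ≤ M

/-- The global registers have suitable values. -/
def Mem.Good (n B : ℕ) (s : Mem) : Prop := Globals n B s.one s.zero s.nn s.q s.M s.tab

theorem runs_hitP {f c : ℕ} {h : Fin 3 → ℕ} (hg : s.Good n B) (hh : ∀ i, h i ≤ s.M)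
    (hx : s.lx ≤ n) :
    Runs (K := K) (m := m) π B hitP
      { s with lo := ⟨0, 0, 0, 0, 0, 0, 0, h 0, h 1, h 2, 0, f, c⟩ }
      { s with lo := ⟨0, 0, 0, 0, 0, 0, 0, h 0, h 1, h 2, ind (Hits s.q h s.lx), f, c⟩ }
      (hitTime B s.q s.M) [] := by
  obtain ⟨h1, h0, -, hB1, hB2, hB3, hB4, -⟩ := hg
  have hb1 : s.lx * h 1 ≤ n * s.M := Nat.mul_le_mul hx (hh 1)
  have hb2 : s.M * n = n * s.M := Nat.mul_comm _ _
  have hh2 := hh 2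
  have hh1 := hh 1
  unfold hitTime
  refine (Runs.ite (T := Nat.size B * (3 * Nat.size B + 7) + 3 * s.M + 3 * s.q + 29)
    (fun hc => ?_) (fun hc => ?_)).mono le_rfl
  · have hp : 0 < h 0 := by simpa [Mem.get, h0] using hc
    have hmod : (s.lx * h 1 + h 2) % h 0 < h 0 := Nat.mod_lt _ hp
    have hd := runs_modP (K := K) (m := m) (π := π)
      (s := { s with lo := ⟨0, 0, 0, 0, 0, 0, 0, h 0, h 1, h 2, 0, f, c⟩ })
      (Nat.size B) (s.lx * h 1 + h 2) (lt_of_le_of_lt (by omega) (Nat.lt_size_self B))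
      (B := B) (by omega) hp
    refine ((runs_mulP (d := .dy) (x := .lx) (y := .ha) (by exact h1) ?_ (fun _ => rfl)
      (fun _ _ _ _ _ => rfl)).seq_nil <|
      (Runs.plus .dy .dy .hb fun _ => ?_).seq_nil <|
      (hd.start ?_).seq_nil <|
      (runs_mulP (d := .dy) (x := .dy) (y := .q) (by exact h1) ?_ (fun _ => rfl)
        (fun _ _ _ _ _ => rfl)).seq_nil <|
      (Runs.iteLt (T := 1) (s' := { s with lo := ⟨0, 0, 0, 0, (s.lx * h 1 + h 2) % h 0 * s.q, 0, 0,
          h 0, h 1, h 2, ind (Hits s.q h s.lx), f, c⟩ }) (fun hc => ?_) (fun hc => ?_)).seq_nil <|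
      Runs.cst .dy 0 (Nat.zero_le _)).congr ?_ ?_
    · exact hb1.trans (by omega)
    · change s.lx * h 1 + h 2 ≤ B
      omega
    · rfl
    · change (s.lx * h 1 + h 2) % h 0 * s.q ≤ B
      exact (Nat.mul_le_mul_right _ (hmod.le.trans (hh 0))).trans hB2
    · refine (Runs.cst .hit 1 hB3).congr ?_ le_rfl
      rw [ind_true]
      · rfl
      · have : (s.lx * h 1 + h 2) % h 0 * s.q < h 0 := hc
        rwa [Hits, mul_comm (h 1), mul_comm s.q]
    · refine (Runs.cst .hit 0 (Nat.zero_le _)).congr ?_ le_rfl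
      rw [ind_false]
      · rfl
      · have : ¬ (s.lx * h 1 + h 2) % h 0 * s.q < h 0 := not_lt.2 hc
        rwa [Hits, mul_comm (h 1), mul_comm s.q]
    · rfl
    · change 3 * h 1 + 10 + (1 + (_ + (3 * s.q + 10 + (1 + 1 + 1)))) ≤ _
      omega
  -- Modulus zero marks an empty slot: it selects nothing, since `Hits` would ask for a number below
  -- zero.
  · have hp : h 0 = 0 := by simpa [Mem.get, h0] using hc
    refine (Runs.cst .hit 0 (Nat.zero_le _)).congr ?_ (by omega)
    rw [ind_false]
    · rfl
    · simp [Hits, hp]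

end CycleLeaders

/-! ### Computing the level of an element -/

namespace CycleLeaders

variable {K m n : ℕ} {π : Equiv.Perm (Elem n)} {B : ℕ} {p p' : Prog (numRegs K m)}
  {s s' s'' : Mem} {T T' : ℕ} {out out' : List (Elem n)}

/-- Some hash function in row `i` of the table selects `x`. -/
def RowHit (q m : ℕ) (T : ℕ → ℕ → Fin 3 → ℕ) (i x : ℕ) : Prop := ∃ j < m, Hits q (T i j) x

open Classical in
/-- The number of rows, among the first `K` rows of the table, before the first one that does not
select `x`. -/
noncomputable def lev (q m : ℕ) (T : ℕ → ℕ → Fin 3 → ℕ) (x : ℕ) : ℕ → ℕ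
  | 0 => 0
  | i + 1 => if lev q m T x i = i ∧ RowHit q m T i x then i + 1 else lev q m T x i

/-- The memory with the registers `fl` and `ci` set and the other scratch registers cleared. -/
def Mem.scratch (s : Mem) (f c : ℕ) : Mem := { s with lo := ⟨0, 0, 0, 0, 0, 0, 0, 0, 0, 0, 0, f, c⟩ }

/-- Set `fl := 1` if row `i` selects `lx`. -/
noncomputable def rowP (i : Fin K) : Prog (numRegs K m) :=
  unroll m fun j => iCpy .hp (.slot i j 0) ⨾ iCpy .ha (.slot i j 1) ⨾ iCpy .hb (.slot i j 2) ⨾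
    hitP ⨾ .ite (teq .hit .one) (iCst .fl 1) .skip ⨾
    iCst .hp 0 ⨾ iCst .ha 0 ⨾ iCst .hb 0 ⨾ iCst .hit 0

theorem runs_rowP {c : ℕ} (i : Fin K) (hg : s.Good n B) (hx : s.lx ≤ n) :
    Runs (K := K) (m := m) π B (rowP i) (s.scratch 0 c)
      (s.scratch (ind (RowHit s.q m s.tab i s.lx)) c) (m * (hitTime B s.q s.M + 9) + 1) [] := by
  have h1 : s.one = 1 := hg.1
  have hB1 : 1 ≤ B := hg.2.2.2.2.2.1
  refine ((Runs.unroll m _ (fun j => s.scratch (ind (∃ j' < j, Hits s.q (s.tab i j') s.lx)) c)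
    (T := hitTime B s.q s.M + 9) fun j => ?_).start ?_)
  · have hh : ∀ a, s.tab i j a ≤ s.M := fun a => hg.2.2.2.2.2.2.2 i j a
    have hr := runs_hitP (K := K) (m := m) (π := π)
      (f := ind (∃ j' < (j : ℕ), Hits s.q (s.tab i j') s.lx)) (c := c) hg hh hx
    refine ((Runs.cpy .hp (.slot i j 0)).seq_nil <| (Runs.cpy .ha (.slot i j 1)).seq_nil <|
      (Runs.cpy .hb (.slot i j 2)).seq_nil <| (hr.start ?_).seq_nil <|
      (Runs.iteEq (T := 1) (s' := { s with lo := ⟨0, 0, 0, 0, 0, 0, 0, s.tab i j 0, s.tab i j 1,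
        s.tab i j 2, ind (Hits s.q (s.tab i j) s.lx),
        ind (∃ j' < (j : ℕ) + 1, Hits s.q (s.tab i j') s.lx), c⟩ })
        (fun hc => ?_) (fun hc => ?_)).seq_nil <|
      (Runs.cst .hp 0 (Nat.zero_le _)).seq_nil <| (Runs.cst .ha 0 (Nat.zero_le _)).seq_nil <|
      (Runs.cst .hb 0 (Nat.zero_le _)).seq_nil <| (Runs.cst .hit 0 (Nat.zero_le _))).congr ?_ ?_
    · rfl
    · replace hc : ind (Hits s.q (s.tab i j) s.lx) = s.one := hc
      rw [h1, ind_eq_one_iff] at hc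
      refine (Runs.cst .fl 1 hB1).congr ?_ le_rfl
      rw [ind_true (P := ∃ j' < (j : ℕ) + 1, Hits s.q (s.tab i j') s.lx) ⟨j, by omega, hc⟩]
      rfl
    · replace hc : ind (Hits s.q (s.tab i j) s.lx) ≠ s.one := hc
      rw [h1, Ne, ind_eq_one_iff] at hc
      refine Runs.skip.congr ?_ le_rfl
      have : (∃ j' < (j : ℕ), Hits s.q (s.tab i j') s.lx) ↔
          ∃ j' < (j : ℕ) + 1, Hits s.q (s.tab i j') s.lx := by
        refine ⟨fun ⟨j', h, h'⟩ => ⟨j', by omega, h'⟩, fun ⟨j', h, h'⟩ => ⟨j', ?_, h'⟩⟩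
        rcases Nat.lt_succ_iff_lt_or_eq.1 h with h | rfl
        · exact h
        · exact (hc h').elim
      rw [this]
    · rfl
    · omega
  · rw [ind_false (by simp)]

/-- `lv := ` level of `lx`. -/
noncomputable def levP : Prog (numRegs K m) :=
  iCst .lv 0 ⨾ unroll K fun i => iCst .ci i ⨾
    .ite (teq .lv .ci) (rowP i ⨾ .ite (teq .fl .one) (iPlus .lv .lv .one) .skip) .skip ⨾
    iCst .fl 0 ⨾ iCst .ci 0

/-- A bound for the time of `levP`. -/
def levTime (K m B q M : ℕ) : ℕ := K * (m * (hitTime B q M + 9) + 10) + 2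

theorem lev_le (q m : ℕ) (T : ℕ → ℕ → Fin 3 → ℕ) (x i : ℕ) : lev q m T x i ≤ i := by
  induction i with
  | zero => exact le_rfl
  | succ i ih => unfold lev; split_ifs <;> omega

theorem runs_levP (hg : s.Good n B) (hx : s.lx ≤ n) (hlo : s.lo = Lo.zero) (hK : K ≤ B) :
    Runs (K := K) (m := m) π B levP s { s with lv := lev s.q m s.tab s.lx K }
      (levTime K m B s.q s.M) [] := by
  have h1 : s.one = 1 := hg.1
  have hB1 : 1 ≤ B := hg.2.2.2.2.2.1
  have hs : s = s.scratch 0 0 := by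
    rw [Mem.scratch]
    change s.lo = ⟨0, 0, 0, 0, 0, 0, 0, 0, 0, 0, 0, 0, 0⟩ at hlo
    rw [← hlo]
  have loop := Runs.unroll (π := π) (B := B) K
    (fun i => (iCst .ci i ⨾
      .ite (teq .lv .ci) (rowP i ⨾ .ite (teq .fl .one) (iPlus .lv .lv .one) .skip) .skip ⨾
      iCst .fl 0 ⨾ iCst .ci 0 : Prog (numRegs K m)))
    (fun i => { s.scratch 0 0 with lv := lev s.q m s.tab s.lx i })
    (T := m * (hitTime B s.q s.M + 9) + 10) fun i => ?_
  · refine ((Runs.cst .lv 0 (Nat.zero_le _)).seq_nil (loop.start ?_)).congr ?_ ?_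
    · conv_lhs => rw [hs]
      rfl
    · conv_rhs => rw [hs]
      rfl
    · unfold levTime
      omega
  · have hr := runs_rowP (K := K) (m := m) (π := π) (c := i)
      (s := { s with lv := lev s.q m s.tab s.lx i }) i hg hx
    have hl := lev_le s.q m s.tab s.lx i
    refine ((Runs.cst .ci i (i.2.le.trans hK)).seq_nil <|
      (Runs.iteEq (T := m * (hitTime B s.q s.M + 9) + 1 + 2)
        (s' := ({ s with lv := lev s.q m s.tab s.lx (i + 1) } : Mem).scratch
          (if lev s.q m s.tab s.lx i = i then ind (RowHit s.q m s.tab i s.lx) else 0) i)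
        (fun hc => ?_) (fun hc => ?_)).seq_nil <|
      (Runs.cst .fl 0 (Nat.zero_le _)).seq_nil <| (Runs.cst .ci 0 (Nat.zero_le _))).congr ?_ ?_
    · replace hc : lev s.q m s.tab s.lx i = i := hc
      refine ((hr.start ?_).seq_nil (Runs.iteEq (T := 1) (fun hf => ?_) (fun hf => ?_))).congr
        rfl le_rfl
      · rfl
      · replace hf : ind (RowHit s.q m s.tab i s.lx) = s.one := hf
        rw [h1, ind_eq_one_iff] at hf
        refine (Runs.plus .lv .lv .one fun _ => ?_).congr ?_ le_rfl
        · change lev s.q m s.tab s.lx i + s.one ≤ B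
          have := i.2
          omega
        · rw [lev, if_pos ⟨hc, hf⟩, if_pos hc]
          simp only [Mem.set, Mem.get, Mem.scratch, h1, hc]
      · replace hf : ind (RowHit s.q m s.tab i s.lx) ≠ s.one := hf
        rw [h1, Ne, ind_eq_one_iff] at hf
        refine Runs.skip.congr ?_ le_rfl
        rw [lev, if_neg fun h => hf h.2, if_pos hc]
    · replace hc : lev s.q m s.tab s.lx i ≠ i := hc
      refine Runs.skip.congr ?_ (by omega)
      rw [lev, if_neg fun h => hc h.1, if_neg hc]
      rfl
    · rfl
    · omega

end CycleLeaders

/-! ### The walk along a cycle -/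

namespace CycleLeaders

variable {K m n : ℕ} {π : Equiv.Perm (Elem n)} {B : ℕ} {p p' : Prog (numRegs K m)}
  {s s' s'' : Mem} {T T' : ℕ} {out out' : List (Elem n)}

/-- The number that is reached from `x` after `j` steps along its cycle. -/
def path (π : Equiv.Perm (Elem n)) (x : Elem n) (j : ℕ) : ℕ := ((π ^ j) x : Elem n)

/-- With `ℓ` as first and the reverse order as second criterion, `y` has priority over `x`. -/
def Kill (ℓ : ℕ → ℕ) (x y : ℕ) : Prop := ℓ x < ℓ y ∨ ℓ y = ℓ x ∧ y < x

open Classical in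
/-- The number of the elements of the same level as `x` among the next `j` ones on its cycle. -/
noncomputable def sameCount (ℓ : ℕ → ℕ) (π : Equiv.Perm (Elem n)) (x : Elem n) (j : ℕ) : ℕ :=
  {i ∈ Finset.range j | ℓ (path π x (i + 1)) = ℓ x}.card

open Classical in
/-- The state of the walk from `x` after `j` steps: `0` unfinished, `1` an element with priority
over `x` was found, `2` the walk is back in `x`, `3` the limit was reached. -/
noncomputable def verdict (ℓ : ℕ → ℕ) (π : Equiv.Perm (Elem n)) (lim : ℕ) (x : Elem n) (j : ℕ) :
    ℕ :=
  if j = 0 then 0 else if path π x j = x then 2 else if Kill ℓ x (path π x j) then 1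
  else if lim ≤ sameCount ℓ π x j then 3 else 0

theorem exists_verdict_ne_zero (ℓ : ℕ → ℕ) (π : Equiv.Perm (Elem n)) (lim : ℕ) (x : Elem n) :
    ∃ j, verdict ℓ π lim x j ≠ 0 := by
  refine ⟨orderOf π, ?_⟩
  have h : path π x (orderOf π) = x := by simp [path, pow_orderOf_eq_one]
  rw [verdict, if_neg (orderOf_pos π).ne', if_pos h]
  omega

/-- The number of steps of the walk from `x`. -/
noncomputable def walkLen (ℓ : ℕ → ℕ) (π : Equiv.Perm (Elem n)) (lim : ℕ) (x : Elem n) : ℕ :=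
  by classical exact Nat.find (exists_verdict_ne_zero ℓ π lim x)

/-- The result of the walk from `x`. -/
noncomputable def walkRes (ℓ : ℕ → ℕ) (π : Equiv.Perm (Elem n)) (lim : ℕ) (x : Elem n) : ℕ :=
  verdict ℓ π lim x (walkLen ℓ π lim x)

section

variable {ℓ : ℕ → ℕ} {lim : ℕ} {x : Elem n} {j : ℕ}

theorem walkRes_ne_zero : walkRes ℓ π lim x ≠ 0 := by
  classical exact Nat.find_spec (exists_verdict_ne_zero ℓ π lim x)

theorem verdict_eq_zero (h : j < walkLen ℓ π lim x) : verdict ℓ π lim x j = 0 := by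
  classical exact not_not.1 (Nat.find_min (exists_verdict_ne_zero ℓ π lim x) h)

theorem walkLen_le (h : verdict ℓ π lim x j ≠ 0) : walkLen ℓ π lim x ≤ j := by
  classical exact Nat.find_min' (exists_verdict_ne_zero ℓ π lim x) h

theorem verdict_zero : verdict ℓ π lim x 0 = 0 := if_pos rfl

theorem walkLen_pos : 0 < walkLen ℓ π lim x := by
  by_contra h
  have h0 : walkLen ℓ π lim x = 0 := by omega
  have := walkRes_ne_zero (ℓ := ℓ) (π := π) (lim := lim) (x := x)
  rw [walkRes, h0] at this
  exact this verdict_zero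

open Classical in
theorem sameCount_succ : sameCount ℓ π x (j + 1) =
    sameCount ℓ π x j + if ℓ (path π x (j + 1)) = ℓ x then 1 else 0 := by
  unfold sameCount
  rw [Finset.range_add_one, Finset.filter_insert]
  split_ifs with h
  · rw [Finset.card_insert_of_notMem (by simp)]
  · rfl

/-- Otherwise the limit would have ended the walk. This bounds the register `cnt` and also the
number of walks that cross a given element. -/
theorem sameCount_lt (h : j < walkLen ℓ π lim x) (hj : j ≠ 0) : sameCount ℓ π x j < lim := by
  have := verdict_eq_zero h
  rw [verdict, if_neg hj] at this
  split_ifs at this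
  omega

theorem path_ne (h : j < walkLen ℓ π lim x) (hj : j ≠ 0) : path π x j ≠ x := by
  have := verdict_eq_zero h
  rw [verdict, if_neg hj] at this
  split_ifs at this
  assumption

theorem not_kill (h : j < walkLen ℓ π lim x) (hj : j ≠ 0) : ¬ Kill ℓ x (path π x j) := by
  have := verdict_eq_zero h
  rw [verdict, if_neg hj] at this
  split_ifs at this
  assumption

end

/-- `res := 3` if the limit has been reached. -/
noncomputable def limP : Prog (numRegs K m) := .ite (tle .wlim .cnt) (iCst .res 3) .skip

/-- One step of the walk. -/
noncomputable def walkStepP : Prog (numRegs K m) :=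
  iAsk .wy .wy ⨾ iCpy .lx .wy ⨾ levP ⨾ .ite (teq .lv .wr) (iPlus .cnt .cnt .one) .skip ⨾
    .ite (teq .wy .ex) (iCst .res 2) (.ite (tlt .wr .lv) (iCst .res 1)
      (.ite (teq .lv .wr) (.ite (tlt .wy .ex) (iCst .res 1) limP) limP))

/-- Walk along the cycle, from `ex = lx` of level `wr = lv`. -/
noncomputable def walkP : Prog (numRegs K m) :=
  iCpy .wy .ex ⨾ iCst .cnt 0 ⨾ iCst .res 0 ⨾ .while (teq .res .zero) walkStepP ⨾
    iCst .lx 0 ⨾ iCst .lv 0 ⨾ iCst .wy 0 ⨾ iCst .cnt 0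

/-- The level, as computed by `levP` from the table in memory. -/
noncomputable def Mem.lev (K m : ℕ) (s : Mem) (x : ℕ) : ℕ := CycleLeaders.lev s.q m s.tab x K

/-- The memory during the walk. -/
noncomputable def walkMem (K m : ℕ) (π : Equiv.Perm (Elem n)) (s : Mem) (x : Elem n) (j : ℕ) :
    Mem :=
  { s with
    lx := path π x j, lv := s.lev K m (path π x j), wy := path π x j
    cnt := sameCount (s.lev K m) π x j, res := verdict (s.lev K m) π s.wlim x j }

theorem runs_walkStepP {x : Elem n} {j : ℕ} (hg : s.Good n B) (hlo : s.lo = Lo.zero) (hK : K ≤ B)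
    (h3 : 3 ≤ B) (hx : s.ex = x) (hr : s.wr = s.lev K m x)
    (hj : j < walkLen (s.lev K m) π s.wlim x) :
    Runs (K := K) (m := m) π B walkStepP (walkMem K m π s x j) (walkMem K m π s x (j + 1))
      (levTime K m B s.q s.M + 10) [] := by
  classical
  have h1 : s.one = 1 := hg.1
  have hnB : n ≤ B := hg.2.2.2.2.2.2.1
  have hpath : path π x (j + 1) = π ((π ^ j) x) := by simp [path, pow_succ']
  have hv : verdict (s.lev K m) π s.wlim x j = 0 := verdict_eq_zero hj
  set y : ℕ := path π x (j + 1) with hy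
  have hyn : y ≤ n := ((π ^ (j + 1)) x).2.2
  have hlev := runs_levP (K := K) (m := m) (π := π)
    (s := { walkMem K m π s x j with wy := y, lx := y, lv := s.lev K m (path π x j) })
    hg hyn hlo hK
  -- The limit is tested in two branches, both reached only when the current element is neither `x`
  -- nor a killer of `x`.
  have hlim : Runs (K := K) (m := m) π B limP
      { walkMem K m π s x (j + 1) with res := 0 }
      { walkMem K m π s x (j + 1) with
        res := if s.wlim ≤ sameCount (s.lev K m) π x (j + 1) then 3 else 0 } 2 [] := by
    refine Runs.iteLe (fun h => ?_) (fun h => ?_)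
    · replace h : s.wlim ≤ sameCount (s.lev K m) π x (j + 1) := h
      rw [if_pos h]
      exact (Runs.cst .res 3 h3).congr rfl le_rfl
    · replace h : sameCount (s.lev K m) π x (j + 1) < s.wlim := h
      rw [if_neg (by omega)]
      exact Runs.skip
  refine .of_bdd fun hs => ?_
  have hlimB : s.wlim ≤ B := hs .wlim
  refine ((Runs.ask .wy .wy ((π ^ j) x) rfl hnB).seq_nil <| (Runs.cpy .lx .wy).seq_nil <|
    (hlev.start ?_).seq_nil <|
    (Runs.iteEq (T := 1) (s' := { walkMem K m π s x (j + 1) with res := 0 })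
      (fun hc => ?_) (fun hc => ?_)).seq_nil <|
    (Runs.iteEq (T := 5) (s' := walkMem K m π s x (j + 1))
      (fun hc => ?_) (fun hc => ?_))).congr rfl ?_
  · rw [hpath]
    rfl
  · replace hc : s.lev K m y = s.wr := hc
    refine (Runs.plus .cnt .cnt .one fun _ => ?_).congr ?_ le_rfl
    · change sameCount (s.lev K m) π x j + s.one ≤ B
      -- Before the first step the limit gives no information: it may be zero.
      rcases Nat.eq_zero_or_pos j with rfl | h
      · rw [show sameCount (s.lev K m) π x 0 = 0 by simp [sameCount]]
        omega
      · have := sameCount_lt hj h.ne'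
        omega
    · simp only [Mem.set, Mem.get, walkMem, h1, hv]
      rw [sameCount_succ, ← hy, if_pos (hc.trans hr)]
      rfl
  · replace hc : s.lev K m y ≠ s.wr := hc
    refine Runs.skip.congr ?_ le_rfl
    simp only [walkMem, hv]
    rw [sameCount_succ, ← hy, if_neg fun h => hc (h.trans hr.symm)]
    rfl
  · replace hc : y = s.ex := hc
    refine (Runs.cst .res 2 (by omega)).congr ?_ (by omega)
    rw [walkMem, verdict, if_neg (by omega), if_pos (hc.trans hx)]
    rfl
  · replace hc : y ≠ s.ex := hc
    rw [hx] at hc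
    refine Runs.iteLt (T := 4) (fun hk => ?_) (fun hk => ?_)
    · replace hk : s.wr < s.lev K m y := hk
      refine (Runs.cst .res 1 (by omega)).congr ?_ (by omega)
      have hk' : Kill (s.lev K m) x y := Or.inl (hr ▸ hk)
      rw [walkMem, verdict, if_neg (by omega), if_neg hc, if_pos hk']
      rfl
    · replace hk : s.lev K m y ≤ s.wr := hk
      refine Runs.iteEq (T := 3) (fun he => ?_) (fun he => ?_)
      · replace he : s.lev K m y = s.wr := he
        refine Runs.iteLt (T := 2) (fun hl => ?_) (fun hl => ?_)
        · replace hl : y < s.ex := hl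
          refine (Runs.cst .res 1 (by omega)).congr ?_ (by omega)
          have hk' : Kill (s.lev K m) x y := Or.inr ⟨he.trans hr, hx ▸ hl⟩
          rw [walkMem, verdict, if_neg (by omega), if_neg hc, if_pos hk']
          rfl
        · replace hl : s.ex ≤ y := hl
          refine hlim.congr ?_ le_rfl
          have hnk : ¬ Kill (s.lev K m) x y := by
            unfold Kill
            omega
          conv_rhs => rw [walkMem, verdict, if_neg (by omega), if_neg hc, if_neg hnk]
          rfl
      · replace he : s.lev K m y ≠ s.wr := he
        refine hlim.congr ?_ (by omega)
        have hnk : ¬ Kill (s.lev K m) x y := by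
          unfold Kill
          omega
        conv_rhs => rw [walkMem, verdict, if_neg (by omega), if_neg hc, if_neg hnk]
        rfl
  · change 1 + (1 + (levTime K m B s.q s.M + _)) ≤ _
    omega

theorem runs_walkP {x : Elem n} (hg : s.Good n B) (hlo : s.lo = Lo.zero) (hK : K ≤ B)
    (h3 : 3 ≤ B) (hx : s.ex = x) (hr : s.wr = s.lev K m x) (hlx : s.lx = x)
    (hlv : s.lv = s.lev K m x) :
    Runs (K := K) (m := m) π B walkP s
      { s with lx := 0, lv := 0, wy := 0, cnt := 0, res := walkRes (s.lev K m) π s.wlim x }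
      (walkLen (s.lev K m) π s.wlim x * (levTime K m B s.q s.M + 11) + 8) [] := by
  have h0 : s.zero = 0 := hg.2.1
  have loop := Runs.while_const (π := π) (B := B) (c := teq (K := K) (m := m) .res .zero)
    (p := walkStepP) (walkLen (s.lev K m) π s.wlim x) (walkMem K m π s x)
    (levTime K m B s.q s.M + 10)
    (fun j hj => by
      rw [teq_holds]
      exact (verdict_eq_zero hj).trans h0.symm)
    (fun j hj => runs_walkStepP hg hlo hK h3 hx hr hj)
    (by
      rw [teq_holds]
      intro h
      exact walkRes_ne_zero (h.trans h0))
  refine ((Runs.cpy .wy .ex).seq_nil <| (Runs.cst .cnt 0 (Nat.zero_le _)).seq_nil <|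
    (Runs.cst .res 0 (Nat.zero_le _)).seq_nil <| (loop.start ?_).seq_nil <|
    (Runs.cst .lx 0 (Nat.zero_le _)).seq_nil <| (Runs.cst .lv 0 (Nat.zero_le _)).seq_nil <|
    (Runs.cst .wy 0 (Nat.zero_le _)).seq_nil <| (Runs.cst .cnt 0 (Nat.zero_le _))).congr ?_ ?_
  · have hp : path π x 0 = x := by simp [path]
    rw [← hlx] at hlv
    have hc : sameCount (s.lev K m) π x 0 = 0 := by simp [sameCount]
    simp only [walkMem, hp, hc, verdict_zero, Mem.set, Mem.get, hx, ← hlx]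
    rw [← hlv]
  · rfl
  · rw [show levTime K m B s.q s.M + 10 + 1 = levTime K m B s.q s.M + 11 from rfl]
    omega

end CycleLeaders

/-! ### Evaluating a table at one level -/

namespace CycleLeaders

variable {K m n : ℕ} {π : Equiv.Perm (Elem n)} {B : ℕ} {p p' : Prog (numRegs K m)}
  {s s' s'' : Mem} {T T' : ℕ} {out out' : List (Elem n)}

/-- The element `i + 1` of `[n]`, where `i < n`. -/
def el (hn : 1 ≤ n) (i : ℕ) : Elem n :=
  if h : i + 1 ≤ n then ⟨i + 1, by simp, h⟩ else ⟨1, le_rfl, hn⟩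

theorem el_val (hn : 1 ≤ n) {i : ℕ} (hi : i < n) : (el hn i : ℕ) = i + 1 := by
  rw [el, dif_pos (by omega)]

theorem sum_el {M : Type*} [AddCommMonoid M] (hn : 1 ≤ n) (f : Elem n → M) :
    ∑ i ∈ Finset.range n, f (el hn i) = ∑ x, f x := by
  refine Finset.sum_bij (fun i _ => el hn i) (fun _ _ => Finset.mem_univ _) ?_ ?_ fun _ _ => rfl
  · intro i hi j hj h
    have := congrArg Subtype.val h
    rw [el_val hn (Finset.mem_range.1 hi), el_val hn (Finset.mem_range.1 hj)] at this
    omega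
  · intro x _
    have h1 := x.2.1
    have h2 := x.2.2
    refine ⟨x - 1, by simp; omega, ?_⟩
    apply Subtype.ext
    rw [el_val hn (by omega)]
    omega

/-- The number of elements up to `i` with the property `P`. -/
noncomputable def countTo (hn : 1 ≤ n) (P : Elem n → Prop) (i : ℕ) : ℕ :=
  ∑ j ∈ Finset.range i, ind (P (el hn j))

theorem countTo_succ (hn : 1 ≤ n) (P : Elem n → Prop) (i : ℕ) :
    countTo hn P (i + 1) = countTo hn P i + ind (P (el hn i)) := Finset.sum_range_succ _ _

theorem countTo_le (hn : 1 ≤ n) (P : Elem n → Prop) (i : ℕ) : countTo hn P i ≤ i :=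
  (Finset.sum_le_sum fun _ _ => ind_le_one _).trans (by simp)

open Classical in
theorem countTo_eq_card (hn : 1 ≤ n) (P : Elem n → Prop) :
    countTo hn P n = (Finset.univ.filter P).card := by
  rw [countTo, sum_el hn fun x => ind (P x), Finset.card_filter]
  rfl

/-- The memory with the registers of the evaluation loop set and its scratch registers cleared. -/
def Mem.mid (s : Mem) (lim x u a b : ℕ) : Mem :=
  { s with
    lo := Lo.zero, lx := 0, lv := 0, rr := 0, wlim := lim, wr := 0, wy := 0, cnt := 0, res := 0
    ex := x, eu := u, en := a, eh := b }

/-- The body of the evaluation loop. -/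
noncomputable def evalStepP (r : ℕ) : Prog (numRegs K m) :=
  iPlus .ex .ex .one ⨾ iCpy .lx .ex ⨾ levP ⨾ iCpy .wr .lv ⨾ iCst .rr r ⨾
    .ite (tle .rr .lv) (iPlus .en .en .one) .skip ⨾
    .ite (tlt .rr .lv) (iPlus .eh .eh .one) .skip ⨾
    .ite (teq .lv .rr) (walkP ⨾ iCst .wy 3 ⨾ .ite (teq .res .wy) (iPlus .eu .eu .one) .skip)
      .skip ⨾
    iCst .lx 0 ⨾ iCst .lv 0 ⨾ iCst .rr 0 ⨾ iCst .wr 0 ⨾ iCst .wy 0 ⨾ iCst .res 0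

/-- `x` has level `r`, and the walk from `x` reaches the limit. -/
def Unfinished (ℓ : ℕ → ℕ) (π : Equiv.Perm (Elem n)) (lim r : ℕ) (x : Elem n) : Prop :=
  ℓ x = r ∧ walkRes ℓ π lim x = 3

open Classical in
/-- The time of the walk from `x`, if `x` has level `r`. -/
noncomputable def walkTime (ℓ : ℕ → ℕ) (π : Equiv.Perm (Elem n)) (lim r : ℕ) (x : Elem n) : ℕ :=
  if ℓ x = r then walkLen ℓ π lim x else 0

/-- Adding `ind P` describes both branches at once. For a concrete register `hs` holds by `rfl`. -/
theorem runs_incr {r : Reg K m} {P : Prop} {c : Test (numRegs K m)} (h1 : s.one = 1)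
    (hc : c.Holds (encode K m s) ↔ P) (hB : s.get r + 1 ≤ B)
    (hs : s.set (s.get r) r = s) :
    Runs π B (.ite c (iPlus r r .one) .skip) s (s.set (s.get r + ind P) r) 2 [] := by
  have hone : s.get (.one : Reg K m) = 1 := h1
  refine Runs.ite (fun h => ?_) (fun h => ?_)
  · exact (Runs.plus _ _ _ fun _ => by rwa [hone]).congr (by rw [hone, ind_true (hc.1 h)]) le_rfl
  · rw [ind_false fun h' => h (hc.2 h'), Nat.add_zero, hs]
    exact Runs.skip

theorem runs_evalStepP {r i u a b lim : ℕ} (hn : 1 ≤ n) (hg : s.Good n B) (hK : K ≤ B)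
    (h3 : 3 ≤ B) (hr : r ≤ B) (hi : i < n) (hu : u ≤ i) (ha : a ≤ i) (hb : b ≤ i) :
    Runs (K := K) (m := m) π B (evalStepP r) (s.mid lim i u a b)
      (s.mid lim (i + 1) (u + ind (Unfinished (s.lev K m) π lim r (el hn i)))
        (a + ind (r ≤ s.lev K m (el hn i))) (b + ind (r < s.lev K m (el hn i))))
      (walkTime (s.lev K m) π lim r (el hn i) * (levTime K m B s.q s.M + 11) +
        (levTime K m B s.q s.M + 40)) [] := by
  have h1 : s.one = 1 := hg.1
  have hnB : n ≤ B := hg.2.2.2.2.2.2.1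
  have hx : (el hn i : ℕ) = i + 1 := el_val hn hi
  set x := el hn i
  have hlev := runs_levP (K := K) (m := m) (π := π)
    (s := { s.mid lim (i + 1) u a b with lx := i + 1 }) hg hi rfl hK
  set a' := a + ind (r ≤ s.lev K m x) with ha'
  set b' := b + ind (r < s.lev K m x) with hb'
  have hwalk := runs_walkP (K := K) (m := m) (π := π) (x := x)
    (s := { s.mid lim (i + 1) u a' b' with
      lx := i + 1, lv := s.lev K m x, wr := s.lev K m x, rr := r }) hg rfl hK h3
      hx.symm rfl hx.symm rfl
  refine ((Runs.plus .ex .ex .one fun _ => ?_).seq_nil <| (Runs.cpy .lx .ex).seq_nil <|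
    (hlev.start ?_).seq_nil <| (Runs.cpy .wr .lv).seq_nil <| (Runs.cst .rr r hr).seq_nil <|
    (runs_incr (r := .en) (P := r ≤ s.lev K m x) (by exact h1) ?_ ?_ rfl).seq_nil <|
    (runs_incr (r := .eh) (P := r < s.lev K m x) (by exact h1) ?_ ?_ rfl).seq_nil <|
    (Runs.iteEq (T := walkTime (s.lev K m) π lim r x * (levTime K m B s.q s.M + 11) + 11)
      (s' := { s.mid lim (i + 1) (u + ind (Unfinished (s.lev K m) π lim r x)) a' b' with
        lx := if s.lev K m x = r then 0 else i + 1
        lv := if s.lev K m x = r then 0 else s.lev K m x, wr := s.lev K m x, rr := r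
        wy := if s.lev K m x = r then 3 else 0
        res := if s.lev K m x = r then walkRes (s.lev K m) π lim x else 0 })
      (fun hc => ?_) (fun hc => ?_)).seq_nil <|
    (Runs.cst .lx 0 (Nat.zero_le _)).seq_nil <| (Runs.cst .lv 0 (Nat.zero_le _)).seq_nil <|
    (Runs.cst .rr 0 (Nat.zero_le _)).seq_nil <| (Runs.cst .wr 0 (Nat.zero_le _)).seq_nil <|
    (Runs.cst .wy 0 (Nat.zero_le _)).seq_nil <| (Runs.cst .res 0 (Nat.zero_le _))).congr ?_ ?_
  · change i + s.one ≤ B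
    omega
  · simp only [Mem.mid, Mem.set, Mem.get, h1]
  · rw [tle_holds, hx]
    rfl
  · change a + 1 ≤ B
    omega
  · rw [tlt_holds, hx]
    rfl
  · change b + 1 ≤ B
    omega
  · replace hc : s.lev K m (i + 1) = r := hc
    rw [← hx] at hc
    refine ((hwalk.start ?_).seq_nil <| (Runs.cst .wy 3 h3).seq_nil <|
      (runs_incr (r := .eu) (P := Unfinished (s.lev K m) π lim r x) (by exact h1)
        ?_ ?_ rfl)).congr ?_ ?_
    · rw [ha', hb', hx]
      rfl
    · rw [teq_holds]
      exact ⟨fun h => ⟨hc, h⟩, fun h => h.2⟩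
    · change u + 1 ≤ B
      omega
    · rw [if_pos hc, if_pos hc, if_pos hc, if_pos hc]
      rfl
    · rw [walkTime, if_pos hc]
      change walkLen (s.lev K m) π lim x * (levTime K m B s.q s.M + 11) + 8 + _ ≤ _
      omega
  · replace hc : s.lev K m (i + 1) ≠ r := hc
    rw [← hx] at hc
    refine Runs.skip.congr ?_ (by omega)
    rw [if_neg hc, if_neg hc, if_neg hc, if_neg hc, ha', hb', hx,
      ind_false (P := Unfinished (s.lev K m) π lim r x) fun h => hc h.1]
    rfl
  · rfl
  · change 1 + (1 + (levTime K m B s.q s.M + _)) ≤ _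
    omega

/-- Evaluate the table at level `r`: `eu` becomes the number of the elements of level `r` with
unfinished walk, `en` and `eh` become the numbers of elements of level at least `r` and above. -/
noncomputable def evalP (r : ℕ) : Prog (numRegs K m) :=
  iCst .eu 0 ⨾ iCst .en 0 ⨾ iCst .eh 0 ⨾ iCst .ex 0 ⨾ .while (tlt .ex .nn) (evalStepP r) ⨾
    iCst .ex 0

theorem runs_evalP {r lim x u a b : ℕ} (hn : 1 ≤ n) (hg : s.Good n B) (hK : K ≤ B)
    (h3 : 3 ≤ B) (hr : r ≤ B) :
    Runs (K := K) (m := m) π B (evalP r) (s.mid lim x u a b)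
      (s.mid lim 0 (countTo hn (Unfinished (s.lev K m) π lim r) n)
        (countTo hn (fun x => r ≤ s.lev K m x) n) (countTo hn (fun x => r < s.lev K m x) n))
      ((∑ x, walkTime (s.lev K m) π lim r x) * (levTime K m B s.q s.M + 11) +
        n * (levTime K m B s.q s.M + 41) + 6) [] := by
  have hnn : s.nn = n := hg.2.2.1
  have loop := Runs.while_nil (π := π) (B := B) (c := tlt (K := K) (m := m) .ex .nn)
    (p := evalStepP r) n
    (fun i => s.mid lim i (countTo hn (Unfinished (s.lev K m) π lim r) i)
        (countTo hn (fun x => r ≤ s.lev K m x) i) (countTo hn (fun x => r < s.lev K m x) i))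
    (fun i => walkTime (s.lev K m) π lim r (el hn i) * (levTime K m B s.q s.M + 11) +
      (levTime K m B s.q s.M + 40))
    (fun i hi => by
      rw [tlt_holds]
      change i < s.nn
      omega)
    (fun i hi => by
      simp only [countTo_succ]
      exact runs_evalStepP hn hg hK h3 hr hi (countTo_le _ _ _) (countTo_le _ _ _)
        (countTo_le _ _ _))
    (by
      rw [tlt_holds]
      change ¬ n < s.nn
      omega)
  refine ((Runs.cst .eu 0 (Nat.zero_le _)).seq_nil <| (Runs.cst .en 0 (Nat.zero_le _)).seq_nil <|
    (Runs.cst .eh 0 (Nat.zero_le _)).seq_nil <| (Runs.cst .ex 0 (Nat.zero_le _)).seq_nil <|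
    (loop.start ?_).seq_nil <| (Runs.cst .ex 0 (Nat.zero_le _))).congr rfl ?_
  · simp [countTo, Mem.mid, Mem.set]
  · have : ∑ j ∈ Finset.range n, (walkTime (s.lev K m) π lim r (el hn j) *
        (levTime K m B s.q s.M + 11) + (levTime K m B s.q s.M + 40) + 1) =
        (∑ x, walkTime (s.lev K m) π lim r x) * (levTime K m B s.q s.M + 11) +
        n * (levTime K m B s.q s.M + 41) := by
      rw [Finset.sum_mul, ← sum_el hn]
      simp only [add_assoc, Finset.sum_add_distrib]
      simp
      ring
    omega

end CycleLeaders

/-! ### The total length of limited walks, and the test of one candidate -/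

namespace CycleLeaders

variable {K m n : ℕ} {π : Equiv.Perm (Elem n)} {B : ℕ} {p p' : Prog (numRegs K m)}
  {s s' s'' : Mem} {T T' : ℕ} {out out' : List (Elem n)}

/-- The walks from the elements of one level take few steps in total. -/
theorem sum_walkTime_le (ℓ : ℕ → ℕ) (π : Equiv.Perm (Elem n)) (lim r : ℕ) :
    ∑ x, walkTime ℓ π lim r x ≤ n * (lim + 1) := by
  classical
  -- Double counting: the pairs (start, step) are grouped by the element at which the walk stands.
  set S : Finset (Σ _ : Elem n, ℕ) :=
    (Finset.univ.filter fun x : Elem n => ℓ x = r).sigma fun x =>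
      Finset.range (walkLen ℓ π lim x) with hS
  have hmem : ∀ z : (Σ _ : Elem n, ℕ), z ∈ S ↔ ℓ z.1 = r ∧ z.2 < walkLen ℓ π lim z.1 := by
    intro z
    simp [hS]
  have hcard : ∑ x, walkTime ℓ π lim r x = S.card := by
    rw [hS, Finset.card_sigma, Finset.sum_filter]
    simp [walkTime]
  have hfib : ∀ y ∈ (Finset.univ : Finset (Elem n)),
      {z ∈ S | (π ^ z.2) z.1 = y}.card ≤ lim + 1 := by
    intro y _
    set F := {z ∈ S | (π ^ z.2) z.1 = y} with hF
    rcases F.eq_empty_or_nonempty with h0 | hne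
    · simp [h0]
    -- Among the walks through `y`, take the one that started farthest back. It runs through all the
    -- other starts before it reaches `y`, and they have the same level as `x`.
    obtain ⟨⟨x, j⟩, hxj, hmax⟩ := F.exists_max_image (fun z => z.2) hne
    have hx := (hmem _).1 (Finset.mem_filter.1 hxj).1
    have hy : (π ^ j) x = y := (Finset.mem_filter.1 hxj).2
    have hback : ∀ z ∈ F, (π ^ (j - z.2)) x = z.1 := by
      intro z hz
      have hzy := (Finset.mem_filter.1 hz).2
      have hle : z.2 ≤ j := hmax z hz
      apply (π ^ z.2).injective
      rw [hzy, ← Equiv.Perm.mul_apply, ← pow_add, Nat.add_sub_cancel' hle, hy]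
    have key : ∀ z ∈ F.erase ⟨x, j⟩, z.2 ≠ j := by
      intro z hz h
      have hzx := hback z (Finset.mem_of_mem_erase hz)
      apply Finset.ne_of_mem_erase hz
      rw [h, Nat.sub_self] at hzx
      obtain ⟨z1, z2⟩ := z
      simp only at h hzx
      subst h
      simp at hzx
      subst hzx
      rfl
    have hle : (F.erase ⟨x, j⟩).card ≤ sameCount ℓ π x j := by
      -- The start `z.1` is met at step `j - z.2`; `sameCount` indexes step `i + 1` by `i`.
      refine Finset.card_le_card_of_injOn (fun z => j - z.2 - 1) ?_ ?_
      · intro z hz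
        have hzF := Finset.mem_of_mem_erase hz
        have hzx := hback z hzF
        have hzj : z.2 ≤ j := hmax z hzF
        have hne := key z hz
        have he : j - z.2 - 1 + 1 = j - z.2 := by omega
        simp only [Finset.coe_filter, Finset.mem_range, Set.mem_ofPred_eq, he]
        refine ⟨by omega, ?_⟩
        rw [path, hzx, ((hmem _).1 (Finset.mem_filter.1 hzF).1).1, hx.1]
      · intro z hz w hw h
        have hzF := Finset.mem_of_mem_erase hz
        have hwF := Finset.mem_of_mem_erase hw
        have hzx := hback z hzF
        have hwx := hback w hwF
        have hzj : z.2 ≤ j := hmax z hzF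
        have hwj : w.2 ≤ j := hmax w hwF
        have h1 := key z hz
        have h2 := key w hw
        replace h : j - z.2 - 1 = j - w.2 - 1 := h
        have h3 : z.2 = w.2 := by omega
        rw [h3] at hzx
        obtain ⟨z1, z2⟩ := z
        obtain ⟨w1, w2⟩ := w
        simp only at h3 hzx hwx
        subst h3
        rw [hzx] at hwx
        rw [hwx]
    have hsc : sameCount ℓ π x j ≤ lim := by
      rcases Nat.eq_zero_or_pos j with rfl | hj
      · simp [sameCount]
      · exact (sameCount_lt hx.2 hj.ne').le
    rw [Finset.card_erase_of_mem hxj] at hle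
    omega
  rw [hcard]
  refine (Finset.card_le_mul_card_image_of_maps_to (f := fun z => (π ^ z.2) z.1)
    (t := Finset.univ) (fun _ _ => Finset.mem_univ _) (lim + 1) hfib).trans ?_
  rw [Finset.card_univ, Nat.mul_comm]
  simp

/-- The table with the triple in slot `(i, j)` replaced by `h`. -/
def setSlot (T : ℕ → ℕ → Fin 3 → ℕ) (i j : ℕ) (h : Fin 3 → ℕ) : ℕ → ℕ → Fin 3 → ℕ :=
  fun i' j' => if i' = i ∧ j' = j then h else T i' j'

theorem updTab_eq_setSlot (T : ℕ → ℕ → Fin 3 → ℕ) (i j : ℕ) (h : Fin 3 → ℕ) :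
    updTab (updTab (updTab T i j 0 (h 0)) i j 1 (h 1)) i j 2 (h 2) = setSlot T i j h := by
  funext i' j' c
  unfold updTab setSlot
  by_cases hij : i' = i ∧ j' = j
  · obtain ⟨rfl, rfl⟩ := hij
    fin_cases c <;> simp
  · rw [if_neg hij, if_neg (by tauto), if_neg (by tauto), if_neg (by tauto)]

theorem setSlot_setSlot (T : ℕ → ℕ → Fin 3 → ℕ) (i j : ℕ) (h h' : Fin 3 → ℕ) :
    setSlot (setSlot T i j h) i j h' = setSlot T i j h' := by
  funext i' j'
  unfold setSlot
  split_ifs <;> rfl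

theorem setSlot_self {T : ℕ → ℕ → Fin 3 → ℕ} {i j : ℕ} {h : Fin 3 → ℕ} (hT : T i j = h) :
    setSlot T i j h = T := by
  funext i' j'
  unfold setSlot
  split_ifs with h1
  · rw [h1.1, h1.2, hT]
  · rfl

section

variable (K m : ℕ) (hn : 1 ≤ n) (π : Equiv.Perm (Elem n)) (q L : ℕ) (T : ℕ → ℕ → Fin 3 → ℕ) (r : ℕ)

/-- The level of `x` with respect to all `K` rows. -/
noncomputable def level (x : ℕ) : ℕ := lev q m T x K

/-- The number of elements of level `r` with unfinished walk. -/
noncomputable def numUnf : ℕ := countTo hn (Unfinished (level K m q T) π L r) n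

/-- The number of elements of level at least `r`. -/
noncomputable def numGe : ℕ := countTo hn (fun x => r ≤ level K m q T x) n

/-- The number of elements of level above `r`. -/
noncomputable def numGt : ℕ := countTo hn (fun x => r < level K m q T x) n

/-- The table `T'` is sufficiently better than `T` at level `r`. -/
def Improves (A : ℕ) (T' : ℕ → ℕ → Fin 3 → ℕ) : Prop :=
  q * numUnf K m hn π q L T' r ≤ A * numUnf K m hn π q L T r ∧
  q * numGt K m hn q T' r ≤ A * numGe K m hn q T r + q * numGt K m hn q T r

end

/-- The memory during the search for a hash function. -/
def searchMem (q M L n : ℕ) (T : ℕ → ℕ → Fin 3 → ℕ) (p a b : ℕ) (best : Fin 3 → ℕ)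
    (ta tb u e h : ℕ) : Mem :=
  { lo := Lo.zero, lx := 0, lv := 0, rr := 0, wlim := L, wr := 0, wy := 0, cnt := 0, res := 0
    ex := 0, eu := u, en := e, eh := h, sp := p, sa := a, sb := b
    bp := best 0, ba := best 1, bb := best 2, ta := ta, tb := tb
    q := q, M := M, L := L, nn := n, one := 1, zero := 0, tab := T }

/-- Write a triple into slot `(i, j)`. -/
noncomputable def storeP (i : Fin K) (j : Fin m) (a b c : Reg K m) : Prog (numRegs K m) :=
  iCpy (.slot i j 0) a ⨾ iCpy (.slot i j 1) b ⨾ iCpy (.slot i j 2) c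

/-- Try the hash function in `sp, sa, sb` in slot `(i, j)`, and keep it if it is good enough. -/
noncomputable def tryP (i : Fin K) (j : Fin m) : Prog (numRegs K m) :=
  storeP i j .sp .sa .sb ⨾ evalP i ⨾ mulP .eu .eu .q ⨾ mulP .eh .eh .q ⨾
    .ite (tle .eu .ta)
      (.ite (tle .eh .tb) (iCpy .bp .sp ⨾ iCpy .ba .sa ⨾ iCpy .bb .sb) .skip) .skip ⨾
    storeP i j .zero .zero .zero ⨾ iCst .eu 0 ⨾ iCst .en 0 ⨾ iCst .eh 0

/-- A bound for the time of `evalP`. -/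
def evalTime (K m B q M L n : ℕ) : ℕ :=
  n * (L + 1) * (levTime K m B q M + 11) + n * (levTime K m B q M + 41) + 6

/-- The inequalities that the bound for the registers has to satisfy. -/
def BoundOK (K A q M n B : ℕ) : Prop :=
  2 * (M * n + M) ≤ B ∧ M * q ≤ B ∧ (A + q) * n ≤ B ∧ n ≤ B ∧ K + A + 3 ≤ B

theorem searchMem_good {A q M L p a b ta tb u e h : ℕ} {T : ℕ → ℕ → Fin 3 → ℕ} {best : Fin 3 → ℕ}
    (hB : BoundOK K A q M n B) (hT : ∀ i j c, T i j c ≤ M) :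
    (searchMem q M L n T p a b best ta tb u e h).Good n B :=
  ⟨rfl, rfl, rfl, hB.1, hB.2.1, by have := hB.2.2.2.2; omega, hB.2.2.2.1, hT⟩

theorem setSlot_le {M : ℕ} {T : ℕ → ℕ → Fin 3 → ℕ} {h : Fin 3 → ℕ} (hT : ∀ i j c, T i j c ≤ M)
    (hh : ∀ c, h c ≤ M) (i j : ℕ) : ∀ i' j' c, setSlot T i j h i' j' c ≤ M := by
  intro i' j' c
  unfold setSlot
  split_ifs
  · exact hh c
  · exact hT i' j' c

theorem numUnf_le (hn : 1 ≤ n) (q L : ℕ) (T : ℕ → ℕ → Fin 3 → ℕ) (r : ℕ) :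
    numUnf K m hn π q L T r ≤ n := countTo_le _ _ _
theorem numGe_le (hn : 1 ≤ n) (q : ℕ) (T : ℕ → ℕ → Fin 3 → ℕ) (r : ℕ) :
    numGe K m hn q T r ≤ n := countTo_le _ _ _
theorem numGt_le (hn : 1 ≤ n) (q : ℕ) (T : ℕ → ℕ → Fin 3 → ℕ) (r : ℕ) :
    numGt K m hn q T r ≤ n := countTo_le _ _ _

/-- The time bound is the same for all tables with entries at most `M`, because `sum_walkTime_le`
holds for every level function. So a bad candidate costs no more to test than a good one. -/
theorem runs_eval_search {A q M L p a b ta tb u e h r : ℕ} {T : ℕ → ℕ → Fin 3 → ℕ}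
    {best : Fin 3 → ℕ} (hn : 1 ≤ n) (hB : BoundOK K A q M n B) (hT : ∀ i j c, T i j c ≤ M)
    (hr : r ≤ K) :
    Runs (K := K) (m := m) π B (evalP r) (searchMem q M L n T p a b best ta tb u e h)
      (searchMem q M L n T p a b best ta tb (numUnf K m hn π q L T r) (numGe K m hn q T r)
        (numGt K m hn q T r)) (evalTime K m B q M L n) [] := by
  have h5 := hB.2.2.2.2
  have hm := runs_evalP (K := K) (m := m) (π := π) (r := r) (lim := L) (x := 0) (u := u) (a := e)
    (b := h) (s := searchMem q M L n T p a b best ta tb 0 0 0) hn (searchMem_good hB hT)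
    (by omega) (by omega) (by omega)
  refine (hm.start rfl).congr rfl ?_
  unfold evalTime
  exact Nat.add_le_add_right (Nat.add_le_add_right (Nat.mul_le_mul_right _
    (sum_walkTime_le (level K m q T) π L r)) _) _

open Classical in
/-- The candidate `h` if it is acceptable, and `best` otherwise. -/
noncomputable def better (P : (Fin 3 → ℕ) → Prop) (h best : Fin 3 → ℕ) : Fin 3 → ℕ :=
  if P h then h else best

/-- A bound for the time of `tryP`. -/
def tryTime (K m B q M L n : ℕ) : ℕ := evalTime K m B q M L n + 6 * q + 40

/-- The candidate is written into the slot, judged, and erased by zeros. By `h0` the slot was empty,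
so erasing restores `T`. The two sides of `Improves` are compared as integers, multiplied by `q` to
avoid division. -/
theorem runs_tryP {A q M L p a b : ℕ} {T : ℕ → ℕ → Fin 3 → ℕ} {best : Fin 3 → ℕ} (hn : 1 ≤ n)
    (hB : BoundOK K A q M n B) (hT : ∀ i j c, T i j c ≤ M) (i : Fin K) (j : Fin m)
    (h0 : T i j = fun _ => 0) (hp : p < M) (ha : a < M) (hb : b < M) :
    Runs (K := K) (m := m) π B (tryP i j)
      (searchMem q M L n T p a b best (A * numUnf K m hn π q L T i)
        (A * numGe K m hn q T i + q * numGt K m hn q T i) 0 0 0)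
      (searchMem q M L n T p a b
        (better (fun h => Improves K m hn π q L T i A (setSlot T i j h)) ![p, a, b] best)
        (A * numUnf K m hn π q L T i)
        (A * numGe K m hn q T i + q * numGt K m hn q T i) 0 0 0)
      (tryTime K m B q M L n) [] := by
  have hb3 : q * n ≤ B := by
    have := hB.2.2.1
    rw [add_mul] at this
    omega
  have hT' := setSlot_le hT (h := ![p, a, b]) (by
    intro c
    fin_cases c
    · exact hp.le
    · exact ha.le
    · exact hb.le) i j
  set T' := setSlot T i j ![p, a, b] with hT'def
  set ta := A * numUnf K m hn π q L T i
  set tb := A * numGe K m hn q T i + q * numGt K m hn q T i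
  have hev := runs_eval_search (K := K) (m := m) (π := π) (L := L) (p := p) (a := a) (b := b)
    (ta := ta) (tb := tb) (u := 0) (e := 0) (h := 0) (best := best) hn hB hT' i.2.le
  unfold tryTime
  refine ((((Runs.cpy (.slot i j 0) .sp).seq_nil <| (Runs.cpy (.slot i j 1) .sa).seq_nil <|
    Runs.cpy (.slot i j 2) .sb)).seq_nil <|
    (hev.start ?_).seq_nil <|
    (runs_mulP (d := .eu) (x := .eu) (y := .q) (by rfl) ?_ (fun _ => rfl)
      (fun _ _ _ _ _ => rfl)).seq_nil <|
    (runs_mulP (d := .eh) (x := .eh) (y := .q) (by rfl) ?_ (fun _ => rfl)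
      (fun _ _ _ _ _ => rfl)).seq_nil <|
    (Runs.iteLe (T := 4) (s' := searchMem q M L n T' p a b
      (better (fun h => Improves K m hn π q L T i A (setSlot T i j h)) ![p, a, b] best) ta tb
      (numUnf K m hn π q L T' i * q) (numGe K m hn q T' i) (numGt K m hn q T' i * q))
      (fun h1 => ?_) (fun h1 => ?_)).seq_nil <|
    (((Runs.cpy (.slot i j 0) .zero).seq_nil <| (Runs.cpy (.slot i j 1) .zero).seq_nil <|
    Runs.cpy (.slot i j 2) .zero)).seq_nil <|
    (Runs.cst .eu 0 (Nat.zero_le _)).seq_nil <| (Runs.cst .en 0 (Nat.zero_le _)).seq_nil <|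
    (Runs.cst .eh 0 (Nat.zero_le _))).congr ?_ ?_
  · rw [hT'def, ← updTab_eq_setSlot]
    rfl
  · change numUnf K m hn π q L T' i * q ≤ B
    refine le_trans ?_ hb3
    rw [mul_comm]
    exact Nat.mul_le_mul_left _ (numUnf_le _ _ _ _ _)
  · change numGt K m hn q T' i * q ≤ B
    refine le_trans ?_ hb3
    rw [mul_comm]
    exact Nat.mul_le_mul_left _ (numGt_le _ _ _ _)
  · replace h1 : numUnf K m hn π q L T' i * q ≤ ta := h1
    refine Runs.iteLe (fun h2 => ?_) (fun h2 => ?_)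
    · replace h2 : numGt K m hn q T' i * q ≤ tb := h2
      have hI : Improves K m hn π q L T i A (setSlot T i j ![p, a, b]) :=
        ⟨by rwa [mul_comm], by rwa [mul_comm q (numGt K m hn q _ i)]⟩
      refine ((Runs.cpy .bp .sp).seq_nil <| (Runs.cpy .ba .sa).seq_nil <|
        Runs.cpy .bb .sb).congr ?_ le_rfl
      rw [better, if_pos hI]
      rfl
    · replace h2 : tb < numGt K m hn q T' i * q := h2
      have hI : ¬ Improves K m hn π q L T i A (setSlot T i j ![p, a, b]) := fun h =>
        absurd h.2 (by rw [mul_comm q (numGt K m hn q (setSlot _ _ _ _) i)]; exact not_le.2 h2)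
      refine Runs.skip.congr ?_ (by omega)
      rw [better, if_neg hI]
      rfl
  · replace h1 : ta < numUnf K m hn π q L T' i * q := h1
    have hI : ¬ Improves K m hn π q L T i A (setSlot T i j ![p, a, b]) := fun h =>
      absurd h.1 (by rw [mul_comm]; exact not_le.2 h1)
    refine Runs.skip.congr ?_ (by omega)
    rw [better, if_neg hI]
    rfl
  · have h2 := updTab_eq_setSlot T' i j (fun _ => 0)
    have h3 : setSlot T' i j (fun _ => 0) = T := by
      rw [hT'def, setSlot_setSlot, setSlot_self h0]
    exact congrArg (fun T => searchMem q M L n T p a b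
      (better (fun h => Improves K m hn π q L _ i A (setSlot _ i j h)) ![p, a, b] best)
      ta tb 0 0 0) (h2.trans h3)
  · change 1 + (1 + 1) + (evalTime K m B q M L n + (3 * q + 10 + (3 * q + 10 + _))) ≤ _
    omega

end CycleLeaders

/-! ### Exhaustive search for a hash function -/

namespace CycleLeaders

variable {K m n : ℕ} {π : Equiv.Perm (Elem n)} {B : ℕ} {p p' : Prog (numRegs K m)}
  {s s' s'' : Mem} {T T' : ℕ} {out out' : List (Elem n)}

/-- The result of applying `g 0`, …, `g (N - 1)` to `a`. -/
def iter {α : Type*} (g : ℕ → α → α) (a : α) : ℕ → α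
  | 0 => a
  | N + 1 => g N (iter g a N)

theorem iter_induction {α : Type*} {P : α → Prop} {g : ℕ → α → α} {a : α} {N : ℕ}
    (hg : ∀ i < N, ∀ a, P a → P (g i a)) (ha : P a) : P (iter g a N) := by
  induction N with
  | zero => exact ha
  | succ N ih => exact hg N (by omega) _ (ih fun i hi => hg i (by omega))

theorem iter_reaches {α : Type*} {P : α → Prop} {g : ℕ → α → α} {a : α} {N i : ℕ} (hi : i < N)
    (hg : ∀ j, ∀ a, P a → P (g j a)) (h : ∀ a, P (g i a)) : P (iter g a N) := by
  induction N with
  | zero => omega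
  | succ N ih =>
    rcases Nat.lt_succ_iff_lt_or_eq.1 hi with h1 | rfl
    · exact hg N _ (ih h1)
    · exact h _

/-- The best triple with entries below `M`. -/
noncomputable def scan (P : (Fin 3 → ℕ) → Prop) (M : ℕ) : Fin 3 → ℕ :=
  iter (fun p best => iter (fun a best => iter (fun b best => better P ![p, a, b] best) best M)
    best M) (fun _ => 0) M

theorem scan_le (P : (Fin 3 → ℕ) → Prop) (M : ℕ) (c : Fin 3) : scan P M c ≤ M := by
  refine iter_induction (P := fun f : Fin 3 → ℕ => ∀ c, f c ≤ M) (fun p hp _ h => ?_)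
    (fun _ => Nat.zero_le _) c
  refine iter_induction (P := fun f : Fin 3 → ℕ => ∀ c, f c ≤ M) (fun a ha _ h => ?_) h
  refine iter_induction (P := fun f : Fin 3 → ℕ => ∀ c, f c ≤ M) (fun b hb _ h => ?_) h
  intro c
  unfold better
  split_ifs
  · fin_cases c
    · exact hp.le
    · exact ha.le
    · exact hb.le
  · exact h c

/-- An acceptable triple is only ever replaced by another acceptable one, so the scan ends with the
last of them. If there is none, the zero triple remains and the slot stays empty. -/
theorem scan_spec {P : (Fin 3 → ℕ) → Prop} {M p a b : ℕ} (hp : p < M) (ha : a < M) (hb : b < M)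
    (h : P ![p, a, b]) : P (scan P M) := by
  have h1 : ∀ h best, P best → P (better P h best) := by
    intro h best hP
    unfold better
    split_ifs with h'
    · exact h'
    · exact hP
  have h2 : ∀ best, P (better P ![p, a, b] best) := by
    intro best
    rwa [better, if_pos h]
  have h3 : ∀ p a best, P best → P (iter (fun b best => better P ![p, a, b] best) best M) :=
    fun p a best hP => iter_induction (fun _ _ _ h => h1 _ _ h) hP
  exact iter_reaches hp (fun _ _ h => iter_induction (fun _ _ _ h => h3 _ _ _ h) h)
    fun _ => iter_reaches ha (fun _ _ h => h3 _ _ _ h) fun _ => iter_reaches hb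
      (fun _ _ h => h1 _ _ h) h2

/-- Find a hash function for slot `(i, j)` that improves the table. -/
noncomputable def searchP (A : ℕ) (i : Fin K) (j : Fin m) : Prog (numRegs K m) :=
  evalP i ⨾ iCst .sp A ⨾ mulP .ta .eu .sp ⨾ mulP .tb .en .sp ⨾ mulP .sa .eh .q ⨾
    iPlus .tb .tb .sa ⨾ iCst .eu 0 ⨾ iCst .en 0 ⨾ iCst .eh 0 ⨾ iCst .sp 0 ⨾ iCst .sa 0 ⨾
    .while (tlt .sp .M)
      (.while (tlt .sa .M)
        (.while (tlt .sb .M) (tryP i j ⨾ iPlus .sb .sb .one) ⨾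
          iCst .sb 0 ⨾ iPlus .sa .sa .one) ⨾
        iCst .sa 0 ⨾ iPlus .sp .sp .one) ⨾
    storeP i j .bp .ba .bb ⨾ iCst .sp 0 ⨾ iCst .bp 0 ⨾ iCst .ba 0 ⨾ iCst .bb 0 ⨾ iCst .ta 0 ⨾
    iCst .tb 0

/-- The memory with global registers and table set, and the other registers cleared. -/
def baseMem (q M L n : ℕ) (T : ℕ → ℕ → Fin 3 → ℕ) : Mem :=
  searchMem q M L n T 0 0 0 (fun _ => 0) 0 0 0 0 0

/-- A bound for the time of `searchP`. -/
def searchTime (A K m B q M L n : ℕ) : ℕ :=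
  evalTime K m B q M L n + 6 * A + 3 * q + 60 +
    M * (M * (M * (tryTime K m B q M L n + 2) + 4) + 4)

theorem runs_searchP {A q M L : ℕ} {T : ℕ → ℕ → Fin 3 → ℕ} (hn : 1 ≤ n)
    (hB : BoundOK K A q M n B) (hT : ∀ i j c, T i j c ≤ M) (i : Fin K) (j : Fin m)
    (h0 : T i j = fun _ => 0) :
    Runs (K := K) (m := m) π B (searchP A i j) (baseMem q M L n T)
      (baseMem q M L n (setSlot T i j
        (scan (fun h => Improves K m hn π q L T i A (setSlot T i j h)) M)))
      (searchTime A K m B q M L n) [] := by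
  set P := fun h => Improves K m hn π q L T i A (setSlot T i j h) with hP
  set ta := A * numUnf K m hn π q L T i with hta
  set tb := A * numGe K m hn q T i + q * numGt K m hn q T i with htb
  have h5 := hB.2.2.2.2
  have hAB : A * n + q * n ≤ B := by
    rw [← add_mul]
    exact hB.2.2.1
  have b1 : A * numUnf K m hn π q L T i ≤ A * n := Nat.mul_le_mul_left _ (numUnf_le _ _ _ _ _)
  have b2 : A * numGe K m hn q T i ≤ A * n := Nat.mul_le_mul_left _ (numGe_le _ _ _ _)
  have b3 : q * numGt K m hn q T i ≤ q * n := Nat.mul_le_mul_left _ (numGt_le _ _ _ _)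
  refine .of_bdd fun hs => ?_
  have hMB : M ≤ B := hs .M
  have loop3 : ∀ p < M, ∀ a < M, ∀ best, Runs (K := K) (m := m) π B
      (.while (tlt .sb .M) (tryP i j ⨾ iPlus .sb .sb .one))
      (searchMem q M L n T p a 0 best ta tb 0 0 0)
      (searchMem q M L n T p a M (iter (fun b best => better P ![p, a, b] best) best M)
        ta tb 0 0 0) (M * (tryTime K m B q M L n + 2) + 1) [] := by
    intro p hp a ha best
    refine Runs.while_const (π := π) (B := B) M
      (fun b => searchMem q M L n T p a b
        (iter (fun b best => better P ![p, a, b] best) best b) ta tb 0 0 0)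
      (tryTime K m B q M L n + 1) (fun b hb => ?_) (fun b hb => ?_) ?_
    · rw [tlt_holds]
      exact hb
    · refine ((runs_tryP hn hB hT i j h0 hp ha hb).seq_nil
        (Runs.plus .sb .sb .one fun _ => ?_)).congr rfl le_rfl
      change b + 1 ≤ B
      omega
    · rw [tlt_holds]
      exact lt_irrefl M
  have loop2 : ∀ p < M, ∀ best, Runs (K := K) (m := m) π B
      (.while (tlt .sa .M) (.while (tlt .sb .M) (tryP i j ⨾ iPlus .sb .sb .one) ⨾
          iCst .sb 0 ⨾ iPlus .sa .sa .one))
      (searchMem q M L n T p 0 0 best ta tb 0 0 0)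
      (searchMem q M L n T p M 0
        (iter (fun a best => iter (fun b best => better P ![p, a, b] best) best M) best M)
        ta tb 0 0 0) (M * (M * (tryTime K m B q M L n + 2) + 4) + 1) [] := by
    intro p hp best
    refine Runs.while_const (π := π) (B := B) M
      (fun a => searchMem q M L n T p a 0
        (iter (fun a best => iter (fun b best => better P ![p, a, b] best) best M) best a)
          ta tb 0 0 0)
      (M * (tryTime K m B q M L n + 2) + 3) (fun a ha => ?_) (fun a ha => ?_) ?_
    · rw [tlt_holds]
      exact ha
    · refine ((loop3 p hp a ha _).seq_nil <| (Runs.cst .sb 0 (Nat.zero_le _)).seq_nil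
        (Runs.plus .sa .sa .one fun _ => ?_)).congr rfl le_rfl
      change a + 1 ≤ B
      omega
    · rw [tlt_holds]
      exact lt_irrefl M
  have loop1 : Runs (K := K) (m := m) π B (.while (tlt .sp .M)
      (.while (tlt .sa .M) (.while (tlt .sb .M) (tryP i j ⨾ iPlus .sb .sb .one) ⨾
          iCst .sb 0 ⨾ iPlus .sa .sa .one) ⨾ iCst .sa 0 ⨾ iPlus .sp .sp .one))
      (searchMem q M L n T 0 0 0 (fun _ => 0) ta tb 0 0 0)
      (searchMem q M L n T M 0 0 (scan P M) ta tb 0 0 0)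
      (M * (M * (M * (tryTime K m B q M L n + 2) + 4) + 4) + 1) [] := by
    refine Runs.while_const (π := π) (B := B) M
      (fun p => searchMem q M L n T p 0 0
        (iter (fun p best => iter (fun a best => iter (fun b best => better P ![p, a, b] best)
          best M) best M) (fun _ => 0) p) ta tb 0 0 0)
      (M * (M * (tryTime K m B q M L n + 2) + 4) + 3) (fun p hp => ?_) (fun p hp => ?_) ?_
    · rw [tlt_holds]
      exact hp
    · refine ((loop2 p hp _).seq_nil <| (Runs.cst .sa 0 (Nat.zero_le _)).seq_nil
        (Runs.plus .sp .sp .one fun _ => ?_)).congr rfl le_rfl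
      change p + 1 ≤ B
      omega
    · rw [tlt_holds]
      exact lt_irrefl M
  have hev := runs_eval_search (K := K) (m := m) (π := π) (L := L) (p := 0) (a := 0) (b := 0)
    (ta := 0) (tb := 0) (u := 0) (e := 0) (h := 0) (best := fun _ => 0) hn hB hT i.2.le
  -- While the thresholds `ta` and `tb` are computed, `sp` and `sa` serve as temporaries for `A` and
  -- for `q` times the number of elements above the level. They are cleared before the loops use
  -- them as counters.
  refine (hev.seq_nil <| (Runs.cst .sp A (by omega)).seq_nil <|
    (runs_mulP (d := .ta) (x := .eu) (y := .sp) (by rfl) ?_ (fun _ => rfl)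
      (fun _ _ _ _ _ => rfl)).seq_nil <|
    (runs_mulP (d := .tb) (x := .en) (y := .sp) (by rfl) ?_ (fun _ => rfl)
      (fun _ _ _ _ _ => rfl)).seq_nil <|
    (runs_mulP (d := .sa) (x := .eh) (y := .q) (by rfl) ?_ (fun _ => rfl)
      (fun _ _ _ _ _ => rfl)).seq_nil <|
    (Runs.plus .tb .tb .sa fun _ => ?_).seq_nil <|
    (Runs.cst .eu 0 (Nat.zero_le _)).seq_nil <| (Runs.cst .en 0 (Nat.zero_le _)).seq_nil <|
    (Runs.cst .eh 0 (Nat.zero_le _)).seq_nil <| (Runs.cst .sp 0 (Nat.zero_le _)).seq_nil <|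
    (Runs.cst .sa 0 (Nat.zero_le _)).seq_nil <| (loop1.start ?_).seq_nil <|
    ((Runs.cpy (.slot i j 0) .bp).seq_nil <| (Runs.cpy (.slot i j 1) .ba).seq_nil <|
      Runs.cpy (.slot i j 2) .bb).seq_nil <|
    (Runs.cst .sp 0 (Nat.zero_le _)).seq_nil <| (Runs.cst .bp 0 (Nat.zero_le _)).seq_nil <|
    (Runs.cst .ba 0 (Nat.zero_le _)).seq_nil <| (Runs.cst .bb 0 (Nat.zero_le _)).seq_nil <|
    (Runs.cst .ta 0 (Nat.zero_le _)).seq_nil <| (Runs.cst .tb 0 (Nat.zero_le _))).congr ?_ ?_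
  · change numUnf K m hn π q L T i * A ≤ B
    rw [mul_comm]
    omega
  · change numGe K m hn q T i * A ≤ B
    rw [mul_comm]
    omega
  · change numGt K m hn q T i * q ≤ B
    rw [mul_comm]
    omega
  · change numGe K m hn q T i * A + numGt K m hn q T i * q ≤ B
    rw [mul_comm, mul_comm _ q]
    omega
  · rw [hta, htb, mul_comm A, mul_comm A, mul_comm q]
    rfl
  · rw [← updTab_eq_setSlot]
    rfl
  · unfold searchTime
    change evalTime K m B q M L n + (1 + (3 * A + 10 + (3 * A + 10 + (3 * q + 10 + _)))) ≤ _
    omega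

end CycleLeaders

/-! ### Initialization, filling the table, and reporting the leaders -/

namespace CycleLeaders

variable {K m n : ℕ} {π : Equiv.Perm (Elem n)} {B : ℕ} {p p' : Prog (numRegs K m)}
  {s s' s'' : Mem} {T T' : ℕ} {out out' : List (Elem n)}

theorem Runs.nil_seq (h : Runs π B p s s' T out) (h' : Runs π B p' s' s'' T' []) :
    Runs π B (.seq p p') s s'' (T + T') out := by
  have := h.seq h'
  rwa [List.append_nil] at this

/-- `sp := q ^ e` -/
noncomputable def powP (e : ℕ) : Prog (numRegs K m) :=
  iCst .sp 1 ⨾ unroll e fun _ => mulP .sp .sp .q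

/-- The memory during the initialization. -/
def initMem (q M L lim n p : ℕ) : Mem :=
  { searchMem q M L n (fun _ _ _ => 0) p 0 0 (fun _ => 0) 0 0 0 0 0 with wlim := lim }

theorem runs_powP {e q M L lim p : ℕ} (hB : q ^ e ≤ B) (hq : 1 ≤ q) :
    Runs (K := K) (m := m) π B (powP e) (initMem q M L lim n p) (initMem q M L lim n (q ^ e))
      (e * (3 * q + 10) + 2) [] := by
  have hpow : ∀ i ≤ e, q ^ i ≤ B := fun i hi => (Nat.pow_le_pow_right hq hi).trans hB
  have loop := Runs.unroll (π := π) (B := B) e (fun _ => (mulP .sp .sp .q : Prog (numRegs K m)))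
    (fun i => initMem q M L lim n (q ^ i)) (T := 3 * q + 10) fun i => by
      refine (runs_mulP (d := .sp) (x := .sp) (y := .q) (by rfl) ?_ (fun _ => rfl)
        (fun _ _ _ _ _ => rfl)).congr rfl le_rfl
      change q ^ (i : ℕ) * q ≤ B
      rw [← pow_succ]
      exact hpow _ i.2
  refine ((Runs.cst .sp 1 (hpow 0 (Nat.zero_le _))).seq_nil (loop.start rfl)).congr rfl ?_
  omega

theorem exists_le_pow (n : ℕ) {c : ℕ} (hc : 1 ≤ c) : ∃ q, n ≤ (q + 1) ^ c :=
  ⟨n, (Nat.le_succ n).trans (Nat.le_self_pow (by omega) _)⟩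

/-- The least positive `q` with `n ≤ q ^ c`. -/
noncomputable def root (n : ℕ) {c : ℕ} (hc : 1 ≤ c) : ℕ := Nat.find (exists_le_pow n hc) + 1

theorem le_root_pow (n : ℕ) {c : ℕ} (hc : 1 ≤ c) : n ≤ root n hc ^ c :=
  Nat.find_spec (exists_le_pow n hc)

theorem pow_lt_of_lt_root {n c q : ℕ} (hc : 1 ≤ c) (h : q + 1 < root n hc) : (q + 1) ^ c < n :=
  not_le.1 (Nat.find_min (exists_le_pow n hc) (Nat.lt_of_succ_lt_succ h))

theorem root_le (hn : 1 ≤ n) {c : ℕ} (hc : 1 ≤ c) : root n hc ≤ n := by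
  by_contra! h
  have h1 : (n - 1 + 1) ^ c < n := pow_lt_of_lt_root hc (by omega)
  rw [Nat.sub_add_cancel hn] at h1
  exact absurd (Nat.le_self_pow (by omega : c ≠ 0) n) (by omega)

theorem root_pos (n : ℕ) {c : ℕ} (hc : 1 ≤ c) : 1 ≤ root n hc := Nat.succ_pos _

/-- Initialize the global registers. -/
noncomputable def initP (c : ℕ) : Prog (numRegs K m) :=
  iCst .one 1 ⨾ iSiz .nn ⨾ iCst .q 1 ⨾ powP c ⨾
    .while (tlt .sp .nn) (iPlus .q .q .one ⨾ powP c) ⨾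
    powP 4 ⨾ iCpy .M .sp ⨾ powP 2 ⨾ iCpy .L .sp ⨾ iCpy .wlim .sp ⨾ iCst .sp 0

/-- The memory in which all registers are zero. -/
def zeroMem : Mem :=
  { lo := Lo.zero, lx := 0, lv := 0, rr := 0, wlim := 0, wr := 0, wy := 0, cnt := 0, res := 0
    ex := 0, eu := 0, en := 0, eh := 0, sp := 0, sa := 0, sb := 0
    bp := 0, ba := 0, bb := 0, ta := 0, tb := 0
    q := 0, M := 0, L := 0, nn := 0, one := 0, zero := 0, tab := fun _ _ _ => 0 }

theorem zeroMem_get (r : Reg K m) : zeroMem.get r = 0 := by cases r <;> rfl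

theorem encode_zeroMem : encode K m zeroMem = fun _ => 0 := funext fun _ => zeroMem_get _

/-- A bound for the time of `initP`. -/
def initTime (c q : ℕ) : ℕ := q * (c * (3 * q + 10) + 4) + (c + 6) * (3 * q + 10) + 20

/-- The root is found by trying `1, 2, …` and recomputing the power each time. Every power formed
has base at most `root n hc ≤ n` and exponent at most `c + 4`, whence the bound in `hB`. -/
theorem runs_initP {c : ℕ} (hn : 1 ≤ n) (hc : 1 ≤ c) (hB : n ^ (c + 4) ≤ B) :
    Runs (K := K) (m := m) π B (initP c) zeroMem
      (baseMem (root n hc) (root n hc ^ 4) (root n hc ^ 2) n fun _ _ _ => 0)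
      (initTime c (root n hc)) [] := by
  have hqn := root_le hn hc
  have hq1 := root_pos n hc
  have hspec := le_root_pow n hc
  have hmin : ∀ j, j + 1 < root n hc → (j + 1) ^ c < n := fun j => pow_lt_of_lt_root hc
  set q := root n hc
  have hpow : ∀ i ≤ c + 4, ∀ j ≤ q, j ^ i ≤ B := fun i hi j hj =>
    (Nat.pow_le_pow_left (hj.trans hqn) _).trans
      ((Nat.pow_le_pow_right hn hi).trans hB)
  have hnB : n ≤ B := (Nat.le_self_pow (by omega : c + 4 ≠ 0) n).trans hB
  have loop := Runs.while_const (π := π) (B := B) (c := tlt (K := K) (m := m) .sp .nn)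
    (p := iPlus .q .q .one ⨾ powP c) (q - 1) (fun j => initMem (j + 1) 0 0 0 n ((j + 1) ^ c))
    (c * (3 * q + 10) + 3)
    (fun j hj => by
      rw [tlt_holds]
      exact hmin j (by omega))
    (fun j hj => by
      have h := runs_powP (K := K) (m := m) (π := π) (M := 0) (L := 0) (lim := 0)
        (p := (j + 1) ^ c) (hpow c (by omega) (j + 1 + 1) (by omega)) (by omega)
      refine ((Runs.plus .q .q .one fun _ => ?_).seq_nil (h.start rfl)).congr rfl ?_
      · change j + 1 + 1 ≤ B
        omega
      · have : c * (3 * (j + 1 + 1) + 10) ≤ c * (3 * q + 10) :=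
          Nat.mul_le_mul_left _ (by omega)
        omega)
    (by
      rw [tlt_holds, Nat.sub_add_cancel hq1]
      exact not_lt.2 hspec)
  rw [Nat.sub_add_cancel hq1] at loop
  have h1 := runs_powP (K := K) (m := m) (π := π) (n := n) (M := 0) (L := 0) (lim := 0) (p := 0)
    (hpow c (by omega) 1 (by omega)) le_rfl
  have h2 := runs_powP (K := K) (m := m) (π := π) (n := n) (M := 0) (L := 0) (lim := 0)
    (p := q ^ c) (hpow 4 (by omega) q le_rfl) hq1
  have h3 := runs_powP (K := K) (m := m) (π := π) (n := n) (M := q ^ 4) (L := 0) (lim := 0)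
    (p := q ^ 4) (hpow 2 (by omega) q le_rfl) hq1
  refine ((Runs.cst .one 1 (by omega)).seq_nil <| (Runs.siz .nn hnB).seq_nil <|
    (Runs.cst .q 1 (by omega)).seq_nil <| (h1.start rfl).seq_nil <|
    (loop.start rfl).seq_nil <| h2.seq_nil <| (Runs.cpy .M .sp).seq_nil <|
    (h3.start rfl).seq_nil <| (Runs.cpy .L .sp).seq_nil <| (Runs.cpy .wlim .sp).seq_nil <|
    Runs.cst .sp 0 (Nat.zero_le _)).congr rfl ?_
  unfold initTime
  have e1 : (q - 1) * (c * (3 * q + 10) + 3 + 1) ≤ q * (c * (3 * q + 10) + 4) :=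
    Nat.mul_le_mul_right _ (by omega)
  have e2 : c * (3 * 1 + 10) ≤ c * (3 * q + 10) := Nat.mul_le_mul_left _ (by omega)
  rw [add_mul c 6]
  omega

section

variable (K m : ℕ) (hn : 1 ≤ n) (π : Equiv.Perm (Elem n)) (A q M L : ℕ)

/-- The table after the search for slot `(i, j)`. -/
noncomputable def nextTab (i j : ℕ) (T : ℕ → ℕ → Fin 3 → ℕ) : ℕ → ℕ → Fin 3 → ℕ :=
  setSlot T i j (scan (fun h => Improves K m hn π q L T i A (setSlot T i j h)) M)

/-- The table after the searches for the first `j` slots of row `i`. -/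
noncomputable def rowTab (i : ℕ) (T : ℕ → ℕ → Fin 3 → ℕ) (j : ℕ) : ℕ → ℕ → Fin 3 → ℕ :=
  iter (nextTab K m hn π A q M L i) T j

/-- The table after the searches for the first `i` rows. -/
noncomputable def allTab (i : ℕ) : ℕ → ℕ → Fin 3 → ℕ :=
  iter (fun i T => rowTab K m hn π A q M L i T m) (fun _ _ _ => 0) i

variable {K m hn π A q M L}

theorem nextTab_of_ne {i j i' j' : ℕ} (h : ¬ (i' = i ∧ j' = j)) (T : ℕ → ℕ → Fin 3 → ℕ) :
    nextTab K m hn π A q M L i j T i' j' = T i' j' := if_neg h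

/-- A search alters only its own slot. Together with `allTab_of_le` this shows that a slot is still
empty when its search begins. -/
theorem rowTab_of_ne {i j i' j' : ℕ} (h : i' ≠ i ∨ j ≤ j') (T : ℕ → ℕ → Fin 3 → ℕ) :
    rowTab K m hn π A q M L i T j i' j' = T i' j' := by
  unfold rowTab
  induction j with
  | zero => rfl
  | succ j ih =>
    rw [iter, nextTab_of_ne (by omega), ih (by omega)]

theorem allTab_of_le {i i' : ℕ} (h : i ≤ i') (j' : ℕ) :
    allTab K m hn π A q M L i i' j' = fun _ => 0 := by
  unfold allTab
  induction i with
  | zero => rfl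
  | succ i ih =>
    rw [iter, rowTab_of_ne (by omega), ih (by omega)]

theorem rowTab_le {i j : ℕ} {T : ℕ → ℕ → Fin 3 → ℕ} (hT : ∀ i j c, T i j c ≤ M) :
    ∀ i' j' c, rowTab K m hn π A q M L i T j i' j' c ≤ M :=
  iter_induction (P := fun T : ℕ → ℕ → Fin 3 → ℕ => ∀ i j c, T i j c ≤ M)
    (fun _ _ _ h => setSlot_le h (scan_le _ _) _ _) hT

theorem allTab_le {i : ℕ} : ∀ i' j' c, allTab K m hn π A q M L i i' j' c ≤ M :=
  iter_induction (P := fun T : ℕ → ℕ → Fin 3 → ℕ => ∀ i j c, T i j c ≤ M)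
    (fun _ _ _ h => rowTab_le h) fun _ _ _ => Nat.zero_le _

end

/-- Fill the table. -/
noncomputable def fillP (A : ℕ) : Prog (numRegs K m) :=
  unroll K fun i => unroll m fun j => searchP A i j

theorem runs_fillP {A q M L : ℕ} (hn : 1 ≤ n) (hB : BoundOK K A q M n B) :
    Runs (K := K) (m := m) π B (fillP A) (baseMem q M L n fun _ _ _ => 0)
      (baseMem q M L n (allTab K m hn π A q M L K))
      (K * (m * searchTime A K m B q M L n + 1) + 1) [] := by
  refine Runs.unroll K _ (fun i => baseMem q M L n (allTab K m hn π A q M L i)) fun i => ?_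
  refine Runs.unroll m _ (fun j => baseMem q M L n
    (rowTab K m hn π A q M L i (allTab K m hn π A q M L i) j)) fun j => ?_
  refine runs_searchP hn hB (rowTab_le allTab_le) i j ?_
  rw [rowTab_of_ne (Or.inr le_rfl), allTab_of_le le_rfl]

/-- Decide whether the next element is a leader, and report it if it is. -/
noncomputable def leaderStepP : Prog (numRegs K m) :=
  iPlus .ex .ex .one ⨾ iCpy .lx .ex ⨾ levP ⨾ iCpy .wr .lv ⨾ walkP ⨾ iCst .wy 2 ⨾
    .ite (teq .res .wy) (iTell .ex) .skip ⨾ iCst .wr 0 ⨾ iCst .wy 0 ⨾ iCst .res 0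

open Classical in
/-- The output for the element `x`. -/
noncomputable def leaderOut (ℓ : ℕ → ℕ) (π : Equiv.Perm (Elem n)) (x : Elem n) : List (Elem n) :=
  if walkRes ℓ π n x = 2 then [x] else []

theorem runs_leaderStepP {i : ℕ} (hn : 1 ≤ n) (hg : s.Good n B) (hK : K ≤ B)
    (h3 : 3 ≤ B) (hi : i < n) :
    Runs (K := K) (m := m) π B leaderStepP (s.mid n i 0 0 0) (s.mid n (i + 1) 0 0 0)
      (walkLen (s.lev K m) π n (el hn i) * (levTime K m B s.q s.M + 11) +
        (levTime K m B s.q s.M + 20)) (leaderOut (s.lev K m) π (el hn i)) := by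
  have h1 : s.one = 1 := hg.1
  have hnB : n ≤ B := hg.2.2.2.2.2.2.1
  have hx : (el hn i : ℕ) = i + 1 := el_val hn hi
  set x := el hn i
  have hlev := runs_levP (K := K) (m := m) (π := π)
    (s := { s.mid n (i + 1) 0 0 0 with lx := i + 1 }) hg hi rfl hK
  have hwalk := runs_walkP (K := K) (m := m) (π := π) (x := x)
    (s := { s.mid n (i + 1) 0 0 0 with
      lx := i + 1, lv := s.lev K m x, wr := s.lev K m x }) hg rfl hK h3
      hx.symm rfl hx.symm rfl
  refine ((Runs.plus .ex .ex .one fun _ => ?_).seq_nil <| (Runs.cpy .lx .ex).seq_nil <|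
    (hlev.start ?_).seq_nil <| (Runs.cpy .wr .lv).seq_nil <| (hwalk.start ?_).seq_nil <|
    (Runs.cst .wy 2 (by omega)).seq_nil <|
    (Runs.iteEq (T := 1) (out := leaderOut (s.lev K m) π x)
      (s' := { s.mid n (i + 1) 0 0 0 with
        wr := s.lev K m x, wy := 2, res := walkRes (s.lev K m) π n x })
      (fun hc => ?_) (fun hc => ?_)).nil_seq <|
    (Runs.cst .wr 0 (Nat.zero_le _)).seq_nil <| (Runs.cst .wy 0 (Nat.zero_le _)).seq_nil <|
    (Runs.cst .res 0 (Nat.zero_le _))).congr ?_ ?_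
  · change i + s.one ≤ B
    omega
  · simp only [Mem.mid, Mem.set, Mem.get, h1]
  · rw [hx]
    rfl
  · replace hc : walkRes (s.lev K m) π n x = 2 := hc
    rw [leaderOut, if_pos hc]
    exact Runs.tell _ x hx.symm
  · replace hc : walkRes (s.lev K m) π n x ≠ 2 := hc
    rw [leaderOut, if_neg hc]
    exact Runs.skip
  · rfl
  · change 1 + (1 + (levTime K m B s.q s.M + (1 +
      (walkLen (s.lev K m) π n x * (levTime K m B s.q s.M + 11) + 8 + _)))) ≤ _
    omega

/-- Report the leaders. -/
noncomputable def leadersP : Prog (numRegs K m) :=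
  iCpy .wlim .nn ⨾ .while (tlt .ex .nn) leaderStepP

/-- The whole program. -/
noncomputable def mainP (A c : ℕ) : Prog (numRegs K m) := initP c ⨾ fillP A ⨾ leadersP

/-- The list of reported elements. -/
noncomputable def leaders (hn : 1 ≤ n) (ℓ : ℕ → ℕ) (π : Equiv.Perm (Elem n)) : List (Elem n) :=
  (List.range n).flatMap fun i => leaderOut ℓ π (el hn i)

/-- The walks now have limit `n`, which never decides a walk (see `walkRes_eq_two_iff`). Their total
length is left open here and bounded later by `sum_walkLen_finalTab_le`. -/
theorem runs_leadersP (hn : 1 ≤ n) {A q M L : ℕ} {T : ℕ → ℕ → Fin 3 → ℕ}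
    (hB : BoundOK K A q M n B) (hT : ∀ i j c, T i j c ≤ M) :
    Runs (K := K) (m := m) π B leadersP (baseMem q M L n T)
      ((baseMem q M L n T).mid n n 0 0 0)
      ((∑ x, walkLen (level K m q T) π n x) * (levTime K m B q M + 11) +
        n * (levTime K m B q M + 21) + 2) (leaders hn (level K m q T) π) := by
  have h5 := hB.2.2.2.2
  have loop := Runs.while (π := π) (B := B) (c := tlt (K := K) (m := m) .ex .nn)
    (p := leaderStepP) n (fun i => (baseMem q M L n T).mid n i 0 0 0)
    (fun i => walkLen (level K m q T) π n (el hn i) * (levTime K m B q M + 11) +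
      (levTime K m B q M + 20))
    (fun i => leaderOut (level K m q T) π (el hn i))
    (fun i hi => by
      rw [tlt_holds]
      exact hi)
    (fun i hi => runs_leaderStepP hn (searchMem_good hB hT) (by omega) (by omega) hi)
    (by
      rw [tlt_holds]
      exact lt_irrefl n)
  refine ((Runs.cpy .wlim .nn).seq_nil (loop.start rfl)).congr rfl ?_
  have : ∑ j ∈ Finset.range n, (walkLen (level K m q T) π n (el hn j) *
      (levTime K m B q M + 11) + (levTime K m B q M + 20) + 1) =
      (∑ x, walkLen (level K m q T) π n x) * (levTime K m B q M + 11) +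
      n * (levTime K m B q M + 21) := by
    rw [Finset.sum_mul, ← sum_el hn]
    simp only [add_assoc, Finset.sum_add_distrib]
    simp
    ring
  omega

/-- A bound for the time of `mainP`, where the final walks take `W` steps in total. -/
def mainTime (A c K m B q n W : ℕ) : ℕ :=
  initTime c q + (K * (m * searchTime A K m B q (q ^ 4) (q ^ 2) n + 1) + 1) +
    (W * (levTime K m B q (q ^ 4) + 11) + n * (levTime K m B q (q ^ 4) + 21) + 2)

/-- The table that the program computes. -/
noncomputable def finalTab (K m : ℕ) (hn : 1 ≤ n) (π : Equiv.Perm (Elem n)) (A q : ℕ) :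
    ℕ → ℕ → Fin 3 → ℕ := allTab K m hn π A q (q ^ 4) (q ^ 2) K

theorem exec_mainP {A c : ℕ} (hn : 1 ≤ n) (hc : 1 ≤ c) (π : Equiv.Perm (Elem n))
    (hB : BoundOK K A (root n hc) (root n hc ^ 4) n B) (hB' : n ^ (c + 4) ≤ B) :
    ∃ σ, ∃ t ≤ mainTime A c K m B (root n hc) n
        (∑ x, walkLen (level K m (root n hc) (finalTab K m hn π A (root n hc))) π n x),
      ∃ sp ≤ numRegs K m * Nat.size B,
        Exec π (mainP (K := K) (m := m) A c) (fun _ => 0) σ t sp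
          (leaders hn (level K m (root n hc) (finalTab K m hn π A (root n hc))) π) := by
  have h := (runs_initP (K := K) (m := m) (π := π) hn hc hB').seq_nil
    ((runs_fillP (L := root n hc ^ 2) hn hB).seq_nil (runs_leadersP hn hB allTab_le))
  obtain ⟨-, t, ht, sp, hsp, he⟩ := h fun r => by rw [zeroMem_get]; exact Nat.zero_le _
  rw [encode_zeroMem] at he
  refine ⟨_, t, ht.trans ?_, sp, hsp, he⟩
  unfold mainTime finalTab
  omega

end CycleLeaders

/-! ### Pairwise independent hashing with a random prime modulus -/

namespace CycleLeaders

section Hashing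

variable {p q : ℕ} [Fact p.Prime]

open Classical in
/-- The residues `r` with `q * r < p`. -/
noncomputable def smallRes (p q : ℕ) [NeZero p] : Finset (ZMod p) :=
  Finset.univ.filter fun r => q * r.val < p

theorem mem_smallRes {r : ZMod p} : r ∈ smallRes p q ↔ q * r.val < p := by simp [smallRes]

theorem card_smallRes : (smallRes p q).card = {r ∈ Finset.range p | q * r < p}.card := by
  refine Finset.card_bij (fun r _ => r.val) ?_ ?_ ?_
  · intro r hr
    simp only [Finset.mem_filter, Finset.mem_range]
    exact ⟨ZMod.val_lt r, mem_smallRes.1 hr⟩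
  · intro r _ r' _ h
    exact ZMod.val_injective p h
  · intro r hr
    simp only [Finset.mem_filter, Finset.mem_range] at hr
    refine ⟨r, ?_, ZMod.val_cast_of_lt hr.1⟩
    rw [mem_smallRes, ZMod.val_cast_of_lt hr.1]
    exact hr.2

/-- The solutions of `q * r < p` are the `⌈p / q⌉` smallest numbers; the quotient is this ceiling.
-/
theorem card_smallRes_eq (hq : 1 ≤ q) : (smallRes p q).card = (p + q - 1) / q := by
  rw [card_smallRes, ← Finset.card_range ((p + q - 1) / q)]
  congr 1
  ext r
  simp only [Finset.mem_filter, Finset.mem_range]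
  rw [Nat.lt_iff_add_one_le (m := r) (n := (p + q - 1) / q), Nat.le_div_iff_mul_le hq, add_mul,
    mul_comm r q]
  have : r ≤ q * r := Nat.le_mul_of_pos_left r hq
  omega

theorem le_mul_card_smallRes (hq : 1 ≤ q) : p ≤ q * (smallRes p q).card := by
  rw [card_smallRes_eq hq]
  have := Nat.lt_mul_div_succ (p + q - 1) hq
  rw [mul_add] at this
  omega

theorem mul_card_smallRes_le (hq : 1 ≤ q) (hqp : q ≤ p) : q * (smallRes p q).card ≤ 2 * p := by
  rw [card_smallRes_eq hq]
  have := Nat.mul_div_le (p + q - 1) q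
  omega

-- For fixed `a`, the map `b ↦ a y + b` is a bijection of the residues.
open Classical in
theorem card_pair (y : ZMod p) :
    ((Finset.univ : Finset (ZMod p × ZMod p)).filter fun w => w.1 * y + w.2 ∈ smallRes p q).card =
      p * (smallRes p q).card := by
  have : p * (smallRes p q).card = ((Finset.univ : Finset (ZMod p)) ×ˢ smallRes p q).card := by
    rw [Finset.card_product, Finset.card_univ, ZMod.card]
  rw [this]
  refine Finset.card_bij (fun w _ => (w.1, w.1 * y + w.2)) ?_ ?_ ?_
  · intro w hw
    simpa using hw
  · rintro ⟨a, b⟩ _ ⟨a', b'⟩ _ h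
    simp only [Prod.mk.injEq] at h
    obtain ⟨rfl, h⟩ := h
    simpa using h
  · rintro ⟨a, b⟩ h
    refine ⟨(a, b - a * y), ?_, ?_⟩
    · simpa using h
    · simp

-- Pairwise independence: `(a, b) ↦ (a y + b, a y' + b)` is a linear bijection, since its
-- determinant `y - y'` is invertible modulo a prime.
open Classical in
theorem card_pair_pair {y y' : ZMod p} (h : y ≠ y') :
    ((Finset.univ : Finset (ZMod p × ZMod p)).filter fun w =>
      w.1 * y + w.2 ∈ smallRes p q ∧ w.1 * y' + w.2 ∈ smallRes p q).card =
      (smallRes p q).card ^ 2 := by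
  have hne : y - y' ≠ 0 := sub_ne_zero.2 h
  rw [pow_two, ← Finset.card_product]
  refine Finset.card_bij (fun w _ => (w.1 * y + w.2, w.1 * y' + w.2)) ?_ ?_ ?_
  · intro w hw
    simpa using hw
  · rintro ⟨a, b⟩ _ ⟨a', b'⟩ _ h
    simp only [Prod.mk.injEq] at h
    have h1 : (a - a') * (y - y') = 0 := by linear_combination h.1 - h.2
    have h2 : a = a' := by
      rcases mul_eq_zero.1 h1 with h | h
      · exact sub_eq_zero.1 h
      · exact (hne h).elim
    subst h2
    simpa using h.1
  · rintro ⟨u, v⟩ huv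
    have e1 : (u - v) / (y - y') * y + (u - (u - v) / (y - y') * y) = u := by ring
    have e2 : (u - v) / (y - y') * y' + (u - (u - v) / (y - y') * y) = v := by
      have : (u - v) / (y - y') * (y - y') = u - v := div_mul_cancel₀ _ hne
      linear_combination -this
    refine ⟨((u - v) / (y - y'), u - (u - v) / (y - y') * y), ?_, ?_⟩
    · rw [Finset.mem_filter, e1, e2]
      simpa using huv
    · simp only [e1, e2]

open Classical in
/-- The number of the pairs of elements of `W` that are congruent modulo `p`. -/
noncomputable def collisions (p : ℕ) (W : Finset ℕ) : ℕ :=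
  {w ∈ W ×ˢ W | (w.1 : ZMod p) = w.2}.card

-- Second moment method. Let `f w` count the elements of `W` selected by the pair `w`; its mean is
-- `μ = |W| t / p`, where `t` is the number of small residues. Non-congruent pairs are independent,
-- so only colliding pairs contribute to the variance, while every `w` that misses `W` contributes
-- `μ ^ 2`.
open Classical in
theorem card_miss (W : Finset ℕ) :
    (((Finset.univ : Finset (ZMod p × ZMod p)).filter fun w =>
      ∀ y ∈ W, w.1 * (y : ZMod p) + w.2 ∉ smallRes p q).card : ℝ) *
      (W.card ^ 2 * (smallRes p q).card) ≤ collisions p W * p ^ 3 := by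
  set t : ℝ := ((smallRes p q).card : ℝ) with ht
  have hp : (0 : ℝ) < p := by exact_mod_cast (Fact.out (p := p.Prime)).pos
  set f : ZMod p × ZMod p → ℝ := fun w => ∑ y ∈ W,
    if w.1 * (y : ZMod p) + w.2 ∈ smallRes p q then 1 else 0
    with hf
  have h1 : ∑ w, f w = W.card * (p * t) := by
    rw [hf, Finset.sum_comm]
    have : ∀ y ∈ W, ∑ w : ZMod p × ZMod p,
        (if w.1 * (y : ZMod p) + w.2 ∈ smallRes p q then (1 : ℝ) else 0) = p * t := by
      intro y _
      rw [Finset.sum_boole, card_pair]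
      push_cast
      rfl
    rw [Finset.sum_congr rfl this, Finset.sum_const, nsmul_eq_mul]
  have h2 : ∑ w, f w ^ 2 ≤ W.card ^ 2 * t ^ 2 + collisions p W * (p * t) := by
    have e : ∀ w, f w ^ 2 = ∑ y ∈ W ×ˢ W, if w.1 * (y.1 : ZMod p) + w.2 ∈ smallRes p q ∧
        w.1 * (y.2 : ZMod p) + w.2 ∈ smallRes p q then 1 else 0 := by
      intro w
      rw [pow_two, hf, Finset.sum_mul_sum, ← Finset.sum_product']
      refine Finset.sum_congr rfl fun y _ => ?_
      rw [ite_and]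
      split_ifs <;> simp
    rw [Finset.sum_congr rfl fun w _ => e w, Finset.sum_comm]
    have : ∀ y ∈ W ×ˢ W, ∑ w : ZMod p × ZMod p, (if w.1 * (y.1 : ZMod p) + w.2 ∈ smallRes p q ∧
        w.1 * (y.2 : ZMod p) + w.2 ∈ smallRes p q then (1 : ℝ) else 0) ≤
        t ^ 2 + if (y.1 : ZMod p) = y.2 then p * t else 0 := by
      intro y _
      rw [Finset.sum_boole]
      by_cases h : (y.1 : ZMod p) = y.2
      · rw [if_pos h, h]
        simp only [and_self]
        rw [card_pair]
        push_cast
        have := sq_nonneg t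
        linarith
      · rw [if_neg h, card_pair_pair h]
        push_cast
        simp [ht]
    refine (Finset.sum_le_sum this).trans ?_
    rw [Finset.sum_add_distrib, Finset.sum_const, Finset.card_product, ← Finset.sum_filter,
      Finset.sum_const, nsmul_eq_mul, nsmul_eq_mul]
    unfold collisions
    push_cast
    rw [pow_two (W.card : ℝ)]
  set X := (Finset.univ : Finset (ZMod p × ZMod p)).filter fun w =>
      ∀ y ∈ W, w.1 * (y : ZMod p) + w.2 ∉ smallRes p q with hX
  set μ : ℝ := W.card * t / p with hμ
  have h3 : (X.card : ℝ) * μ ^ 2 ≤ ∑ w, (f w - μ) ^ 2 := by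
    calc (X.card : ℝ) * μ ^ 2 = ∑ w ∈ X, (f w - μ) ^ 2 := by
          rw [← nsmul_eq_mul, ← Finset.sum_const]
          refine Finset.sum_congr rfl fun w hw => ?_
          have hw' := (Finset.mem_filter.1 hw).2
          have : f w = 0 := Finset.sum_eq_zero fun y hy => if_neg (hw' y hy)
          rw [this]
          ring
      _ ≤ _ := Finset.sum_le_univ_sum_of_nonneg fun _ => sq_nonneg _
  have h4 : ∑ w, (f w - μ) ^ 2 = ∑ w, f w ^ 2 - W.card ^ 2 * t ^ 2 := by
    simp only [sub_sq]
    rw [Finset.sum_add_distrib, Finset.sum_sub_distrib, Finset.sum_const, ← Finset.sum_mul,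
      ← Finset.mul_sum, h1, Finset.card_univ, Fintype.card_prod, ZMod.card, nsmul_eq_mul, hμ]
    push_cast
    field_simp
    ring
  have h5 : (X.card : ℝ) * μ ^ 2 ≤ collisions p W * (p * t) := by linarith
  rcases (Nat.cast_nonneg (smallRes p q).card : (0 : ℝ) ≤ t).eq_or_lt with h0 | h0
  · rw [show t = 0 from h0.symm]
    simp
    positivity
  · rw [hμ, div_pow, ← mul_div_assoc, div_le_iff₀ (by positivity)] at h5
    have : (X.card * (W.card ^ 2 * t) : ℝ) * t ≤ (collisions p W * p ^ 3) * t := by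
      linarith
    exact le_of_mul_le_mul_right this h0

theorem hits_iff_mem_smallRes (u v : ZMod p) (y : ℕ) :
    Hits q ![p, u.val, v.val] y ↔ u * y + v ∈ smallRes p q := by
  have h : (u * y + v).val = (u.val * y + v.val) % p := by
    rw [← ZMod.val_natCast]
    simp
  rw [mem_smallRes, h]
  rfl

end Hashing

/-- These primes all divide `y' - y`, which is positive and at most `q ^ c`; a product of `c + 1`
primes above `q` is larger. -/
theorem card_prime_congr_le {q c n y y' : ℕ} (hq : 1 ≤ q) (hn : n ≤ q ^ c) {P : Finset ℕ}
    (hP : ∀ p ∈ P, p.Prime ∧ q < p) (hy' : y' ≤ n) (hlt : y < y') :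
    {p ∈ P | (y : ZMod p) = y'}.card ≤ c := by
  by_contra! h
  set D := {p ∈ P | (y : ZMod p) = y'} with hD
  have hdvd : ∏ p ∈ D, p ∣ y' - y := by
    refine Finset.prod_primes_dvd _ (fun p hp => (hP p (Finset.mem_filter.1 hp).1).1.prime)
      fun p hp => ?_
    rw [← Nat.modEq_iff_dvd' hlt.le, ← ZMod.natCast_eq_natCast_iff]
    exact (Finset.mem_filter.1 hp).2
  have h1 : ∏ p ∈ D, p ≤ y' - y := Nat.le_of_dvd (by omega) hdvd
  have h2 : (q + 1) ^ D.card ≤ ∏ p ∈ D, p :=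
    Finset.pow_card_le_prod _ _ _ fun p hp => (hP p (Finset.mem_filter.1 hp).1).2
  have h3 : (q + 1) ^ (c + 1) ≤ (q + 1) ^ D.card := Nat.pow_le_pow_right (by omega) h
  have h4 : q ^ c < (q + 1) ^ (c + 1) :=
    (Nat.pow_le_pow_left (Nat.le_succ q) c).trans_lt (Nat.pow_lt_pow_right (by omega) (by omega))
  omega

/-- Equal elements collide for every prime, distinct ones for at most `c` primes. The moduli are
much smaller than `n`, so collisions can be controlled only on average over the modulus. -/
theorem sum_collisions_le {q c n : ℕ} (hq : 1 ≤ q) (hn : n ≤ q ^ c) {P : Finset ℕ}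
    (hP : ∀ p ∈ P, p.Prime ∧ q < p) {W : Finset ℕ} (hW : ∀ y ∈ W, y ≤ n) :
    ∑ p ∈ P, collisions p W ≤ P.card * W.card + c * W.card ^ 2 := by
  classical
  have h1 : ∑ p ∈ P, collisions p W =
      ∑ w ∈ W ×ˢ W, {p ∈ P | (w.1 : ZMod p) = w.2}.card := by
    unfold collisions
    simp only [Finset.card_filter]
    exact Finset.sum_comm
  have h2 : ∀ w ∈ W ×ˢ W, {p ∈ P | (w.1 : ZMod p) = w.2}.card ≤
      (if w.1 = w.2 then P.card else 0) + c := by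
    intro w hw
    rw [Finset.mem_product] at hw
    rcases lt_trichotomy w.1 w.2 with h | h | h
    · have := card_prime_congr_le hq hn hP (hW _ hw.2) h
      omega
    · rw [if_pos h]
      have := Finset.card_filter_le P fun p => (w.1 : ZMod p) = w.2
      omega
    · have := card_prime_congr_le hq hn hP (hW _ hw.1) h
      simp only [eq_comm] at this ⊢
      omega
  rw [h1]
  refine (Finset.sum_le_sum h2).trans ?_
  rw [Finset.sum_add_distrib, Finset.sum_const, Finset.card_product, Finset.sum_product]
  simp only [Finset.sum_ite_eq, smul_eq_mul]
  rw [Finset.sum_congr rfl fun x hx => if_pos hx, Finset.sum_const, smul_eq_mul]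
  exact le_of_eq (by ring)

open Classical in
/-- Among the hash functions with prime modulus, there is one that selects few elements of `V` and
misses few of the sets `W x`. -/
theorem exists_hash {ι : Type*} {q c n : ℕ} (hq : 1 ≤ q) (hn : n ≤ q ^ c) {P : Finset ℕ}
    (hP : ∀ p ∈ P, p.Prime ∧ q < p) (hPc : q ^ 2 ≤ P.card) (U : Finset ι) (W : ι → Finset ℕ)
    (hW : ∀ x ∈ U, ∀ y ∈ W x, y ≤ n) (hWc : ∀ x ∈ U, q ^ 2 ≤ (W x).card) (V : Finset ι)
    (g : ι → ℕ) :
    ∃ p ∈ P, ∃ a < p, ∃ b < p,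
      q * (U.filter fun x => ∀ y ∈ W x, ¬ Hits q ![p, a, b] y).card ≤ (c + 3) * U.card ∧
      q * (V.filter fun x => Hits q ![p, a, b] (g x)).card ≤ (c + 3) * V.card := by
  have hq' : (0 : ℝ) < q := by exact_mod_cast hq
  have hPne : P.Nonempty := Finset.card_pos.1 (lt_of_lt_of_le (by positivity) hPc)
  have hPq : (q : ℝ) ^ 2 ≤ P.card := by exact_mod_cast hPc
  -- The modulus is fixed first, by averaging over `P`. The mean collision rate of `W x` is at most
  -- `1 / |W x| + c / |P| ≤ (c + 1) / q ^ 2`, because both sets have at least `q ^ 2` elements.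
  obtain ⟨p, hp, hR⟩ : ∃ p ∈ P,
      ∑ x ∈ U, (q * collisions p (W x) / (W x).card ^ 2 / U.card : ℝ) ≤ (c + 1) / q := by
    refine Finset.exists_le_of_sum_le hPne ?_
    rw [Finset.sum_comm, Finset.sum_const, nsmul_eq_mul]
    have h1 : ∀ x ∈ U, ∑ p ∈ P, (q * collisions p (W x) / (W x).card ^ 2 / U.card : ℝ) ≤
        P.card * ((c + 1) / q) / U.card := by
      intro x hx
      rw [← Finset.sum_div, ← Finset.sum_div, ← Finset.mul_sum]
      have h2 : (∑ p ∈ P, collisions p (W x) : ℝ) ≤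
          P.card * (W x).card + c * (W x).card ^ 2 := by
        exact_mod_cast sum_collisions_le hq hn hP (hW x hx)
      have h3 : (q : ℝ) ^ 2 ≤ (W x).card := by exact_mod_cast hWc x hx
      set w : ℝ := ((W x).card : ℝ)
      have hw : 0 < w := lt_of_lt_of_le (by positivity) h3
      gcongr
      rw [div_le_iff₀ (by positivity), mul_div_assoc', div_mul_eq_mul_div, le_div_iff₀ hq']
      have h4 : (q : ℝ) ^ 2 * (P.card * w) ≤ P.card * w ^ 2 := by
        have : (q : ℝ) ^ 2 * (P.card * w) ≤ w * (P.card * w) := by gcongr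
        linarith
      have h5 : (q : ℝ) ^ 2 * (c * w ^ 2) ≤ P.card * (c * w ^ 2) := by gcongr
      calc q * (∑ p ∈ P, (collisions p (W x) : ℝ)) * q
          = q ^ 2 * (∑ p ∈ P, (collisions p (W x) : ℝ)) := by ring
        _ ≤ q ^ 2 * (P.card * w + c * w ^ 2) := by gcongr
        _ ≤ _ := by linarith
    refine (Finset.sum_le_sum h1).trans ?_
    rw [Finset.sum_const, nsmul_eq_mul]
    rcases Nat.eq_zero_or_pos U.card with h0 | h0
    · rw [h0]
      simp
      positivity
    · have : (0 : ℝ) < U.card := by exact_mod_cast h0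
      rw [mul_div_cancel₀ _ this.ne']
  have hpp := hP p hp
  have : Fact p.Prime := ⟨hpp.1⟩
  have hp0 : (0 : ℝ) < p := by exact_mod_cast hpp.1.pos
  have ht1 : (p : ℝ) ≤ q * (smallRes p q).card := by exact_mod_cast le_mul_card_smallRes hq
  have ht2 : (q : ℝ) * (smallRes p q).card ≤ 2 * p := by
    exact_mod_cast mul_card_smallRes_le hq hpp.2.le
  set t : ℝ := ((smallRes p q).card : ℝ)
  have ht0 : 0 < t := by
    by_contra! h
    nlinarith
  -- Averaging the sum of the missed and the selected fraction yields one pair that is good for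
  -- both. The constant is `(c + 1) + 2`: the first part comes from `card_miss`, the second from `t
  -- / p ≤ 2 / q`. Division by zero makes the fraction of an empty set zero.
  obtain ⟨w, -, hw⟩ : ∃ w ∈ (Finset.univ : Finset (ZMod p × ZMod p)),
      ((U.filter fun x => ∀ y ∈ W x, ¬ Hits q ![p, w.1.val, w.2.val] y).card / U.card +
      (V.filter fun x => Hits q ![p, w.1.val, w.2.val] (g x)).card / V.card : ℝ) ≤
        (c + 3) / q := by
    refine Finset.exists_le_of_sum_le Finset.univ_nonempty ?_
    rw [Finset.sum_add_distrib, ← Finset.sum_div, ← Finset.sum_div, Finset.sum_const,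
      Finset.card_univ, Fintype.card_prod, ZMod.card, nsmul_eq_mul]
    have e1 : ∑ w : ZMod p × ZMod p,
        ((U.filter fun x => ∀ y ∈ W x, ¬ Hits q ![p, w.1.val, w.2.val] y).card : ℝ) =
        ∑ x ∈ U, (((Finset.univ : Finset (ZMod p × ZMod p)).filter fun w =>
          ∀ y ∈ W x, w.1 * (y : ZMod p) + w.2 ∉ smallRes p q).card : ℝ) := by
      simp only [hits_iff_mem_smallRes, Finset.card_filter, Nat.cast_sum]
      exact Finset.sum_comm
    have e2 : ∑ w : ZMod p × ZMod p,
        ((V.filter fun x => Hits q ![p, w.1.val, w.2.val] (g x)).card : ℝ) =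
        V.card * (p * t) := by
      have : ∀ x ∈ V, (((Finset.univ : Finset (ZMod p × ZMod p)).filter fun w =>
          w.1 * (g x : ZMod p) + w.2 ∈ smallRes p q).card : ℝ) = p * t := by
        intro x _
        rw [card_pair]
        push_cast
        rfl
      rw [← nsmul_eq_mul, ← Finset.sum_const, ← Finset.sum_congr rfl this]
      simp only [hits_iff_mem_smallRes, Finset.card_filter, Nat.cast_sum]
      exact Finset.sum_comm
    have b1 : (∑ x ∈ U, (((Finset.univ : Finset (ZMod p × ZMod p)).filter fun w =>
          ∀ y ∈ W x, w.1 * (y : ZMod p) + w.2 ∉ smallRes p q).card : ℝ)) / U.card ≤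
        p ^ 2 * ((c + 1) / q) := by
      rw [Finset.sum_div]
      refine le_trans ?_ (mul_le_mul_of_nonneg_left hR (by positivity))
      rw [Finset.mul_sum]
      refine Finset.sum_le_sum fun x hx => ?_
      have h1 := card_miss (p := p) (q := q) (W x)
      have h3 : (q : ℝ) ^ 2 ≤ (W x).card := by exact_mod_cast hWc x hx
      rw [mul_div_assoc']
      have hw : (0 : ℝ) < (W x).card := lt_of_lt_of_le (by positivity) h3
      gcongr
      rw [mul_div_assoc', le_div_iff₀ (by positivity)]
      refine le_of_mul_le_mul_right ?_ ht0
      calc _ = _ := by rw [mul_assoc]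
        _ ≤ (collisions p (W x) * p ^ 3 : ℝ) := h1
        _ = collisions p (W x) * p ^ 2 * p := by ring
        _ ≤ collisions p (W x) * p ^ 2 * (q * t) := by gcongr
        _ = _ := by ring
    have b2 : (V.card * (p * t) : ℝ) / V.card ≤ p ^ 2 * (2 / q) := by
      have h1 : (p * t : ℝ) ≤ p ^ 2 * (2 / q) := by
        rw [mul_div_assoc', le_div_iff₀ hq']
        nlinarith
      rcases Nat.eq_zero_or_pos V.card with h0 | h0
      · rw [h0]
        simp
        positivity
      · have : (0 : ℝ) < V.card := by exact_mod_cast h0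
        rwa [mul_div_cancel_left₀ _ this.ne']
    rw [e1, e2]
    push_cast
    refine (add_le_add b1 b2).trans (le_of_eq ?_)
    ring
  have final : ∀ b k : ℕ, b ≤ k → (b : ℝ) / k ≤ (c + 3) / q → q * b ≤ (c + 3) * k := by
    intro b k hbk h
    rcases Nat.eq_zero_or_pos k with h0 | h0
    · have : b = 0 := by omega
      simp [this]
    · rw [div_le_div_iff₀ (by exact_mod_cast h0) hq'] at h
      rw [mul_comm]
      exact_mod_cast h
  refine ⟨p, hp, w.1.val, ZMod.val_lt _, w.2.val, ZMod.val_lt _, ?_, ?_⟩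
  · refine final _ _ (Finset.card_filter_le _ _) (le_trans ?_ hw)
    exact le_add_of_nonneg_right (by positivity)
  · refine final _ _ (Finset.card_filter_le _ _) (le_trans ?_ hw)
    exact le_add_of_nonneg_left (by positivity)

end CycleLeaders

/-! ### The supply of primes, and unfinished walks when levels increase -/

namespace CycleLeaders

/-- Chebyshev's lower bound gives at least `q ^ 2 + q + 1` primes up to `q ^ 4`, and at most `q + 1`
of them are discarded as not exceeding `q`. The condition `16 ≤ q` leaves room for crude bounds on
the logarithms. -/
theorem exists_primes {q : ℕ} (hq : 16 ≤ q) :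
    ∃ P : Finset ℕ, (∀ p ∈ P, p.Prime ∧ q < p) ∧ (∀ p ∈ P, p < q ^ 4) ∧ q ^ 2 ≤ P.card := by
  classical
  refine ⟨((Finset.range (q ^ 4 + 1)).filter Nat.Prime) \ Finset.range (q + 1), ?_, ?_, ?_⟩
  · intro p hp
    simp only [Finset.mem_sdiff, Finset.mem_filter, Finset.mem_range] at hp
    exact ⟨hp.1.2, by omega⟩
  · intro p hp
    simp only [Finset.mem_sdiff, Finset.mem_filter, Finset.mem_range] at hp
    refine lt_of_le_of_ne (by omega) ?_
    rintro rfl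
    exact Nat.Prime.not_prime_pow (by norm_num) hp.1.2
  · have h1 := Finset.le_card_sdiff (Finset.range (q + 1))
      ((Finset.range (q ^ 4 + 1)).filter Nat.Prime)
    have h2 : ((Finset.range (q ^ 4 + 1)).filter Nat.Prime).card = Nat.primeCounting (q ^ 4) := by
      rw [Nat.primeCounting, Nat.primeCounting', Nat.count_eq_card_filter_range]
    rw [Finset.card_range, h2] at h1
    have h3 := Chebyshev.pi_ge (q ^ 4)
    have hq' : (16 : ℝ) ≤ q := by exact_mod_cast hq
    have hlog : Real.log q ≤ q := (Real.log_le_sub_one_of_pos (by linarith)).trans (by linarith)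
    have hlogpos : 0 < Real.log q := Real.log_pos (by linarith)
    have h4 : Real.log ((q ^ 4 : ℕ) : ℝ) = 4 * Real.log q := by
      push_cast
      rw [Real.log_pow]
      norm_num
    have h5 : Real.log (((q ^ 4 : ℕ) : ℝ) + 1) ≤ 1 + 4 * q := by
      calc Real.log (((q ^ 4 : ℕ) : ℝ) + 1) ≤ Real.log (2 * ((q ^ 4 : ℕ) : ℝ)) := by
            apply Real.log_le_log (by positivity)
            have : (1 : ℝ) ≤ ((q ^ 4 : ℕ) : ℝ) := by
              exact_mod_cast Nat.one_le_pow _ _ (by omega)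
            linarith
        _ = Real.log 2 + 4 * Real.log q := by
            rw [Real.log_mul (by norm_num) (by positivity), h4]
        _ ≤ _ := by linarith [Real.log_two_lt_d9]
    have h6 : ((q ^ 2 + q + 1 : ℕ) : ℝ) ≤ Nat.primeCounting (q ^ 4) := by
      refine le_trans ?_ h3
      rw [h4, le_div_iff₀ (by positivity)]
      have h7 : ((q ^ 2 + q + 1 : ℕ) : ℝ) * (4 * Real.log q) ≤ (q ^ 2 + q + 1) * (4 * q) := by
        push_cast
        gcongr
      refine h7.trans ?_
      have h8 : (0.6 : ℝ) * q ^ 4 ≤ ((q ^ 4 : ℕ) : ℝ) * Real.log 2 := by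
        push_cast
        rw [mul_comm]
        have := Real.log_two_gt_d9
        gcongr
        linarith
      have h9 : (16 : ℝ) * q ^ 3 ≤ q ^ 4 := by
        rw [pow_succ (q : ℝ) 3, mul_comm]
        gcongr
      have h10 : (16 : ℝ) * q ^ 2 ≤ q ^ 3 := by
        rw [pow_succ (q : ℝ) 2, mul_comm]
        gcongr
      have h11 : (16 : ℝ) * q ≤ q ^ 2 := by
        rw [pow_two]
        gcongr
      nlinarith
    have h12 : q ^ 2 + q + 1 ≤ Nat.primeCounting (q ^ 4) := by exact_mod_cast h6
    omega

variable {K m n q : ℕ} {π : Equiv.Perm (Elem n)} {T T' : ℕ → ℕ → Fin 3 → ℕ}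

/-- After the first row that does not select `x`, the count lags behind the row index and never
grows again. -/
theorem le_lev_iff {x i r : ℕ} (h : r ≤ i) : r ≤ lev q m T x i ↔ ∀ i' < r, RowHit q m T i' x := by
  induction i generalizing r with
  | zero =>
    obtain rfl : r = 0 := by omega
    simp
  | succ i ih =>
    have hle := lev_le q m T x i
    have hi := ih le_rfl
    unfold lev
    rcases Nat.le_succ_iff_eq_or_le.1 h with rfl | h
    · constructor
      · intro h1 i' hi'
        split_ifs at h1 with h2
        · rcases Nat.lt_succ_iff_lt_or_eq.1 hi' with h3 | rfl
          · exact hi.1 h2.1.ge i' h3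
          · exact h2.2
        · omega
      · intro h1
        rw [if_pos]
        exact ⟨le_antisymm hle (hi.2 fun i' hi' => h1 i' (by omega)), h1 i (by omega)⟩
    · rw [← ih h]
      split_ifs with h2
      · omega
      · rfl

theorem le_level_iff {x r : ℕ} (h : r ≤ K) :
    r ≤ level K m q T x ↔ ∀ i < r, RowHit q m T i x := le_lev_iff h

section

variable {ℓ ℓ' : ℕ → ℕ} {lim r : ℕ} {x : Elem n}

theorem verdict_eq_three {j : ℕ} : verdict ℓ π lim x j = 3 ↔
    j ≠ 0 ∧ path π x j ≠ x ∧ ¬ Kill ℓ x (path π x j) ∧ lim ≤ sameCount ℓ π x j := by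
  unfold verdict
  split_ifs <;> simp_all

theorem walkRes_eq_three_iff : walkRes ℓ π lim x = 3 ↔
    ∃ s, (∀ j, j ≠ 0 → j ≤ s → path π x j ≠ x ∧ ¬ Kill ℓ x (path π x j)) ∧
      lim ≤ sameCount ℓ π x s ∧ walkLen ℓ π lim x ≤ s := by
  constructor
  · intro h
    obtain ⟨-, h1, h2, h3⟩ := verdict_eq_three.1 h
    refine ⟨walkLen ℓ π lim x, fun j hj hle => ?_, h3, le_rfl⟩
    rcases hle.lt_or_eq with hlt | rfl
    · exact ⟨path_ne hlt hj, not_kill hlt hj⟩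
    · exact ⟨h1, h2⟩
  · rintro ⟨s, h1, h2, h3⟩
    have hpos := (walkLen_pos (ℓ := ℓ) (π := π) (lim := lim) (x := x)).ne'
    have h4 := walkRes_ne_zero (ℓ := ℓ) (π := π) (lim := lim) (x := x)
    obtain ⟨h5, h6⟩ := h1 _ hpos h3
    unfold walkRes verdict at h4 ⊢
    rw [if_neg hpos, if_neg h5, if_neg h6] at h4 ⊢
    by_cases h7 : lim ≤ sameCount ℓ π x (walkLen ℓ π lim x)
    · rw [if_pos h7]
    · rw [if_neg h7] at h4
      exact absurd rfl h4

/-- Without a return or a killer up to `s`, only the limit can have ended the walk. As `s` need not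
be the exact length, the walk length for one level function can be used for another. -/
theorem walkRes_eq_three (hlim : 1 ≤ lim) {s : ℕ}
    (h1 : ∀ j, j ≠ 0 → j ≤ s → path π x j ≠ x ∧ ¬ Kill ℓ x (path π x j))
    (h2 : lim ≤ sameCount ℓ π x s) : walkRes ℓ π lim x = 3 ∧ walkLen ℓ π lim x ≤ s := by
  have hs : s ≠ 0 := by
    rintro rfl
    simp [sameCount] at h2
    omega
  obtain ⟨h3, h4⟩ := h1 s hs le_rfl
  have h5 : walkLen ℓ π lim x ≤ s := walkLen_le (by rw [verdict_eq_three.2 ⟨hs, h3, h4, h2⟩]; omega)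
  exact ⟨walkRes_eq_three_iff.2 ⟨s, h1, h2, h5⟩, h5⟩

open Classical in
/-- The elements of the same level as `x` that are met on the walk from `x`. -/
noncomputable def window (ℓ : ℕ → ℕ) (π : Equiv.Perm (Elem n)) (lim : ℕ) (x : Elem n) :
    Finset ℕ :=
  ((Finset.range (walkLen ℓ π lim x)).filter fun i => ℓ (path π x (i + 1)) = ℓ x).image
    fun i => path π x (i + 1)

/-- Two equal elements on the walk would mean an earlier return to `x`, so the elements counted by
`sameCount` are distinct. -/
theorem le_card_window (h : walkRes ℓ π lim x = 3) :
    lim ≤ (window ℓ π lim x).card := by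
  classical
  obtain ⟨-, h1, h2, h3⟩ := verdict_eq_three.1 h
  refine h3.trans (le_of_eq ?_)
  unfold window
  rw [Finset.card_image_of_injOn]
  · rfl
  have hret : ∀ j, j ≠ 0 → j ≤ walkLen ℓ π lim x → path π x j ≠ x := by
    intro j hj hle
    rcases hle.lt_or_eq with hlt | rfl
    · exact path_ne hlt hj
    · exact h1
  have key : ∀ i j, i < j → j < walkLen ℓ π lim x → path π x (i + 1) ≠ path π x (j + 1) := by
    intro i j hij hj he
    refine hret (j - i) (by omega) (by omega) ?_
    have he' : (π ^ (i + 1)) x = (π ^ (j + 1)) x := Subtype.ext he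
    rw [show j + 1 = (i + 1) + (j - i) by omega, pow_add π (i + 1), Equiv.Perm.mul_apply] at he'
    exact congrArg Subtype.val ((π ^ (i + 1)).injective he').symm
  intro i hi j hj he
  simp only [Finset.coe_filter, Finset.mem_range, Set.mem_ofPred_eq] at hi hj
  rcases lt_trichotomy i j with h | h | h
  · exact (key i j h hj.1 he).elim
  · exact h
  · exact (key j i h hi.1 he.symm).elim

/-- If the levels only increase, then unfinished walks were unfinished before, and their windows
contain no element whose level increases. -/
theorem Unfinished.of_increase (hlim : 1 ≤ lim) (h1 : ∀ y, r ≤ ℓ y ↔ r ≤ ℓ' y)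
    (h2 : ∀ y, r < ℓ y → r < ℓ' y) (h : Unfinished ℓ' π lim r x) :
    Unfinished ℓ π lim r x ∧ ∀ y ∈ window ℓ π lim x, ¬ r < ℓ' y := by
  classical
  obtain ⟨hx, h3⟩ := h
  obtain ⟨s, hs, hc, -⟩ := walkRes_eq_three_iff.1 h3
  have heq : ∀ y, ℓ' y = r → ℓ y = r := by
    intro y hy
    have := h1 y
    have := h2 y
    omega
  have hxr := heq x hx
  -- Killers persist: `x` has level `r` for both functions, elements above `r` stay above `r`, and
  -- an element of level `r` keeps its level or rises.
  have hk : ∀ y, Kill ℓ x y → Kill ℓ' x y := by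
    intro y hy
    unfold Kill at hy ⊢
    have := h1 y
    have := h2 y
    omega
  have hc' : lim ≤ sameCount ℓ π x s := by
    refine hc.trans (Finset.card_le_card ?_)
    intro i hi
    simp only [Finset.mem_filter] at hi ⊢
    refine ⟨hi.1, ?_⟩
    rw [hxr]
    exact heq _ (hi.2.trans hx)
  obtain ⟨h4, h5⟩ := walkRes_eq_three hlim
    (fun j hj hle => ⟨(hs j hj hle).1, fun h => (hs j hj hle).2 (hk _ h)⟩) hc'
  refine ⟨⟨hxr, h4⟩, fun y hy hlt => ?_⟩
  simp only [window, Finset.mem_image, Finset.mem_filter, Finset.mem_range] at hy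
  obtain ⟨i, ⟨hi, -⟩, rfl⟩ := hy
  -- A window element that rose above `r` would have ended the walk for `ℓ'`, because the window
  -- lies within the first `s` steps.
  refine (hs (i + 1) (by omega) (by omega)).2 (Or.inl ?_)
  rwa [hx]

end

end CycleLeaders

/-! ### Progress of the greedy construction -/

namespace CycleLeaders

variable {K m n q : ℕ} {π : Equiv.Perm (Elem n)} {T T' : ℕ → ℕ → Fin 3 → ℕ}

theorem rowHit_setSlot {r j x : ℕ} {h : Fin 3 → ℕ} (hj : j < m) (h0 : ¬ Hits q (T r j) x) :
    RowHit q m (setSlot T r j h) r x ↔ RowHit q m T r x ∨ Hits q h x := by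
  unfold RowHit
  constructor
  · rintro ⟨j', hj', h1⟩
    by_cases he : j' = j
    · subst he
      rw [setSlot, if_pos ⟨rfl, rfl⟩] at h1
      exact Or.inr h1
    · rw [setSlot, if_neg (by tauto)] at h1
      exact Or.inl ⟨j', hj', h1⟩
  · rintro (⟨j', hj', h1⟩ | h1)
    · refine ⟨j', hj', ?_⟩
      rwa [setSlot, if_neg]
      rintro ⟨-, rfl⟩
      exact h0 h1
    · refine ⟨j, hj, ?_⟩
      rwa [setSlot, if_pos ⟨rfl, rfl⟩]

theorem le_level_congr {r x : ℕ} (hr : r ≤ K) (h : ∀ i < r, ∀ j, T i j = T' i j) :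
    r ≤ level K m q T x ↔ r ≤ level K m q T' x := by
  rw [le_level_iff hr, le_level_iff hr]
  unfold RowHit
  refine forall₂_congr fun i hi => ?_
  simp only [h i hi]

theorem lt_level_iff {r x : ℕ} (hr : r < K) :
    r < level K m q T x ↔ r ≤ level K m q T x ∧ RowHit q m T r x := by
  rw [← Nat.succ_le_iff, le_level_iff hr, le_level_iff hr.le]
  simp only [Nat.lt_succ_iff_lt_or_eq]
  constructor
  · exact fun h => ⟨fun i hi => h i (Or.inl hi), h r (Or.inr rfl)⟩
  · rintro ⟨h1, h2⟩ i (hi | rfl)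
    · exact h1 i hi
    · exact h2

theorem not_hits_zero (x : ℕ) : ¬ Hits q (fun _ => 0) x := by simp [Hits]

theorem countTo_mono {hn : 1 ≤ n} {P Q : Elem n → Prop} (h : ∀ x, P x → Q x) :
    countTo hn P n ≤ countTo hn Q n := by
  classical
  rw [countTo_eq_card, countTo_eq_card]
  exact Finset.card_le_card (Finset.monotone_filter_right _ fun x _ => h x)

theorem countTo_congr {hn : 1 ≤ n} {P Q : Elem n → Prop} (h : ∀ x, P x ↔ Q x) :
    countTo hn P n = countTo hn Q n :=
  (countTo_mono fun x => (h x).1).antisymm (countTo_mono fun x => (h x).2)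

theorem countTo_eq_zero {hn : 1 ≤ n} {P : Elem n → Prop} :
    countTo hn P n = 0 ↔ ∀ x, ¬ P x := by
  classical
  rw [countTo_eq_card, Finset.card_eq_zero, Finset.filter_eq_empty_iff]
  simp

/-- `exists_hash` is applied to the windows of the unfinished walks and to the elements of level at
least `r`. A walk that stays unfinished has its whole window missed by the new function, and an
element newly above `r` is selected by it. -/
theorem exists_improves {c r j : ℕ} (hn : 1 ≤ n) (hq : 16 ≤ q) (hnq : n ≤ q ^ c) (hr : r < K)
    (hj : j < m) (h0 : T r j = fun _ => 0) :
    ∃ p < q ^ 4, ∃ a < q ^ 4, ∃ b < q ^ 4,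
      Improves K m hn π q (q ^ 2) T r (c + 3) (setSlot T r j ![p, a, b]) := by
  classical
  obtain ⟨P, hP, hP4, hPc⟩ := exists_primes hq
  set ℓ := level K m q T with hℓ
  have hlim : 1 ≤ q ^ 2 := Nat.one_le_pow _ _ (by omega)
  obtain ⟨p, hp, a, ha, b, hb, h1, h2⟩ := exists_hash (by omega) hnq hP hPc
    (Finset.univ.filter (Unfinished ℓ π (q ^ 2) r)) (window ℓ π (q ^ 2))
    (fun x _ y hy => by
      simp only [window, Finset.mem_image] at hy
      obtain ⟨i, -, rfl⟩ := hy
      exact ((π ^ (i + 1)) x).2.2)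
    (fun x hx => le_card_window (Finset.mem_filter.1 hx).2.2)
    (Finset.univ.filter fun x : Elem n => r ≤ ℓ x) Subtype.val
  have hp4 := hP4 p hp
  refine ⟨p, hp4, a, ha.trans hp4, b, hb.trans hp4, ?_⟩
  set T' := setSlot T r j ![p, a, b] with hT'
  have hle : ∀ y, r ≤ ℓ y ↔ r ≤ level K m q T' y := fun y =>
    le_level_congr hr.le fun i hi j' => by
      rw [hT', setSlot, if_neg]
      omega
  have hlt : ∀ y, r < level K m q T' y ↔ r < ℓ y ∨ r ≤ ℓ y ∧ Hits q ![p, a, b] y := by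
    intro y
    rw [lt_level_iff hr, lt_level_iff hr, ← hle, rowHit_setSlot hj]
    · tauto
    · rw [h0]
      exact not_hits_zero y
  constructor
  · unfold numUnf
    rw [countTo_eq_card, countTo_eq_card]
    refine le_trans (Nat.mul_le_mul_left _ (Finset.card_le_card ?_)) h1
    intro x hx
    obtain ⟨hU, hw⟩ := Unfinished.of_increase hlim hle (fun y hy => (hlt y).2 (Or.inl hy))
      (Finset.mem_filter.1 hx).2
    simp only [Finset.mem_filter, Finset.mem_univ, true_and]
    refine ⟨hU, fun y hy hh => hw y hy ((hlt y).2 (Or.inr ⟨?_, hh⟩))⟩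
    simp only [window, Finset.mem_image, Finset.mem_filter] at hy
    obtain ⟨i, ⟨-, hi⟩, rfl⟩ := hy
    rw [hi, hU.1]
  · unfold numGe numGt
    rw [countTo_eq_card, countTo_eq_card, countTo_eq_card]
    have h3 := Nat.add_le_add_right h2 (q * (Finset.univ.filter fun x : Elem n => r < ℓ x).card)
    refine le_trans ?_ (h3.trans_eq (by congr!))
    rw [← Nat.mul_add]
    refine Nat.mul_le_mul_left _ ((Finset.card_le_card ?_).trans (Finset.card_union_le _ _))
    intro x hx
    have := (hlt x).1 (by simpa using hx)
    simp only [Finset.mem_union, Finset.mem_filter, Finset.mem_univ, true_and]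
    tauto

section

variable {hn : 1 ≤ n} {c r : ℕ}

theorem improves_nextTab {j : ℕ} (hq : 16 ≤ q) (hnq : n ≤ q ^ c) (hr : r < K)
    (hj : j < m) (h0 : T r j = fun _ => 0) :
    Improves K m hn π q (q ^ 2) T r (c + 3) (nextTab K m hn π (c + 3) q (q ^ 4) (q ^ 2) r j T) := by
  obtain ⟨p, hp, a, ha, b, hb, h⟩ := exists_improves (π := π) hn hq hnq hr hj h0
  exact scan_spec (P := fun h => Improves K m hn π q (q ^ 2) T r (c + 3) (setSlot T r j h))
    hp ha hb h

theorem numGe_congr (hr : r ≤ K) (h : ∀ i < r, ∀ j, T i j = T' i j) :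
    numGe K m hn q T r = numGe K m hn q T' r := countTo_congr fun _ => le_level_congr hr h

/-- The unfinished walks shrink geometrically, while the elements above level `r` grow only linearly
in `j`: an empty row selects nothing, and each slot adds a share of `numGe`, which depends only on
the rows before `r` and is constant here. -/
theorem rowTab_spec {j : ℕ} (hq : 16 ≤ q) (hnq : n ≤ q ^ c) (hr : r < K) (hj : j ≤ m)
    (h0 : ∀ j, T r j = fun _ => 0) :
    q ^ j * numUnf K m hn π q (q ^ 2) (rowTab K m hn π (c + 3) q (q ^ 4) (q ^ 2) r T j) r ≤
      (c + 3) ^ j * n ∧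
    q * numGt K m hn q (rowTab K m hn π (c + 3) q (q ^ 4) (q ^ 2) r T j) r ≤
      j * (c + 3) * numGe K m hn q T r := by
  induction j with
  | zero =>
    refine ⟨?_, ?_⟩
    · rw [pow_zero, pow_zero, one_mul, one_mul]
      exact numUnf_le hn q _ _ r
    · have : numGt K m hn q T r = 0 := countTo_eq_zero.2 fun x hx => by
        obtain ⟨j, -, hj⟩ := ((lt_level_iff hr).1 hx).2
        rw [h0] at hj
        exact not_hits_zero _ hj
      change q * numGt K m hn q T r ≤ _
      rw [this]
      exact Nat.zero_le _
  | succ j ih =>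
    obtain ⟨h1, h2⟩ := ih (by omega)
    obtain ⟨h3, h4⟩ := improves_nextTab (π := π) (hn := hn) hq hnq hr (Nat.lt_of_succ_le hj)
      (T := rowTab K m hn π (c + 3) q (q ^ 4) (q ^ 2) r T j)
      (by rw [rowTab_of_ne (Or.inr le_rfl), h0])
    rw [numGe_congr (T' := T) hr.le fun i hi j => rowTab_of_ne (Or.inl hi.ne) T] at h4
    constructor
    · rw [pow_succ, mul_assoc]
      refine (Nat.mul_le_mul_left _ h3).trans ?_
      rw [pow_succ' (c + 3), mul_assoc, mul_left_comm]
      exact Nat.mul_le_mul_left _ h1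
    · refine h4.trans ((Nat.add_le_add_left h2 _).trans_eq ?_)
      ring

/-- Each factor `D / q` is at most `q ^ (-1/2)`, so `2 * c + 1` of them push `n ≤ q ^ c` below one.
-/
theorem eq_zero_of_pow_mul_le {D X : ℕ} (hD : 2 ≤ D) (hDq : D ^ 2 ≤ q) (hnq : n ≤ q ^ c)
    (h : q ^ (2 * c + 1) * X ≤ D ^ (2 * c + 1) * n) : X = 0 := by
  by_contra hX
  have hq : 0 < q := lt_of_lt_of_le (by positivity) hDq
  have h1 : q ^ c * q ^ (c + 1) ≤ q ^ c * D ^ (2 * c + 1) := by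
    calc q ^ c * q ^ (c + 1) = q ^ (2 * c + 1) := by ring
      _ ≤ q ^ (2 * c + 1) * X := Nat.le_mul_of_pos_right _ (by omega)
      _ ≤ D ^ (2 * c + 1) * n := h
      _ ≤ D ^ (2 * c + 1) * q ^ c := Nat.mul_le_mul_left _ hnq
      _ = _ := mul_comm _ _
  have h2 := Nat.le_of_mul_le_mul_left h1 (by positivity)
  have h3 : D ^ (2 * c + 2) ≤ q ^ (c + 1) := by
    rw [show 2 * c + 2 = 2 * (c + 1) by ring, pow_mul]
    exact Nat.pow_le_pow_left hDq _
  have h4 : D ^ (2 * c + 1) < D ^ (2 * c + 2) := Nat.pow_lt_pow_right (by omega) (by omega)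
  omega

theorem allTab_of_lt {A M L i i' k : ℕ} (h : k < i) (h' : i ≤ i') (j : ℕ) :
    allTab K m hn π A q M L i' k j = allTab K m hn π A q M L i k j := by
  induction i', h' using Nat.le_induction with
  | base => rfl
  | succ i' h' ih =>
    rw [← ih]
    exact rowTab_of_ne (Or.inl (by omega)) _

/-- The elements above level `i` after row `i` are those of level at least `i + 1`, so the second
bound of `rowTab_spec` can be iterated over the rows. -/
theorem numGe_allTab {i : ℕ} (hq : 16 ≤ q) (hnq : n ≤ q ^ c) (hi : i ≤ K) :
    q ^ i * numGe K m hn q (allTab K m hn π (c + 3) q (q ^ 4) (q ^ 2) i) i ≤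
      (m * (c + 3)) ^ i * n := by
  induction i with
  | zero =>
    rw [pow_zero, pow_zero, one_mul, one_mul]
    exact numGe_le hn q _ _
  | succ i ih =>
    have h1 := ih (by omega)
    have h2 := (rowTab_spec (m := m) (π := π) (hn := hn) hq hnq (Nat.lt_of_succ_le hi) le_rfl
      (T := allTab K m hn π (c + 3) q (q ^ 4) (q ^ 2) i) (allTab_of_le le_rfl)).2
    rw [pow_succ, mul_assoc]
    refine (Nat.mul_le_mul_left _ h2).trans ?_
    rw [pow_succ' (m * (c + 3)), mul_assoc (m * (c + 3)), mul_left_comm]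
    exact Nat.mul_le_mul_left _ h1

theorem level_finalTab_lt (hq : 16 ≤ q) (hnq : n ≤ q ^ c) (hm : 1 ≤ m)
    (hD : (m * (c + 3)) ^ 2 ≤ q) (x : Elem n) :
    level (2 * c + 1) m q (finalTab (2 * c + 1) m hn π (c + 3) q) x < 2 * c + 1 := by
  have h := eq_zero_of_pow_mul_le (by nlinarith) hD hnq
    (numGe_allTab (K := 2 * c + 1) (m := m) (hn := hn) (π := π) hq hnq le_rfl)
  exact not_le.1 (countTo_eq_zero.1 h x)

/-- No walk at level `r` is unfinished once row `r` is complete. Later rows leave the sets of level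
at least `r` and of level above `r` unchanged, so `Unfinished.of_increase` carries this over to the
final table. -/
theorem not_unfinished_finalTab (hq : 16 ≤ q) (hnq : n ≤ q ^ c) (hr : r < K)
    (hD : (c + 3) ^ 2 ≤ q) (x : Elem n) :
    ¬ Unfinished (level K (2 * c + 1) q (finalTab K (2 * c + 1) hn π (c + 3) q)) π (q ^ 2) r x := by
  have h := eq_zero_of_pow_mul_le (by omega) hD hnq
    (rowTab_spec (m := 2 * c + 1) (π := π) (hn := hn) hq hnq hr le_rfl
      (T := allTab K (2 * c + 1) hn π (c + 3) q (q ^ 4) (q ^ 2) r) (allTab_of_le le_rfl)).1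
  have e : ∀ i ≤ r, ∀ j, allTab K (2 * c + 1) hn π (c + 3) q (q ^ 4) (q ^ 2) (r + 1) i j =
      finalTab K (2 * c + 1) hn π (c + 3) q i j := fun i hi j =>
    (allTab_of_lt (Nat.lt_succ_of_le hi) (Nat.succ_le_of_lt hr) j).symm
  intro hx
  exact countTo_eq_zero.1 h x (Unfinished.of_increase (Nat.one_le_pow _ _ (by omega))
    (fun y => le_level_congr hr.le fun i hi j => e i hi.le j)
    (fun y hy => (le_level_congr (Nat.succ_le_of_lt hr) fun i hi j =>
      e i (Nat.le_of_lt_succ hi) j).1 (Nat.succ_le_of_lt hy)) hx).1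

end

end CycleLeaders

/-! ### The cost of the final walks, and correctness of the reported leaders -/

namespace CycleLeaders

variable {K m n q : ℕ} {π : Equiv.Perm (Elem n)} {ℓ : ℕ → ℕ} {lim lim' : ℕ} {x y : Elem n}

theorem exists_path_eq (π : Equiv.Perm (Elem n)) (x : Elem n) :
    ∃ j ≤ n, j ≠ 0 ∧ path π x j = x := by
  have h : x ∈ Function.periodicPts π := by
    rw [Function.injective_iff_periodicPts_eq_univ.1 π.injective]
    trivial
  refine ⟨Function.minimalPeriod π x, ?_, (Function.minimalPeriod_pos_of_mem_periodicPts h).ne', ?_⟩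
  · exact (Function.minimalPeriod_le_card (f := π) (x := x)).trans_eq (by simp)
  · rw [path, ← Equiv.Perm.iterate_eq_pow, Function.iterate_minimalPeriod]

theorem walkLen_le_card (ℓ : ℕ → ℕ) (π : Equiv.Perm (Elem n)) (lim : ℕ) (x : Elem n) :
    walkLen ℓ π lim x ≤ n := by
  obtain ⟨j, hj, h0, hx⟩ := exists_path_eq π x
  refine (walkLen_le ?_).trans hj
  rw [verdict, if_neg h0, if_pos hx]
  omega

/-- A return or a killer ends the walk at that point whatever the limit is. -/
theorem walkLen_le_of_ne_three (h : walkRes ℓ π lim x ≠ 3) :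
    walkLen ℓ π lim' x ≤ walkLen ℓ π lim x := by
  apply walkLen_le
  have h0 := walkRes_ne_zero (ℓ := ℓ) (π := π) (lim := lim) (x := x)
  unfold walkRes verdict at h h0
  unfold verdict
  split_ifs at h h0 ⊢ <;> simp_all

theorem sum_walkLen_le (hK : ∀ x : Elem n, ℓ x < K)
    (h : ∀ r < K, ∀ x, ¬ Unfinished ℓ π lim r x) :
    ∑ x, walkLen ℓ π lim' x ≤ K * (n * (lim + 1)) := by
  calc ∑ x, walkLen ℓ π lim' x ≤ ∑ x, ∑ r ∈ Finset.range K, walkTime ℓ π lim r x := by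
        refine Finset.sum_le_sum fun x _ => ?_
        refine le_trans ?_ (Finset.single_le_sum (fun _ _ => Nat.zero_le _)
          (Finset.mem_range.2 (hK x)))
        rw [walkTime, if_pos rfl]
        exact walkLen_le_of_ne_three fun h3 => h _ (hK x) x ⟨rfl, h3⟩
    _ = ∑ r ∈ Finset.range K, ∑ x, walkTime ℓ π lim r x := Finset.sum_comm
    _ ≤ ∑ r ∈ Finset.range K, n * (lim + 1) :=
        Finset.sum_le_sum fun r _ => sum_walkTime_le ℓ π lim r
    _ = _ := by simp

theorem sum_walkLen_le_sq (ℓ : ℕ → ℕ) (π : Equiv.Perm (Elem n)) (lim : ℕ) :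
    ∑ x, walkLen ℓ π lim x ≤ n * n :=
  (Finset.sum_le_sum fun x _ => walkLen_le_card ℓ π lim x).trans_eq (by simp)

/-- A walk that returns has seen the whole cycle without a killer. Conversely, without killers only
a return can end it, since the limit `n` comes too late. -/
theorem walkRes_eq_two_iff :
    walkRes ℓ π n x = 2 ↔ ∀ y, π.SameCycle x y → ¬ Kill ℓ x y := by
  have hpos := (walkLen_pos (ℓ := ℓ) (π := π) (lim := n) (x := x)).ne'
  constructor
  · intro h y hy hk
    have hret : (π ^ walkLen ℓ π n x) x = x := by
      unfold walkRes verdict at h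
      rw [if_neg hpos] at h
      by_contra hne
      have hne' : path π x (walkLen ℓ π n x) ≠ x := fun he => hne (Subtype.ext he)
      rw [if_neg hne'] at h
      split_ifs at h <;> omega
    obtain ⟨i, -, rfl⟩ := hy.exists_pow_eq'
    have hmod : (π ^ i) x = (π ^ (i % walkLen ℓ π n x)) x := by
      conv_lhs => rw [← Nat.mod_add_div i (walkLen ℓ π n x), pow_add, pow_mul,
        Equiv.Perm.mul_apply, Equiv.Perm.pow_apply_eq_self_of_apply_eq_self hret]
    rw [hmod] at hk
    rcases Nat.eq_zero_or_pos (i % walkLen ℓ π n x) with h0 | h0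
    · rw [h0] at hk
      simp [Kill] at hk
    · exact not_kill (Nat.mod_lt _ (Nat.pos_of_ne_zero hpos)) h0.ne' hk
  · intro h
    have h1 := walkRes_ne_zero (ℓ := ℓ) (π := π) (lim := n) (x := x)
    -- Counting `n` elements takes at least `n` steps, but by then the walk has returned to `x`, and
    -- the return is tested before the limit.
    have h3 : walkRes ℓ π n x ≠ 3 := by
      intro h3
      obtain ⟨-, hx, -, hn⟩ := verdict_eq_three.1 h3
      obtain ⟨j, hj, h0, hjx⟩ := exists_path_eq π x
      have hs : sameCount ℓ π x (walkLen ℓ π n x) ≤ walkLen ℓ π n x := by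
        unfold sameCount
        exact (Finset.card_filter_le _ _).trans_eq (Finset.card_range _)
      rcases (hj.trans (hn.trans hs)).lt_or_eq with hlt | he
      · exact path_ne hlt h0 hjx
      · exact hx (he ▸ hjx)
    have hk : ¬ Kill ℓ x (path π x (walkLen ℓ π n x)) := h _ ⟨walkLen ℓ π n x, rfl⟩
    unfold walkRes verdict at h1 h3 ⊢
    split_ifs at h1 h3 ⊢ <;> simp_all

theorem mem_leaderOut : y ∈ leaderOut ℓ π x ↔ y = x ∧ walkRes ℓ π n x = 2 := by
  unfold leaderOut
  split_ifs <;> simp_all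

theorem mem_leaders (hn : 1 ≤ n) : x ∈ leaders hn ℓ π ↔ walkRes ℓ π n x = 2 := by
  simp only [leaders, List.mem_flatMap, List.mem_range, mem_leaderOut]
  constructor
  · rintro ⟨i, -, rfl, h⟩
    exact h
  · intro h
    have h1 := x.2.1
    have h2 := x.2.2
    have he : el hn (x - 1) = x := Subtype.ext (by rw [el_val hn (by omega)]; omega)
    exact ⟨x - 1, by omega, he.symm, he.symm ▸ h⟩

theorem nodup_leaders (hn : 1 ≤ n) (ℓ : ℕ → ℕ) (π : Equiv.Perm (Elem n)) :
    (leaders hn ℓ π).Nodup := by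
  refine List.nodup_flatMap.2 ⟨fun i _ => ?_, ?_⟩
  · unfold leaderOut
    split_ifs <;> simp
  · refine (List.nodup_range (n := n)).imp_of_mem fun {i j} hi hj hij => ?_
    intro x hx hx'
    have he := (mem_leaderOut.1 hx).1.symm.trans (mem_leaderOut.1 hx').1
    have := congrArg Subtype.val he
    rw [el_val hn (List.mem_range.1 hi), el_val hn (List.mem_range.1 hj)] at this
    omega

/-- The elements are ordered by level, and then by the reverse of the natural order. -/
def key (ℓ : ℕ → ℕ) (x : ℕ) : ℕ ×ₗ ℕᵒᵈ := toLex (ℓ x, OrderDual.toDual x)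

theorem kill_iff {x y : ℕ} : Kill ℓ x y ↔ key ℓ x < key ℓ y := by
  rw [key, key, Prod.Lex.toLex_lt_toLex, OrderDual.toDual_lt_toDual, Kill, eq_comm]

/-- Priority is a strict linear order, by the injective `key`, so each cycle has exactly one element
without killers. This holds for every `ℓ`: the table matters only for the running time. -/
theorem isLeaderList_leaders (hn : 1 ≤ n) (ℓ : ℕ → ℕ) (π : Equiv.Perm (Elem n)) :
    IsLeaderList π (leaders hn ℓ π) := by
  classical
  refine ⟨nodup_leaders hn ℓ π, fun i => ?_⟩
  simp only [mem_leaders, walkRes_eq_two_iff, kill_iff]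
  obtain ⟨j, hj, hmax⟩ := (Finset.univ.filter fun j => π.SameCycle i j).exists_max_image
    (fun j => key ℓ j) ⟨i, by simp [Equiv.Perm.SameCycle.refl]⟩
  simp only [Finset.mem_filter, Finset.mem_univ, true_and] at hj hmax
  refine ⟨j, ⟨fun y hy => not_lt.2 (hmax y (hj.trans hy)), hj⟩, fun y hy => ?_⟩
  have h1 := hmax y hy.2
  have h2 := not_lt.1 (hy.1 j (hy.2.symm.trans hj))
  have h3 := congrArg (fun z => OrderDual.ofDual (ofLex z).2) (h1.antisymm h2)
  exact Subtype.ext h3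

end CycleLeaders

/-! ### Estimates of time and space -/

namespace CycleLeaders

section

variable {A c K m B q n S : ℕ}

theorem hitTime_le (hS : Nat.size B ≤ S) (hS1 : 1 ≤ S) (hq : 1 ≤ q) :
    hitTime B q (q ^ 4) ≤ 46 * (S ^ 2 * q ^ 4) := by
  have h1 : Nat.size B * (3 * Nat.size B + 7) ≤ S * (10 * S) :=
    Nat.mul_le_mul hS (by omega)
  have h2 : q ≤ q ^ 4 := Nat.le_self_pow (by norm_num) q
  have h3 : S ^ 2 ≤ S ^ 2 * q ^ 4 := Nat.le_mul_of_pos_right _ (by positivity)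
  have h4 : q ^ 4 ≤ S ^ 2 * q ^ 4 := Nat.le_mul_of_pos_left _ (by positivity)
  have h5 : S * (10 * S) = 10 * S ^ 2 := by ring
  unfold hitTime
  omega

theorem levTime_le (hS : Nat.size B ≤ S) (hS1 : 1 ≤ S) (hq : 1 ≤ q) :
    levTime K m B q (q ^ 4) ≤ (K * (55 * m + 10) + 2) * (S ^ 2 * q ^ 4) := by
  have h := hitTime_le hS hS1 hq
  have hZ : 1 ≤ S ^ 2 * q ^ 4 := Nat.succ_le_of_lt (by positivity)
  set Z := S ^ 2 * q ^ 4
  calc levTime K m B q (q ^ 4) ≤ K * (m * (55 * Z) + 10 * Z) + 2 * Z := by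
        unfold levTime
        gcongr <;> omega
    _ = _ := by ring

/-- The factor in the bound for `levTime`. -/
def levConst (K m : ℕ) : ℕ := K * (55 * m + 10) + 2

theorem evalTime_le (hS : Nat.size B ≤ S) (hS1 : 1 ≤ S) (hq : 1 ≤ q) (hn : 1 ≤ n) :
    evalTime K m B q (q ^ 4) (q ^ 2) n ≤
      (3 * levConst K m + 69) * (n * q ^ 2 * (S ^ 2 * q ^ 4)) := by
  have h : levTime K m B q (q ^ 4) ≤ levConst K m * (S ^ 2 * q ^ 4) := levTime_le hS hS1 hq
  have hZ : 1 ≤ S ^ 2 * q ^ 4 := Nat.succ_le_of_lt (by positivity)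
  have hq2 : 1 ≤ q ^ 2 := Nat.one_le_pow _ _ hq
  have hY : 1 ≤ n * q ^ 2 * (S ^ 2 * q ^ 4) := Nat.succ_le_of_lt (by positivity)
  set Z := S ^ 2 * q ^ 4
  calc evalTime K m B q (q ^ 4) (q ^ 2) n ≤ n * (2 * q ^ 2) * (levConst K m * Z + 11 * Z) +
        n * q ^ 2 * (levConst K m * Z + 41 * Z) + 6 * (n * q ^ 2 * Z) := by
        unfold evalTime
        gcongr
        · omega
        · omega
        · exact Nat.le_mul_of_pos_right _ hq2
        · omega
        · omega
    _ = _ := by ring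

/-- The exponent is `18 = 2 + 4 + 12`: the walk limit, the cost of one level computation, and the
number of triples below `q ^ 4`. -/
theorem searchTime_le (hS : Nat.size B ≤ S) (hS1 : 1 ≤ S) (hq : 1 ≤ q) (hn : 1 ≤ n) :
    searchTime A K m B q (q ^ 4) (q ^ 2) n ≤
      (6 * levConst K m + 6 * A + 263) * (n * q ^ 18 * S ^ 2) := by
  have h := evalTime_le (K := K) (m := m) hS hS1 hq hn
  set E := 3 * levConst K m + 69 with hE
  have hY : 1 ≤ n * q ^ 2 * (S ^ 2 * q ^ 4) := Nat.succ_le_of_lt (by positivity)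
  have hX : 1 ≤ n * q ^ 18 * S ^ 2 := Nat.succ_le_of_lt (by positivity)
  have hqY : q ≤ n * q ^ 2 * (S ^ 2 * q ^ 4) := by
    calc q ≤ q ^ 6 := Nat.le_self_pow (by norm_num) q
      _ = 1 * q ^ 2 * (1 ^ 2 * q ^ 4) := by ring
      _ ≤ _ := by gcongr
  have hYX : n * q ^ 2 * (S ^ 2 * q ^ 4) * q ^ 12 = n * q ^ 18 * S ^ 2 := by ring
  have hle : ∀ i ≤ 12, q ^ i ≤ n * q ^ 18 * S ^ 2 := fun i hi => by
    calc q ^ i ≤ q ^ 18 := Nat.pow_le_pow_right hq (by omega)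
      _ = 1 * q ^ 18 * 1 ^ 2 := by ring
      _ ≤ _ := by gcongr
  have h4 := hle 4 (by norm_num)
  have h8 := hle 8 (by norm_num)
  have hYX' : n * q ^ 2 * (S ^ 2 * q ^ 4) ≤ n * q ^ 18 * S ^ 2 := by
    rw [← hYX]
    exact Nat.le_mul_of_pos_right _ (by positivity)
  set Y := n * q ^ 2 * (S ^ 2 * q ^ 4)
  set X := n * q ^ 18 * S ^ 2
  calc searchTime A K m B q (q ^ 4) (q ^ 2) n ≤ E * X + 6 * (A * X) + 3 * X + 60 * X +
        q ^ 4 * (q ^ 4 * (q ^ 4 * (E * Y + 6 * Y + 40 * Y + 2 * Y) + 4) + 4) := by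
        unfold searchTime tryTime
        gcongr
        · exact h.trans (Nat.mul_le_mul_left _ hYX')
        · exact Nat.le_mul_of_pos_right _ hX
        · exact hqY.trans hYX'
        all_goals omega
    _ = E * X + 6 * A * X + 3 * X + 60 * X + (E + 48) * (Y * q ^ 12) + 4 * q ^ 8 + 4 * q ^ 4 := by
        ring
    _ ≤ E * X + 6 * A * X + 3 * X + 60 * X + (E + 48) * X + 4 * X + 4 * X := by
        rw [hYX]
        gcongr
    _ = (6 * levConst K m + 6 * A + 257) * X := by
        rw [hE]
        ring
    _ ≤ _ := Nat.mul_le_mul_right _ (by omega)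

/-- The factor in the bound for `mainTime`. -/
def mainConst (A c K m w : ℕ) : ℕ :=
  26 * c + 102 + (K * (m * (6 * levConst K m + 6 * A + 263) + 1) + 1) +
    (w * (levConst K m + 11) + levConst K m + 23)

theorem mainTime_le {W w : ℕ} (hS : Nat.size B ≤ S) (hS1 : 1 ≤ S) (hq : 1 ≤ q) (hn : 1 ≤ n)
    (hW : W ≤ w * (n * q ^ 2)) :
    mainTime A c K m B q n W ≤ mainConst A c K m w * (n * q ^ 18 * S ^ 2) := by
  have hl : levTime K m B q (q ^ 4) ≤ levConst K m * (S ^ 2 * q ^ 4) := levTime_le hS hS1 hq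
  have hs := searchTime_le (A := A) (K := K) (m := m) hS hS1 hq hn
  have hZ : 1 ≤ S ^ 2 * q ^ 4 := Nat.succ_le_of_lt (by positivity)
  have hX : 1 ≤ n * q ^ 18 * S ^ 2 := Nat.succ_le_of_lt (by positivity)
  have hqX : q ^ 2 ≤ n * q ^ 18 * S ^ 2 := by
    calc q ^ 2 ≤ q ^ 18 := Nat.pow_le_pow_right hq (by omega)
      _ = 1 * q ^ 18 * 1 ^ 2 := by ring
      _ ≤ _ := by gcongr
  have h1 : n * q ^ 2 * (S ^ 2 * q ^ 4) ≤ n * q ^ 18 * S ^ 2 := by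
    calc n * q ^ 2 * (S ^ 2 * q ^ 4) = n * q ^ 6 * S ^ 2 := by ring
      _ ≤ _ := by
        gcongr
        norm_num
  have h2 : n * (S ^ 2 * q ^ 4) ≤ n * q ^ 18 * S ^ 2 := by
    refine le_trans ?_ h1
    gcongr
    exact Nat.le_mul_of_pos_right _ (by positivity)
  have hinit : initTime c q ≤ (26 * c + 102) * (n * q ^ 18 * S ^ 2) := by
    refine le_trans ?_ (Nat.mul_le_mul_left _ hqX)
    calc initTime c q ≤ q * (c * (3 * q + 10 * q) + 4 * q) + (c + 6) * (3 * q + 10 * q) * q +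
          20 * q ^ 2 := by
          unfold initTime
          have : 1 ≤ q ^ 2 := Nat.one_le_pow _ _ hq
          have h5 : (c + 6) * (3 * q + 10) ≤ (c + 6) * (3 * q + 10 * q) * q :=
            (Nat.mul_le_mul_left _ (by omega)).trans (Nat.le_mul_of_pos_right _ hq)
          gcongr <;> omega
      _ = _ := by ring
  set Z := S ^ 2 * q ^ 4
  set X := n * q ^ 18 * S ^ 2
  calc mainTime A c K m B q n W ≤ (26 * c + 102) * X +
        (K * (m * ((6 * levConst K m + 6 * A + 263) * X) + X) + X) +
        (w * (n * q ^ 2) * (levConst K m * Z + 11 * Z) + n * (levConst K m * Z + 21 * Z) + 2 * X) := by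
        unfold mainTime
        gcongr <;> omega
    _ = (26 * c + 102) * X +
        (K * (m * ((6 * levConst K m + 6 * A + 263) * X) + X) + X) +
        (w * (levConst K m + 11) * (n * q ^ 2 * Z) + (levConst K m + 21) * (n * Z) + 2 * X) := by
        ring
    _ ≤ (26 * c + 102) * X +
        (K * (m * ((6 * levConst K m + 6 * A + 263) * X) + X) + X) +
        (w * (levConst K m + 11) * X + (levConst K m + 21) * X + 2 * X) := by
        gcongr
    _ = _ := by
        unfold mainConst
        ring

theorem boundOK_mul_pow (hn : 1 ≤ n) (hqn : q ≤ n) :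
    BoundOK K A q (q ^ 4) n ((A + K + 4) * n ^ (c + 5)) := by
  have h4 : q ^ 4 ≤ n ^ 4 := Nat.pow_le_pow_left hqn 4
  have hp : ∀ i ≤ 5, n ^ i ≤ n ^ (c + 5) := fun i hi => Nat.pow_le_pow_right hn (by omega)
  have h0 := hp 0 (by norm_num)
  have h1 := hp 1 (by norm_num)
  have h5 := hp 5 le_rfl
  have h45 := hp 4 (by norm_num)
  have h2 := hp 2 (by norm_num)
  set N := n ^ (c + 5)
  have hAn : A * n ≤ A * N := Nat.mul_le_mul_left _ (by simpa using h1)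
  have hK : K * 1 ≤ K * N := Nat.mul_le_mul_left _ h0
  have hA : A * 1 ≤ A * N := Nat.mul_le_mul_left _ h0
  have hqn2 : q * n ≤ N := (Nat.mul_le_mul_right _ hqn).trans (by rwa [← pow_two])
  have hMn : q ^ 4 * n ≤ N := (Nat.mul_le_mul_right _ h4).trans (by rwa [← pow_succ])
  have hMq : q ^ 4 * q ≤ N := (Nat.mul_le_mul h4 hqn).trans (by rwa [← pow_succ])
  have e : (A + K + 4) * N = A * N + K * N + 4 * N := by ring
  rw [pow_zero] at h0
  rw [pow_one] at h1
  unfold BoundOK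
  rw [e, add_mul]
  refine ⟨?_, ?_, ?_, ?_, ?_⟩ <;> omega

/-- For large `n` by the choice of the table, and for small `n` trivially. -/
theorem sum_walkLen_finalTab_le (hn : 1 ≤ n) (hq : 1 ≤ q) (hnq : n ≤ q ^ c)
    (π : Equiv.Perm (Elem n)) :
    ∑ x, walkLen (level (2 * c + 1) (2 * c + 1) q
      (finalTab (2 * c + 1) (2 * c + 1) hn π (c + 3) q)) π n x ≤
      (2 * (2 * c + 1) + (16 + ((2 * c + 1) * (c + 3)) ^ 2) ^ c) * (n * q ^ 2) := by
  have hq2 : 1 ≤ q ^ 2 := Nat.one_le_pow _ _ hq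
  by_cases h : 16 + ((2 * c + 1) * (c + 3)) ^ 2 ≤ q
  · have hD : (c + 3) ^ 2 ≤ q := by
      refine le_trans (Nat.pow_le_pow_left (Nat.le_mul_of_pos_left _ (by omega)) 2)
        ((Nat.le_add_left _ _).trans h)
    calc _ ≤ (2 * c + 1) * (n * (q ^ 2 + 1)) :=
          sum_walkLen_le
            (fun x => level_finalTab_lt (by omega) hnq (by omega) (by omega) x)
            (fun r hr x => not_unfinished_finalTab (by omega) hnq hr hD x)
      _ ≤ (2 * c + 1) * (n * (2 * q ^ 2)) := by
          gcongr
          omega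
      _ = 2 * (2 * c + 1) * (n * q ^ 2) := by ring
      _ ≤ _ := Nat.mul_le_mul_right _ (by omega)
  · calc _ ≤ n * n := sum_walkLen_le_sq _ _ _
      _ ≤ (16 + ((2 * c + 1) * (c + 3)) ^ 2) ^ c * (n * q ^ 2) := by
          rw [mul_comm n n]
          exact Nat.mul_le_mul (hnq.trans (Nat.pow_le_pow_left (by omega) c))
            (Nat.le_mul_of_pos_right _ hq2)
      _ ≤ _ := Nat.mul_le_mul_right _ (by omega)

end

/-- By minimality `(root - 1) ^ c < n`, so the root is at most `n ^ (1/c) + 1`. The root `1` is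
separate, since minimality speaks only of positive candidates. -/
theorem root_le_rpow {n c : ℕ} (hn : 1 ≤ n) (hc : 1 ≤ c) :
    (root n hc : ℝ) ≤ 2 * (n : ℝ) ^ (1 / (c : ℝ)) := by
  have hn' : (1 : ℝ) ≤ n := by exact_mod_cast hn
  have h1 : (1 : ℝ) ≤ (n : ℝ) ^ (1 / (c : ℝ)) := Real.one_le_rpow hn' (by positivity)
  have hpos := root_pos n hc
  rcases Nat.lt_or_ge (root n hc) 2 with h | h
  · have : root n hc = 1 := by omega
    rw [this]
    push_cast
    linarith
  · have h2 : (root n hc - 2 + 1) ^ c < n := pow_lt_of_lt_root hc (by omega)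
    rw [show root n hc - 2 + 1 = root n hc - 1 by omega] at h2
    have h3 : ((root n hc - 1 : ℕ) : ℝ) ≤ (n : ℝ) ^ (1 / (c : ℝ)) := by
      rw [one_div, Real.le_rpow_inv_iff_of_pos (by positivity) (by positivity)
        (by exact_mod_cast hc), Real.rpow_natCast]
      exact_mod_cast h2.le
    rw [Nat.cast_sub hpos] at h3
    push_cast at h3
    linarith

theorem size_le_logb {D e n : ℕ} (hD : 1 ≤ D) (hn : 1 ≤ n) :
    ((Nat.size (D * n ^ e) : ℕ) : ℝ) ≤ (1 + D + e) * Real.logb 2 ((n : ℝ) + 1) := by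
  have hn' : (1 : ℝ) ≤ n := by exact_mod_cast hn
  have hD' : (1 : ℝ) ≤ D := by exact_mod_cast hD
  have hlog : (1 : ℝ) ≤ Real.logb 2 ((n : ℝ) + 1) := by
    rw [Real.le_logb_iff_rpow_le (by norm_num) (by positivity)]
    norm_num
    linarith
  have hpos : 0 < D * n ^ e := by positivity
  have h1 : Nat.size (D * n ^ e) = Nat.log 2 (D * n ^ e) + 1 := by
    refine le_antisymm (Nat.size_le.2 (Nat.lt_pow_succ_log_self (by norm_num) _)) ?_
    exact Nat.lt_size.2 (Nat.pow_log_le_self 2 hpos.ne')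
  have h2 : ((Nat.log 2 (D * n ^ e) : ℕ) : ℝ) ≤ Real.logb 2 ((D * n ^ e : ℕ) : ℝ) := by
    have := Real.natLog_le_logb (D * n ^ e) 2
    exact_mod_cast this
  have h3 : Real.logb 2 ((D * n ^ e : ℕ) : ℝ) = Real.logb 2 D + e * Real.logb 2 n := by
    push_cast
    rw [Real.logb_mul (by positivity) (by positivity), Real.logb_pow]
  have h4 : Real.logb 2 D ≤ D := by
    rw [Real.logb_le_iff_le_rpow (by norm_num) (by positivity), Real.rpow_natCast]
    exact_mod_cast Nat.lt_two_pow_self.le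
  have h5 : Real.logb 2 n ≤ Real.logb 2 ((n : ℝ) + 1) :=
    Real.logb_le_logb_of_le (by norm_num) (by positivity) (by linarith)
  rw [h1]
  push_cast
  rw [h3] at h2
  have h6 := mul_le_mul_of_nonneg_left h5 (Nat.cast_nonneg (α := ℝ) e)
  nlinarith

theorem logb_le_rpow {δ : ℝ} (hδ : 0 < δ) {n : ℕ} (hn : 1 ≤ n) :
    Real.logb 2 ((n : ℝ) + 1) ≤ 2 ^ δ / δ / Real.log 2 * (n : ℝ) ^ δ := by
  have hn' : (1 : ℝ) ≤ n := by exact_mod_cast hn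
  have h2 : 0 < Real.log 2 := Real.log_pos (by norm_num)
  rw [Real.logb, div_mul_eq_mul_div]
  gcongr
  rw [div_mul_eq_mul_div, ← Real.mul_rpow (by norm_num) (by positivity)]
  refine (Real.log_le_rpow_div (by positivity) hδ).trans ?_
  gcongr
  linarith

end CycleLeaders

/-! ### Choice of the constants -/

open CycleLeaders in
theorem mainTheorem1 (ε : ℝ) (hε : 0 < ε) :
    ∃ (k : ℕ) (p : CycleLeaders.Prog k) (C : ℝ),
      ∀ n : ℕ, 1 ≤ n → ∀ π : Equiv.Perm (CycleLeaders.Elem n),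
        ∃ (σ : CycleLeaders.State k) (t s : ℕ) (out : List (CycleLeaders.Elem n)),
          CycleLeaders.Exec π p (fun _ => 0) σ t s out ∧
          CycleLeaders.IsLeaderList π out ∧
          (t : ℝ) ≤ C * (n : ℝ) ^ (1 + ε) ∧
          (s : ℝ) ≤ C * Real.logb 2 ((n : ℝ) + 1) := by
  -- With this `c` the factor `q ^ 18`, about `n ^ (18/c)`, costs at most `n ^ (ε/2)` up to a
  -- constant. The other `ε/2` pays for the squared logarithm, estimated by `n ^ (ε/4)` before
  -- squaring.
  set c : ℕ := ⌈36 / ε⌉₊ with hc_def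
  have hc : 1 ≤ c := Nat.succ_le_of_lt (Nat.ceil_pos.2 (by positivity))
  have hcε : 18 / (c : ℝ) ≤ ε / 2 := by
    have h1 : 36 / ε ≤ c := Nat.le_ceil _
    have h2 : (0 : ℝ) < c := by exact_mod_cast hc
    rw [div_le_iff₀ hε] at h1
    rw [div_le_iff₀ h2]
    linarith
  set K := 2 * c + 1
  -- The factor in the register bound of `boundOK_mul_pow`, with `A = c + 3`.
  set D := c + 3 + K + 4
  set F : ℝ := 1 + D + ((c + 5 : ℕ) : ℝ)
  set G : ℝ := 2 ^ (ε / 4) / (ε / 4) / Real.log 2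
  set T := mainConst (c + 3) c K K (2 * K + (16 + (K * (c + 3)) ^ 2) ^ c)
  have hlog2 : 0 < Real.log 2 := Real.log_pos (by norm_num)
  have hF : 0 ≤ F := by positivity
  have hG : 0 ≤ G := by positivity
  have hC1 : 0 ≤ T * (2 ^ 18 * (F * G) ^ 2) := by positivity
  have hC2 : 0 ≤ numRegs K K * F := mul_nonneg (Nat.cast_nonneg _) hF
  refine ⟨numRegs K K, mainP (K := K) (m := K) (c + 3) c,
    T * (2 ^ 18 * (F * G) ^ 2) + numRegs K K * F, fun n hn π => ?_⟩
  have hn' : (1 : ℝ) ≤ n := by exact_mod_cast hn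
  have hn0 : (0 : ℝ) < n := by linarith
  have hqn := root_le hn hc
  have hq1 := root_pos n hc
  have hspec := le_root_pow n hc
  have hrpow := root_le_rpow hn hc
  obtain ⟨σ, t, ht, s, hs, hexec⟩ := exec_mainP (K := K) (m := K) (A := c + 3) hn hc π
    (boundOK_mul_pow (c := c) hn hqn)
    ((Nat.pow_le_pow_right hn (by omega)).trans (Nat.le_mul_of_pos_left _ (by omega)))
  set q := root n hc
  have hSlog : ((Nat.size (D * n ^ (c + 5)) : ℕ) : ℝ) ≤ F * Real.logb 2 ((n : ℝ) + 1) :=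
    size_le_logb (by omega) hn
  have hlog0 : 0 ≤ Real.logb 2 ((n : ℝ) + 1) := Real.logb_nonneg (by norm_num) (by linarith)
  have hrp : (0 : ℝ) ≤ (n : ℝ) ^ (1 + ε) := by positivity
  have hS1 : 1 ≤ Nat.size (D * n ^ (c + 5)) := Nat.size_pos.2 (by positivity)
  refine ⟨σ, t, s, _, hexec, isLeaderList_leaders hn _ π, ?_, ?_⟩
  · have h1 := ht.trans (mainTime_le le_rfl hS1 hq1 hn (sum_walkLen_finalTab_le hn hq1 hspec π))
    have h2 : (t : ℝ) ≤ T * (n * q ^ 18 * ((Nat.size (D * n ^ (c + 5)) : ℕ) : ℝ) ^ 2) := by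
      exact_mod_cast h1
    have h3 : (q : ℝ) ^ 18 ≤ 2 ^ 18 * (n : ℝ) ^ (ε / 2) := by
      calc (q : ℝ) ^ 18 ≤ (2 * (n : ℝ) ^ (1 / (c : ℝ))) ^ 18 := by gcongr
        _ = 2 ^ 18 * (n : ℝ) ^ (18 / (c : ℝ)) := by
            rw [mul_pow, ← Real.rpow_natCast ((n : ℝ) ^ (1 / (c : ℝ))), ← Real.rpow_mul hn0.le]
            congr 2
            push_cast
            ring
        _ ≤ _ := by
            gcongr
    have h4 : ((Nat.size (D * n ^ (c + 5)) : ℕ) : ℝ) ^ 2 ≤ (F * G) ^ 2 * (n : ℝ) ^ (ε / 2) := by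
      calc ((Nat.size (D * n ^ (c + 5)) : ℕ) : ℝ) ^ 2 ≤ (F * (G * (n : ℝ) ^ (ε / 4))) ^ 2 := by
            gcongr
            refine hSlog.trans (mul_le_mul_of_nonneg_left ?_ hF)
            exact logb_le_rpow (by positivity) hn
        _ = _ := by
            rw [← mul_assoc, mul_pow (F * G), ← Real.rpow_natCast ((n : ℝ) ^ (ε / 4)),
              ← Real.rpow_mul hn0.le]
            congr 2
            push_cast
            ring
    calc (t : ℝ) ≤ T * (n * (2 ^ 18 * (n : ℝ) ^ (ε / 2)) * ((F * G) ^ 2 * (n : ℝ) ^ (ε / 2))) := by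
          refine h2.trans ?_
          gcongr
      _ = T * (2 ^ 18 * (F * G) ^ 2) * (n * ((n : ℝ) ^ (ε / 2) * (n : ℝ) ^ (ε / 2))) := by ring
      _ = T * (2 ^ 18 * (F * G) ^ 2) * (n : ℝ) ^ (1 + ε) := by
          rw [← Real.rpow_add hn0, Real.rpow_add hn0 1 ε, Real.rpow_one, add_halves]
      _ ≤ _ := by
          gcongr
          linarith
  · calc (s : ℝ) ≤ (numRegs K K * Nat.size (D * n ^ (c + 5)) : ℕ) := Nat.cast_le.2 hs
      _ = numRegs K K * ((Nat.size (D * n ^ (c + 5)) : ℕ) : ℝ) := Nat.cast_mul _ _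
      _ ≤ numRegs K K * (F * Real.logb 2 ((n : ℝ) + 1)) :=
          mul_le_mul_of_nonneg_left hSlog (Nat.cast_nonneg _)
      _ = numRegs K K * F * Real.logb 2 ((n : ℝ) + 1) := (mul_assoc _ _ _).symm
      _ ≤ _ := mul_le_mul_of_nonneg_right (by linarith) hlog0
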